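/- **Setting.** Let $G$ be a finite connected loopless multigraph with at least one edge. A *relaxed BC tree* of $G$ is a tree whose nodes are labelled $B$ or $C$ and carry skeleton subgraphs $\Gamma(v)\subseteq G$ such that: every edge of $G$ lies in exactly one skeleton; the skeletons of adjacent nodes share a vertex and no two $B$ nodes are adjacent; the skeleton of a $B$ node is a single edge or a biconnected graph; the skeleton of a $C$ node is a single vertex, an articulation point of $G$; for each vertex $x$ of $G$, the nodes containing $x$ are connected in the tree, and so are the $C$ nodes containing $x$. It is *strict* if moreover no two $C$ nodes are adjacent. A *path decomposition* of a rooted tree marks every edge solid or dashed such that each node has at most one solid child. For a vertex $x$ let $b(x)$ be the $C$ node containing $x$ furthest from the root, or, if there is none, the $B$ node containing $x$; put $w(v)=|b^{-1}(v)|$ and let $w(T_v)$ be the total weight of the subtree rooted in $v$. A child $c$ of $p$ and the edge $(c,p)$ are *heavy* if $w(T_p)<2w(T_c)$. The decomposition is *proper* if exactly the heavy edges are solid. It is *$u$-exposed* if an edge $(v,p(v))$ is solid iff it lies on the path $P$ from the root to $u$, or $p(v)\notin P$ and the edge is heavy. A node is *primary* if it is the root, a $B$ node, or a $C$ node with a $B$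 parent, and *secondary* otherwise. A $C$ node is *splittable* if it has a parent, a solid child and at least two dashed children. A node is *mergeable* if it has a secondary child. A dashed edge $(c,p(c))$ is *stable* if $p(c)$ is a $B$ node, or $p(c)$ is a $C$ node incident to exactly two solid edges and $c$ has no dashed sibling; other dashed edges are *unstable*. *Split* (of a splittable primary node $v$): the dashed children of $v$ become the children of one new dashed secondary child $c$ of $v$, and precisely the heavy child of $c$ (if any) becomes its solid child. *Merge* (of a mergeable primary node $v$): for each secondary child $c$ of $v$, make the solid child edge of $c$ (if any) dashed in case $(c,v)$ is dashed, and contract $(c,v)$. Given a strict BC tree $T$ with a $u$-exposed (or proper) heavy path decomposition, a *pre-split BC tree* corresponding to $T$ is a relaxed BC tree $T'$ of $G$ with a $u$-exposed (or proper) heavy path decomposition such that contracting every secondary node into its nearest primary ancestor (making the edges from secondary nodes to their children dashed) gives $T$ with its decomposition, and such that: (1) no node is both splittable and mergeable; (2) each secondary node has at least two children and is a dashed child of a primary node that has a parent and a solid child; (3) neither the root nor a primary node with a solid or unstable parent edge is splittable; (4) no primary node with a stable parent edge is mergeable. **Operations.** expose$(u)$ turns a proper decomposition into a $u$-exposed one,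 conceil does the opposite; reverse makes a $u$-exposed tree with root $r$ into an $r$-exposed tree with root $u$; link-exposed$(v,u)$ joins a proper tree with root $v$ to a node-disjoint $u$-exposed tree, where the two graphs share exactly one vertex $x$, and $x\in\Gamma(v)\cap\Gamma(u)$, by making $u$ the dashed parent of $v$, with $u$-exposed result (in the strict tree, $v$ is then contracted into $u$ if both are $C$ nodes); cut-exposed$(v)$ deletes the edge between $v$ and its parent $u$ in a $u$-exposed tree, leaving a proper tree with root $v$ and a $u$-exposed tree. Links and cuts are considered when the resulting strict tree(s) are again strict BC trees, namely of the union of the two graphs, respectively of the two parts. **Theorem.** There is a universal constant $K$ such that the following holds for each of the operations expose, conceil, reverse, link-exposed, cut-exposed. Suppose the operation is performed on one strict BC tree (for link-exposed: two), and let $d$ be the number of edges that thereby change from solid to dashed or vice versa in the strict tree(s); for link-exposed, the newly created dashed edge is counted in $d$ as well, and if $v$ is contracted into $u$, then the edges at $v$ are identified with the resulting edges at $u$. Take any corresponding pre-split BC tree(s) (for link-exposed: on disjoint node sets). Then the underlying tree operation (re-rooting, linking or cutting, with edges keeping their status; nothing for expose and conceil) can be performed on the pre-split tree(s), and the result can be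 transformed into pre-split BC tree(s) corresponding to the resulting strict tree(s) by a sequence of splits, merges and individual status changes of edges between two primary nodes, where individual status changes are made only to edges that change their status in the strict tree(s), at most once to each, and the number of splits and merges is at most $K\,d$. -/

import Mathlib

open scoped Graph

namespace BCT

universe u v w

/-! ### Multigraphs -/

/-- A multigraph is connected if it has a vertex and any two vertices are joined by a walk. -/
def GConnected {α : Type v} {β : Type w} (G : Graph α β) : Prop :=
  V(G).Nonempty ∧ ∀ x ∈ V(G), ∀ y ∈ V(G), Relation.ReflTransGen G.Adj x y

/-- `x` is an articulation point of `G` if `G - x` is not connected. -/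
def IsArticulation {α : Type v} {β : Type w} (G : Graph α β) (x : α) : Prop :=
  x ∈ V(G) ∧ ¬ GConnected (G.deleteVerts {x})

/-- The graphs allowed at `B` nodes: connected, at least two vertices, no articulation point.
For loopless graphs these are the single edge and the (larger) biconnected graphs. -/
def IsBlockGraph {α : Type v} {β : Type w} (H : Graph α β) : Prop :=
  V(H).Nontrivial ∧ GConnected H ∧ ∀ x, ¬ IsArticulation H x

/-- Finite connected loopless multigraphs with at least one edge. -/
structure IsBaseGraph {α : Type v} {β : Type w} (G : Graph α β) : Prop where
  finite_vertices : V(G).Finite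
  finite_edges : E(G).Finite
  loopless : G.Loopless
  connected : GConnected G
  edge_nonempty : E(G).Nonempty

/-- `G` is the union of two subgraphs that share exactly the vertex `x` (and no edge). -/
structure IsUnionAt {α : Type v} {β : Type w} (G G₁ G₂ : Graph α β) (x : α) : Prop where
  left_le : G₁ ≤ G
  right_le : G₂ ≤ G
  vertices : V(G) = V(G₁) ∪ V(G₂)
  edges : E(G) = E(G₁) ∪ E(G₂)
  inter_vertices : V(G₁) ∩ V(G₂) = {x}
  inter_edges : E(G₁) ∩ E(G₂) = ∅

/-! ### Rooted labelled trees with a path decomposition -/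

/-- The two labels of the nodes of a BC tree. -/
inductive Kind where
  | B : Kind
  | C : Kind

/-- A finite rooted tree whose nodes carry a label `B` or `C` and a skeleton graph, together with a
(naive) path decomposition: every edge is solid or dashed, and every node has at most one solid
child. An edge `(a, p(a))` is referred to by its lower end `a`; it is solid iff `a ∈ solid`. -/
structure PDTree (ν : Type u) (α : Type v) (β : Type w) where
  nodes : Finset ν
  root : ν
  parent : ν → Option ν
  kind : ν → Kind
  skel : ν → Graph α β
  solid : Set ν
  root_mem : root ∈ nodes
  parent_root : parent root = none
  mem_of_parent : ∀ a b, parent a = some b → a ∈ nodes ∧ b ∈ nodes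
  reaches_root : ∀ a ∈ nodes, Relation.ReflTransGen (fun a b => parent a = some b) a root
  parent_of_solid : ∀ a ∈ solid, ∃ b, parent a = some b
  solid_unique : ∀ a ∈ solid, ∀ b ∈ solid, parent a = parent b → a = b

namespace PDTree

variable {ν : Type u} {α : Type v} {β : Type w}

/-- `S.Below a b`: `a` lies in the subtree rooted in `b` (possibly `a = b`). -/
def Below (S : PDTree ν α β) (a b : ν) : Prop :=
  Relation.ReflTransGen (fun a b => S.parent a = some b) a b

/-- Adjacency in the unrooted tree. -/
def TAdj (S : PDTree ν α β) (a b : ν) : Prop :=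
  S.parent a = some b ∨ S.parent b = some a

/-- `a` is a dashed child of `b`. -/
def DashedChild (S : PDTree ν α β) (a b : ν) : Prop :=
  S.parent a = some b ∧ a ∉ S.solid

/-- `a` is a solid child of `b`. -/
def SolidChild (S : PDTree ν α β) (a b : ν) : Prop :=
  S.parent a = some b ∧ a ∈ S.solid

/-- The set of solid edges, as unordered pairs of nodes. -/
def solidEdges (S : PDTree ν α β) : Set (Sym2 ν) :=
  {e | ∃ a b, S.SolidChild a b ∧ e = s(a, b)}

/-! #### Weights, heavy edges, exposed and proper heavy path decompositions -/

/-- `b(x) = a`: `a` is the `C` node furthest from the root containing `x` if some `C` node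
contains `x`, and otherwise `a` is the `B` node containing `x`. -/
def IsHome (S : PDTree ν α β) (x : α) (a : ν) : Prop :=
  a ∈ S.nodes ∧ x ∈ V(S.skel a) ∧
    ((S.kind a = Kind.C ∧
        ∀ b ∈ S.nodes, S.kind b = Kind.C → x ∈ V(S.skel b) → S.Below a b) ∨
      (S.kind a = Kind.B ∧ ∀ b ∈ S.nodes, S.kind b = Kind.C → x ∉ V(S.skel b)))

/-- The weight `w(a)` of a node: the number of vertices `x` with `b(x) = a`. -/
noncomputable def weight (S : PDTree ν α β) (a : ν) : ℕ :=
  {x | S.IsHome x a}.ncard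

open Classical in
/-- The total weight of the subtree rooted in `a`. -/
noncomputable def subtreeWeight (S : PDTree ν α β) (a : ν) : ℕ :=
  ∑ b ∈ S.nodes.filter (fun b => S.Below b a), S.weight b

/-- The child `a` (and its parent edge) is heavy if `w(T_p) < 2 w(T_a)` where `p = p(a)`. -/
def Heavy (S : PDTree ν α β) (a : ν) : Prop :=
  ∃ p, S.parent a = some p ∧ S.subtreeWeight p < 2 * S.subtreeWeight a

/-- A proper heavy path decomposition: an edge is solid iff it is heavy. -/
def IsProper (S : PDTree ν α β) : Prop :=
  ∀ a p, S.parent a = some p → (a ∈ S.solid ↔ S.Heavy a)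

/-- An `e`-exposed heavy path decomposition: an edge `(a, p(a))` is solid iff it lies on the path
from the root to `e`, or `p(a)` is not on this path and the edge is heavy. -/
def IsExposed (S : PDTree ν α β) (e : ν) : Prop :=
  e ∈ S.nodes ∧ ∀ a p, S.parent a = some p →
    (a ∈ S.solid ↔ (S.Below e a ∨ (¬ S.Below e p ∧ S.Heavy a)))

/-- `IsHPD none`: proper; `IsHPD (some e)`: `e`-exposed. -/
def IsHPD (S : PDTree ν α β) : Option ν → Prop
  | none => S.IsProper
  | some e => S.IsExposed e

/-! #### Relaxed and strict BC trees -/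

/-- `S` is a relaxed BC tree of `G`. The last two fields say that `S` is a tree decomposition (the
nodes containing a given vertex are connected) and that the `C` nodes representing one and the
same vertex are connected among themselves, so that contracting all edges between `C` nodes leaves
one `C` node for that vertex. -/
structure IsRelaxedBC (G : Graph α β) (S : PDTree ν α β) : Prop where
  base : IsBaseGraph G
  skel_le : ∀ a ∈ S.nodes, S.skel a ≤ G
  edge_unique : ∀ e ∈ E(G), ∃! a, a ∈ S.nodes ∧ e ∈ E(S.skel a)
  common_vertex : ∀ a b, S.parent a = some b → (V(S.skel a) ∩ V(S.skel b)).Nonempty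
  not_both_B : ∀ a b, S.parent a = some b → S.kind a = Kind.C ∨ S.kind b = Kind.C
  skel_B : ∀ a ∈ S.nodes, S.kind a = Kind.B → IsBlockGraph (S.skel a)
  skel_C : ∀ a ∈ S.nodes, S.kind a = Kind.C → ∃ x, V(S.skel a) = {x} ∧ IsArticulation G x
  connected : ∀ x, ∀ a ∈ S.nodes, ∀ b ∈ S.nodes, x ∈ V(S.skel a) → x ∈ V(S.skel b) →
    Relation.ReflTransGen (fun c d => S.TAdj c d ∧ x ∈ V(S.skel d)) a b
  connected_C : ∀ x, ∀ a ∈ S.nodes, ∀ b ∈ S.nodes, S.kind a = Kind.C → S.kind b = Kind.C →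
    x ∈ V(S.skel a) → x ∈ V(S.skel b) →
    Relation.ReflTransGen (fun c d => S.TAdj c d ∧ S.kind d = Kind.C ∧ x ∈ V(S.skel d)) a b

/-- `S` is the strict BC tree of `G`: moreover, no two `C` nodes are neighbours. -/
structure IsStrictBC (G : Graph α β) (S : PDTree ν α β) : Prop extends IsRelaxedBC G S where
  not_both_C : ∀ a b, S.parent a = some b → S.kind a = Kind.B ∨ S.kind b = Kind.B

/-! #### Primary, splittable, mergeable, stable -/

/-- A node is primary if it is the root, a `B` node, or a `C` node whose parent is a `B` node. -/
def Primary (S : PDTree ν α β) (a : ν) : Prop :=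
  a ∈ S.nodes ∧ (a = S.root ∨ S.kind a = Kind.B ∨ ∃ p, S.parent a = some p ∧ S.kind p = Kind.B)

/-- All nodes that are not primary are secondary. -/
def Secondary (S : PDTree ν α β) (a : ν) : Prop :=
  a ∈ S.nodes ∧ ¬ S.Primary a

/-- A `C` node with a parent, a solid child, and at least two dashed children. -/
def Splittable (S : PDTree ν α β) (a : ν) : Prop :=
  a ∈ S.nodes ∧ S.kind a = Kind.C ∧ (∃ p, S.parent a = some p) ∧ (∃ c, S.SolidChild c a) ∧
    ∃ c d, c ≠ d ∧ S.DashedChild c a ∧ S.DashedChild d a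

/-- A node with a secondary child. -/
def Mergeable (S : PDTree ν α β) (a : ν) : Prop :=
  ∃ c, S.parent c = some a ∧ S.Secondary c

/-- The number of solid edges incident to a node. -/
noncomputable def solidDegree (S : PDTree ν α β) (a : ν) : ℕ :=
  {e | e ∈ S.solidEdges ∧ a ∈ e}.ncard

/-- The edge `(a, p(a))` is stable: it is dashed, and `p(a)` is a `B` node, or a `C` node of solid
degree 2 such that `a` has no dashed sibling. -/
def StableEdge (S : PDTree ν α β) (a : ν) : Prop :=
  ∃ p, S.DashedChild a p ∧
    (S.kind p = Kind.B ∨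
      (S.kind p = Kind.C ∧ S.solidDegree p = 2 ∧ ∀ c, S.DashedChild c p → c = a))

/-- The edge `(a, p(a))` is dashed but not stable. -/
def UnstableEdge (S : PDTree ν α β) (a : ν) : Prop :=
  (∃ p, S.DashedChild a p) ∧ ¬ S.StableEdge a

/-- The four pre-splitting invariants. -/
structure PreSplitInvariants (S : PDTree ν α β) : Prop where
  /-- No node is both splittable and mergeable. -/
  not_both : ∀ a, ¬ (S.Splittable a ∧ S.Mergeable a)
  /-- Each secondary node has at least two children, and is a dashed child of a primary node which
  has both a parent and a solid child. -/
  secondary : ∀ a, S.Secondary a →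
    (∃ c d, c ≠ d ∧ S.parent c = some a ∧ S.parent d = some a) ∧
    ∃ p, S.DashedChild a p ∧ S.Primary p ∧ (∃ q, S.parent p = some q) ∧ ∃ c, S.SolidChild c p
  /-- The root, and each primary node with a solid or unstable parent edge, is not splittable. -/
  split_rule : ∀ a, S.Primary a → (a = S.root ∨ a ∈ S.solid ∨ S.UnstableEdge a) → ¬ S.Splittable a
  /-- A primary node with a stable parent edge is not mergeable. -/
  merge_rule : ∀ a, S.Primary a → S.StableEdge a → ¬ S.Mergeable a

/-! #### The strict tree corresponding to a relaxed tree -/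

/-- The labelled rooted tree `T` arises from `R` by contracting each secondary node into the nearest
primary ancestor; its nodes are the primary nodes of `R`. -/
structure IsContraction (T R : PDTree ν α β) : Prop where
  mem_nodes : ∀ a, a ∈ T.nodes ↔ R.Primary a
  root_eq : T.root = R.root
  kind_eq : ∀ a ∈ T.nodes, T.kind a = R.kind a
  skel_eq : ∀ a ∈ T.nodes, T.skel a = R.skel a
  parent_iff : ∀ a p, T.parent a = some p ↔ R.Primary a ∧ R.Primary p ∧ ∃ q, R.parent a = some q ∧
    Relation.ReflTransGen (fun c d => R.Secondary c ∧ R.parent c = some d) q p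

/-- `T` is the tree with path decomposition corresponding to `R`: secondary nodes are contracted as
above, where the edges from secondary nodes to their children become dashed, and the edges between
primary nodes keep their status. -/
structure Corresponds (T R : PDTree ν α β) : Prop extends IsContraction T R where
  solid_iff : ∀ a ∈ T.nodes, (a ∈ T.solid ↔ a ∈ R.solid ∧ ∃ q, R.parent a = some q ∧ R.Primary q)

/-- `R` is the pre-split BC tree corresponding to the strict BC tree `T` of `G`, where `T` has an
`e`-exposed (`e = some _`) or proper (`e = none`) heavy path decomposition. -/
structure IsPreSplit (G : Graph α β) (e : Option ν) (T R : PDTree ν α β) : Prop where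
  strict : IsStrictBC G T
  strict_hpd : T.IsHPD e
  relaxed : IsRelaxedBC G R
  relaxed_hpd : R.IsHPD e
  corresponds : Corresponds T R
  invariants : R.PreSplitInvariants

/-! #### Elementary changes of relaxed trees -/

/-- Changing the edge `(c, p)` between two primary nodes from solid to dashed or vice versa. -/
structure IsFlip (S : PDTree ν α β) (c p : ν) (S' : PDTree ν α β) : Prop where
  parent_c : S.parent c = some p
  primary_c : S.Primary c
  primary_p : S.Primary p
  nodes_eq : S'.nodes = S.nodes
  root_eq : S'.root = S.root
  parent_eq : S'.parent = S.parent
  kind_eq : ∀ a ∈ S.nodes, S'.kind a = S.kind a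
  skel_eq : ∀ a ∈ S.nodes, S'.skel a = S.skel a
  solid_c : c ∈ S'.solid ↔ c ∉ S.solid
  solid_eq : ∀ a, a ≠ c → (a ∈ S'.solid ↔ a ∈ S.solid)

/-- `split(a)` for a splittable primary node `a`: the dashed children of `a` are replaced by a single
new dashed secondary child `n`, which inherits them; if `n` has a heavy child, then the edge to it
becomes solid, and all other child edges of `n` are dashed. -/
structure IsSplit (S : PDTree ν α β) (a : ν) (S' : PDTree ν α β) : Prop where
  primary : S.Primary a
  splittable : S.Splittable a
  exists_new : ∃ n, n ∉ S.nodes ∧ (∀ b, b ∈ S'.nodes ↔ b = n ∨ b ∈ S.nodes) ∧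
    S'.root = S.root ∧
    (∀ b ∈ S.nodes, S'.kind b = S.kind b ∧ S'.skel b = S.skel b) ∧
    S'.kind n = Kind.C ∧ S'.skel n = S.skel a ∧
    S'.parent n = some a ∧ n ∉ S'.solid ∧
    (∀ b ∈ S.nodes, S.DashedChild b a → S'.parent b = some n ∧ (b ∈ S'.solid ↔ S'.Heavy b)) ∧
    (∀ b ∈ S.nodes, ¬ S.DashedChild b a →
      S'.parent b = S.parent b ∧ (b ∈ S'.solid ↔ b ∈ S.solid))

/-- `merge(a)` for a mergeable primary node `a`: for each secondary child `c` of `a`, if `(c, a)` is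
dashed, then the solid child edge of `c` (if any) becomes dashed; then `(c, a)` is contracted. -/
structure IsMerge (S : PDTree ν α β) (a : ν) (S' : PDTree ν α β) : Prop where
  primary : S.Primary a
  mergeable : S.Mergeable a
  mem_nodes : ∀ b, b ∈ S'.nodes ↔ b ∈ S.nodes ∧ ¬ (S.parent b = some a ∧ S.Secondary b)
  root_eq : S'.root = S.root
  kind_eq : ∀ b ∈ S'.nodes, S'.kind b = S.kind b
  skel_eq : ∀ b ∈ S'.nodes, S'.skel b = S.skel b
  moved : ∀ b ∈ S'.nodes, ∀ c, S.parent b = some c → S.parent c = some a → S.Secondary c →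
    S'.parent b = some a ∧ (b ∈ S'.solid ↔ b ∈ S.solid ∧ c ∈ S.solid)
  unmoved : ∀ b ∈ S'.nodes,
    (¬ ∃ c, S.parent b = some c ∧ S.parent c = some a ∧ S.Secondary c) →
    S'.parent b = S.parent b ∧ (b ∈ S'.solid ↔ b ∈ S.solid)

/-- `Steps S S' k l`: `S` is transformed into `S'` by a sequence of splits, merges and changes of the
status of single edges, with `k` splits and merges in total, where `l` lists the edges whose status
is changed (edges whose status changes as a part of a split or merge are not listed). -/
inductive Steps : PDTree ν α β → PDTree ν α β → ℕ → List (Sym2 ν) → Prop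
  | refl (S : PDTree ν α β) : Steps S S 0 []
  | flip {S S' S'' : PDTree ν α β} {k : ℕ} {l : List (Sym2 ν)} {c p : ν} :
      Steps S S' k l → IsFlip S' c p S'' → Steps S S'' k (s(c, p) :: l)
  | split {S S' S'' : PDTree ν α β} {k : ℕ} {l : List (Sym2 ν)} {a : ν} :
      Steps S S' k l → IsSplit S' a S'' → Steps S S'' (k + 1) l
  | merge {S S' S'' : PDTree ν α β} {k : ℕ} {l : List (Sym2 ν)} {a : ν} :
      Steps S S' k l → IsMerge S' a S'' → Steps S S'' (k + 1) l

/-! #### The effect of the operations on rooted trees -/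

/-- The same rooted labelled tree, possibly with another path decomposition. -/
structure SameTree (S S' : PDTree ν α β) : Prop where
  nodes_eq : S'.nodes = S.nodes
  root_eq : S'.root = S.root
  parent_eq : S'.parent = S.parent
  kind_eq : ∀ a ∈ S.nodes, S'.kind a = S.kind a
  skel_eq : ∀ a ∈ S.nodes, S'.skel a = S.skel a

/-- The same unrooted labelled tree, now rooted in `e`. -/
structure SameTreeRerooted (S : PDTree ν α β) (e : ν) (S' : PDTree ν α β) : Prop where
  nodes_eq : S'.nodes = S.nodes
  root_eq : S'.root = e
  adj_iff : ∀ a b, S'.TAdj a b ↔ S.TAdj a b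
  kind_eq : ∀ a ∈ S.nodes, S'.kind a = S.kind a
  skel_eq : ∀ a ∈ S.nodes, S'.skel a = S.skel a

/-- `S` is obtained from `S₁` (rooted in `a`) and `S₂` by making `e` the dashed parent of `a`. -/
structure IsLinked (S₁ S₂ : PDTree ν α β) (a e : ν) (S : PDTree ν α β) : Prop where
  disjoint : Disjoint S₁.nodes S₂.nodes
  root_left : S₁.root = a
  mem_right : e ∈ S₂.nodes
  mem_nodes : ∀ b, b ∈ S.nodes ↔ b ∈ S₁.nodes ∨ b ∈ S₂.nodes
  root_eq : S.root = S₂.root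
  parent_a : S.parent a = some e
  parent_left : ∀ b ∈ S₁.nodes, b ≠ a → S.parent b = S₁.parent b
  parent_right : ∀ b ∈ S₂.nodes, S.parent b = S₂.parent b
  kind_left : ∀ b ∈ S₁.nodes, S.kind b = S₁.kind b
  kind_right : ∀ b ∈ S₂.nodes, S.kind b = S₂.kind b
  skel_left : ∀ b ∈ S₁.nodes, S.skel b = S₁.skel b
  skel_right : ∀ b ∈ S₂.nodes, S.skel b = S₂.skel b
  solid_eq : S.solid = S₁.solid ∪ S₂.solid

/-- `S₁` (the subtree of `S` rooted in `a`) and `S₂` (the rest) are obtained from `S` by deleting the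
edge between `a` and its parent `e`; edges keep their status. -/
structure IsCut (S : PDTree ν α β) (a e : ν) (S₁ S₂ : PDTree ν α β) : Prop where
  parent_a : S.parent a = some e
  mem_left : ∀ b, b ∈ S₁.nodes ↔ S.Below b a
  mem_right : ∀ b, b ∈ S₂.nodes ↔ b ∈ S.nodes ∧ ¬ S.Below b a
  root_left : S₁.root = a
  root_right : S₂.root = S.root
  parent_left : ∀ b ∈ S₁.nodes, b ≠ a → S₁.parent b = S.parent b
  parent_right : ∀ b ∈ S₂.nodes, S₂.parent b = S.parent b
  kind_left : ∀ b ∈ S₁.nodes, S₁.kind b = S.kind b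
  kind_right : ∀ b ∈ S₂.nodes, S₂.kind b = S.kind b
  skel_left : ∀ b ∈ S₁.nodes, S₁.skel b = S.skel b
  skel_right : ∀ b ∈ S₂.nodes, S₂.skel b = S.skel b
  solid_left : ∀ b ∈ S₁.nodes, b ≠ a → (b ∈ S₁.solid ↔ b ∈ S.solid)
  solid_right : ∀ b ∈ S₂.nodes, (b ∈ S₂.solid ↔ b ∈ S.solid)

/-! #### The operations on strict trees -/

/-- expose`(e)`: a proper heavy path decomposition becomes `e`-exposed. -/
structure StrictExpose (T : PDTree ν α β) (e : ν) (T' : PDTree ν α β) : Prop where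
  before : T.IsProper
  same : SameTree T T'
  after : T'.IsExposed e

/-- conceil: an `e`-exposed heavy path decomposition becomes proper. -/
structure StrictConceil (T : PDTree ν α β) (e : ν) (T' : PDTree ν α β) : Prop where
  before : T.IsExposed e
  same : SameTree T T'
  after : T'.IsProper

/-- reverse`(r)`: an `e`-exposed heavy path decomposition with root `r` becomes an `r`-exposed one
with root `e`. -/
structure StrictReverse (T : PDTree ν α β) (e : ν) (T' : PDTree ν α β) : Prop where
  before : T.IsExposed e
  same : SameTreeRerooted T e T'
  after : T'.IsExposed T.root

/-- link-exposed`(a, e)` of the tree `T₁` with root `a` (proper) and the `e`-exposed tree `T₂`,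
resulting in an `e`-exposed tree. If `a` and `e` are both `C` nodes, then `a` is contracted into `e`;
otherwise the contraction changes nothing. -/
structure StrictLink (T₁ T₂ : PDTree ν α β) (a e : ν) (T' : PDTree ν α β) : Prop where
  before_left : T₁.IsProper
  before_right : T₂.IsExposed e
  linked : ∃ L, IsLinked T₁ T₂ a e L ∧ IsContraction T' L
  after : T'.IsExposed e

/-- cut-exposed`(a)` of an `e`-exposed tree `T`, where `e = p(a)`, resulting in the proper tree `T₁`
with root `a` and the `e`-exposed tree `T₂` with the old root. -/
structure StrictCut (T : PDTree ν α β) (a e : ν) (T₁ T₂ : PDTree ν α β) : Prop where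
  before : T.IsExposed e
  cut : ∃ L₁ L₂, IsCut T a e L₁ L₂ ∧ SameTree L₁ T₁ ∧ SameTree L₂ T₂
  after_left : T₁.IsProper
  after_right : T₂.IsExposed e

/-! #### Edges changing status -/

/-- The edges changing from solid to dashed or vice versa between two trees with the same edges. -/
def changed (T T' : PDTree ν α β) : Set (Sym2 ν) :=
  symmDiff T.solidEdges T'.solidEdges

open Classical in
/-- The edges of `T₁` and `T₂` changing status when `T₁` and `T₂` are linked to `T'` at `e`. The edges
at a node of `T₁` that has been contracted into `e` are identified with the resulting edges at `e`.
The new edge between `T₁` and `T₂` is not contained in this set. -/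
noncomputable def changedLink (T₁ T₂ : PDTree ν α β) (e : ν) (T' : PDTree ν α β) : Set (Sym2 ν) :=
  symmDiff
    (Sym2.map (fun b => if b ∈ T'.nodes then b else e) '' T₁.solidEdges ∪ T₂.solidEdges)
    T'.solidEdges

/-- The edges changing status when `T` is cut into `T₁` and `T₂`. -/
def changedCut (T T₁ T₂ : PDTree ν α β) : Set (Sym2 ν) :=
  symmDiff T.solidEdges (T₁.solidEdges ∪ T₂.solidEdges)

end PDTree

end BCT

/-!
# Maintaining pre-split BC trees

Let `T` be a strict BC tree. Since no two `C` nodes of `T` are adjacent, the parent of a `C` node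
that is not the root is a `B` node, so a dashed parent edge of a `C` node is always stable. Hence the
pre-splitting invariants determine the pre-split tree `R` of `T` up to the names of the secondary
nodes: `R` arises from `T` by splitting exactly the `C` nodes with a solid parent edge, a solid child
and at least two dashed children (`splitNodes`), each of them into itself and one new dashed child
that inherits the dashed children (`Splitting`). A vertex counted at a split node `v` in `T` is
counted at the new child of `v` in `R`. So subtree weights in `R` of nodes of `T` are those in `T`, and
the subtree of the new child weighs as much as `v` together with its dashed branches
(`branchWeight`); this decides which edge below the new child is solid (`InnerHeavy`). The lemmas
`IsPreSplit.exists_splitting` and `Splitting.isPreSplit` show that being pre-split is equivalent to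
this explicit description.

If only the path decomposition of `T` changes, whether `v` is split, and how, can only change if `v`
is an end of a changed edge. There are at most `2 d` such nodes for `d` changed edges. Merging the
split ones among them, changing the status of the `d` edges (first those becoming dashed, so that no
node ever has two solid children), and splitting those that are split nodes of the new tree takes at
most `4 d` merges and splits (`Splitting.exists_steps`).

The other operations reduce to this case. In the unrooted tree, split nodes are the `C` nodes incident
to two solid and at least two dashed edges, which re-rooting does not affect. Exposed nodes, roots and
nodes made children in a link have no split counterpart, so that re-rooting, linking and cutting
commute with splitting. The weights that matter are those of dashed branches; these do not meet the
path to the exposed node, and neither do they contain the ends of a new or deleted edge, so their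
weights remain the same (`subtreeWeight_congr`, `weight_eq_of_part`). If two `C` nodes are linked, the
lower one becomes a secondary child of the upper one, and a single additional merge contracts it.
-/

namespace BCT
namespace PDTree

universe u v w
variable {ν : Type u} {α : Type v} {β : Type w} {T T' R R' : PDTree ν α β} {S : Set ν} {n : ν → ν}
  {G : Graph α β}

/-! ### Rooted trees -/

lemma exists_parent {a : ν} (ha : a ∈ T.nodes) (hr : a ≠ T.root) : ∃ p, T.parent a = some p := by
  rcases Relation.ReflTransGen.cases_head (T.reaches_root a ha) with h | ⟨c, h, -⟩
  · exact absurd h hr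
  · exact ⟨c, h⟩

lemma ne_root {a b : ν} (h : T.parent a = some b) : a ≠ T.root := by
  rintro rfl
  simp [T.parent_root] at h

lemma mem_child {a b : ν} (h : T.parent a = some b) : a ∈ T.nodes := (T.mem_of_parent a b h).1

lemma mem_parent {a b : ν} (h : T.parent a = some b) : b ∈ T.nodes := (T.mem_of_parent a b h).2

lemma mem_of_solid {a : ν} (h : a ∈ T.solid) : a ∈ T.nodes := by
  obtain ⟨b, hb⟩ := T.parent_of_solid a h
  exact mem_child hb

lemma Below.of_parent {a b : ν} (h : T.parent a = some b) : T.Below a b :=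
  Relation.ReflTransGen.single h

lemma Below.mem_left {a b : ν} (h : T.Below a b) (hb : b ∈ T.nodes) : a ∈ T.nodes := by
  rcases Relation.ReflTransGen.cases_head h with rfl | ⟨c, h, -⟩
  · exact hb
  · exact mem_child h

/-- The parent relation has no cycles: on a cycle, every ancestor would lie on the cycle, and so
would the root, which has no parent. -/
lemma not_below_of_parent {a b : ν} (h : T.parent a = some b) : ¬ T.Below b a := by
  intro hba
  have key : ∀ c, T.Below a c → T.Below c a := by
    intro c hc
    induction hc with
    | refl => exact Relation.ReflTransGen.refl
    | tail _ hcd ih =>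
      rename_i c d _
      rcases Relation.ReflTransGen.cases_head ih with rfl | ⟨d', hd', hd⟩
      · rw [h] at hcd
        cases hcd
        exact hba
      · rw [hcd] at hd'
        cases hd'
        exact hd
  rcases Relation.ReflTransGen.cases_head (key _ (T.reaches_root a (mem_child h))) with
    h' | ⟨c, hc, -⟩
  · exact ne_root h h'.symm
  · simp [T.parent_root] at hc

lemma parent_ne {a b : ν} (h : T.parent a = some b) : a ≠ b := by
  rintro rfl
  exact not_below_of_parent h Relation.ReflTransGen.refl

lemma parent_asymm {a b : ν} (h : T.parent a = some b) : T.parent b ≠ some a := fun h' =>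
  not_below_of_parent h (Below.of_parent h')

lemma Below.parent_of_ne {a b p : ν} (h : T.Below a b) (hne : a ≠ b) (hp : T.parent a = some p) :
    T.Below p b := by
  rcases Relation.ReflTransGen.cases_head h with rfl | ⟨c, hc, h⟩
  · exact absurd rfl hne
  · rw [hp] at hc
    cases hc
    exact h

lemma Below.total {a b c : ν} (h : T.Below a b) (h' : T.Below a c) : T.Below b c ∨ T.Below c b :=
  Relation.ReflTransGen.total_of_right_unique
    (fun a b c (h : T.parent a = some b) (h' : T.parent a = some c) => by
      rw [h] at h'; exact Option.some_injective _ h') h h'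

lemma sibling_eq {a b c p : ν} (hb : T.parent b = some p) (hc : T.parent c = some p)
    (hab : T.Below a b) (hac : T.Below a c) : b = c := by
  by_contra hne
  rcases hab.total hac with h | h
  · exact not_below_of_parent hc (h.parent_of_ne hne hb)
  · exact not_below_of_parent hb (h.parent_of_ne (Ne.symm hne) hc)

lemma mk_mem_solidEdges {a b : ν} (h : T.parent a = some b) :
    s(a, b) ∈ T.solidEdges ↔ a ∈ T.solid := by
  constructor
  · rintro ⟨c, d, ⟨hp, hs⟩, he⟩
    rcases Sym2.eq_iff.1 he with ⟨rfl, rfl⟩ | ⟨rfl, rfl⟩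
    · exact hs
    · exact absurd h (parent_asymm hp)
  · intro hs
    exact ⟨a, b, ⟨h, hs⟩, rfl⟩

lemma SameTree.below_iff (h : SameTree T T') {a b : ν} : T'.Below a b ↔ T.Below a b := by
  unfold Below
  rw [h.parent_eq]

lemma SameTree.tAdj_iff (h : SameTree T T') {a b : ν} : T'.TAdj a b ↔ T.TAdj a b := by
  unfold TAdj
  rw [h.parent_eq]

lemma SameTree.symm (h : SameTree T T') : SameTree T' T where
  nodes_eq := h.nodes_eq.symm
  root_eq := h.root_eq.symm
  parent_eq := h.parent_eq.symm
  kind_eq a ha := (h.kind_eq a (h.nodes_eq ▸ ha)).symm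
  skel_eq a ha := (h.skel_eq a (h.nodes_eq ▸ ha)).symm

/-- The tree `T` with its path decomposition replaced by the one with solid edges `s`. -/
def withSolid (T : PDTree ν α β) (s : Set ν) (h : ∀ a ∈ s, ∃ b, T.parent a = some b)
    (h' : ∀ a ∈ s, ∀ b ∈ s, T.parent a = T.parent b → a = b) : PDTree ν α β :=
  { T with solid := s, parent_of_solid := h, solid_unique := h' }

lemma sameTree_withSolid (s : Set ν) (h h') : SameTree T (T.withSolid s h h') :=
  ⟨rfl, rfl, rfl, fun _ _ => rfl, fun _ _ => rfl⟩

/-! ### Split trees -/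

/-- Every edge has an end labelled `B`. -/
def Alternating (T : PDTree ν α β) : Prop :=
  ∀ a b, T.parent a = some b → T.kind a = Kind.B ∨ T.kind b = Kind.B

/-- The `C` nodes that are split in the pre-split tree corresponding to a strict tree `T`. The
parent of a `C` node that is not the root is a `B` node, so its parent edge is stable iff it is
dashed. -/
def splitNodes (T : PDTree ν α β) : Set ν :=
  {v | T.kind v = Kind.C ∧ v ∈ T.solid ∧ (∃ c, T.SolidChild c v) ∧
    ∃ c d, c ≠ d ∧ T.DashedChild c v ∧ T.DashedChild d v}

/-- `R` arises from `T` by splitting the `C` nodes in `S`: each `v ∈ S` gets a new dashed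
child `n v`, which inherits the dashed children of `v`. The status of the edges to the children
of the nodes `n v` is left open. -/
structure Splitting (T : PDTree ν α β) (S : Set ν) (n : ν → ν) (R : PDTree ν α β) : Prop where
  mem_of : ∀ v ∈ S, v ∈ T.nodes
  kind_of : ∀ v ∈ S, T.kind v = Kind.C
  inj : Set.InjOn n S
  fresh : ∀ v ∈ S, n v ∉ T.nodes
  mem_nodes : ∀ b, b ∈ R.nodes ↔ b ∈ T.nodes ∨ ∃ v ∈ S, b = n v
  root_eq : R.root = T.root
  kind_eq : ∀ b ∈ T.nodes, R.kind b = T.kind b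
  skel_eq : ∀ b ∈ T.nodes, R.skel b = T.skel b
  kind_new : ∀ v ∈ S, R.kind (n v) = Kind.C
  skel_new : ∀ v ∈ S, R.skel (n v) = T.skel v
  parent_new : ∀ v ∈ S, R.parent (n v) = some v
  dashed_new : ∀ v ∈ S, n v ∉ R.solid
  moved : ∀ v ∈ S, ∀ b, T.DashedChild b v → R.parent b = some (n v)
  kept : ∀ b ∈ T.nodes, (∀ v ∈ S, ¬ T.DashedChild b v) →
    R.parent b = T.parent b ∧ (b ∈ R.solid ↔ b ∈ T.solid)

namespace Splitting

lemma mem_old (h : Splitting T S n R) {b : ν} (hb : b ∈ T.nodes) : b ∈ R.nodes :=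
  (h.mem_nodes b).2 (Or.inl hb)

lemma mem_new (h : Splitting T S n R) {v : ν} (hv : v ∈ S) : n v ∈ R.nodes :=
  (h.mem_nodes _).2 (Or.inr ⟨v, hv, rfl⟩)

lemma parent_solid (h : Splitting T S n R) {b : ν} (hb : b ∈ T.solid) :
    R.parent b = T.parent b ∧ b ∈ R.solid := by
  have := h.kept b (mem_of_solid hb) (fun v _ hd => hd.2 hb)
  exact ⟨this.1, this.2.2 hb⟩

lemma parent_notMem (h : Splitting T S n R) {b p : ν} (hb : T.parent b = some p) (hp : p ∉ S) :
    R.parent b = some p ∧ (b ∈ R.solid ↔ b ∈ T.solid) := by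
  rw [← hb]
  refine h.kept b (mem_child hb) (fun v hv hd => hp ?_)
  have := hd.1
  rw [hb] at this
  cases this
  exact hv

/-- The edges of a split tree: edges of `T` kept, edges of `T` moved to a new node, and edges from
a new node to its parent. -/
lemma parent_cases (h : Splitting T S n R) {b q : ν} (hb : R.parent b = some q) :
    (b ∈ T.nodes ∧ T.parent b = some q ∧ (∀ v ∈ S, ¬ T.DashedChild b v) ∧
        (b ∈ R.solid ↔ b ∈ T.solid)) ∨
      (∃ v ∈ S, T.DashedChild b v ∧ q = n v) ∨ (∃ v ∈ S, b = n v ∧ q = v) := by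
  rcases (h.mem_nodes b).1 (mem_child hb) with hbT | ⟨v, hv, rfl⟩
  · by_cases hm : ∃ v ∈ S, T.DashedChild b v
    · obtain ⟨v, hv, hd⟩ := hm
      have := h.moved v hv b hd
      rw [hb] at this
      cases this
      exact Or.inr (Or.inl ⟨v, hv, hd, rfl⟩)
    · push Not at hm
      obtain ⟨h1, h2⟩ := h.kept b hbT hm
      exact Or.inl ⟨hbT, h1 ▸ hb, hm, h2⟩
  · rw [h.parent_new v hv] at hb
    cases hb
    exact Or.inr (Or.inr ⟨_, hv, rfl, rfl⟩)

lemma dashedChild_of_parent_new (h : Splitting T S n R) {b v : ν} (hv : v ∈ S)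
    (hb : R.parent b = some (n v)) : T.DashedChild b v := by
  rcases h.parent_cases hb with ⟨_, hp, _⟩ | ⟨w, hw, hd, he⟩ | ⟨w, hw, _, he⟩
  · exact absurd (mem_parent hp) (h.fresh v hv)
  · rw [h.inj hv hw he]
    exact hd
  · exact absurd (he ▸ h.mem_of w hw) (h.fresh v hv)

lemma below_step (h : Splitting T S n R) {b p : ν} (hb : T.parent b = some p) : R.Below b p := by
  by_cases hm : ∃ v ∈ S, T.DashedChild b v
  · obtain ⟨v, hv, hd⟩ := hm
    have hvp : v = p := Option.some_injective _ (hd.1.symm.trans hb)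
    subst hvp
    exact Relation.ReflTransGen.head (h.moved v hv b hd) (Below.of_parent (h.parent_new v hv))
  · push Not at hm
    exact Below.of_parent ((h.kept b (mem_child hb) hm).1.trans hb)

lemma below_of_below (h : Splitting T S n R) {a b : ν} (hab : T.Below a b) : R.Below a b := by
  induction hab with
  | refl => exact Relation.ReflTransGen.refl
  | tail _ hcd ih => exact Relation.ReflTransGen.trans ih (h.below_step hcd)

lemma below_project (h : Splitting T S n R) {x y : ν} (hxy : R.Below x y) (hy : y ∈ T.nodes) :
    (x ∈ T.nodes → T.Below x y) ∧ ∀ u ∈ S, x = n u → T.Below u y := by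
  induction hxy using Relation.ReflTransGen.head_induction_on with
  | refl =>
    exact ⟨fun _ => Relation.ReflTransGen.refl, fun u hu he => absurd (he ▸ hy) (h.fresh u hu)⟩
  | head hac _ ih =>
    rcases h.parent_cases hac with ⟨ha, hp, _⟩ | ⟨w, hw, hd, rfl⟩ | ⟨w, hw, rfl, rfl⟩
    · exact ⟨fun _ => Relation.ReflTransGen.head hp (ih.1 (mem_parent hp)),
        fun u hu he => absurd (he ▸ ha) (h.fresh u hu)⟩
    · exact ⟨fun _ => Relation.ReflTransGen.head hd.1 (ih.2 w hw rfl),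
        fun u hu he => absurd (he ▸ mem_child hd.1) (h.fresh u hu)⟩
    · refine ⟨fun hm => absurd hm (h.fresh _ hw), fun u hu he => ?_⟩
      rw [← h.inj hw hu he]
      exact ih.1 (h.mem_of _ hw)

lemma below_iff (h : Splitting T S n R) {a b : ν} (ha : a ∈ T.nodes) (hb : b ∈ T.nodes) :
    R.Below a b ↔ T.Below a b :=
  ⟨fun hab => (h.below_project hab hb).1 ha, h.below_of_below⟩

lemma new_below_iff (h : Splitting T S n R) {v b : ν} (hv : v ∈ S) (hb : b ∈ T.nodes) :
    R.Below (n v) b ↔ T.Below v b :=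
  ⟨fun hab => (h.below_project hab hb).2 v hv rfl, fun hab =>
    Relation.ReflTransGen.head (h.parent_new v hv) (h.below_of_below hab)⟩

lemma below_new_iff (h : Splitting T S n R) {x v : ν} (hv : v ∈ S) :
    R.Below x (n v) ↔ x = n v ∨ ∃ b, T.DashedChild b v ∧ R.Below x b := by
  constructor
  · intro hx
    rcases Relation.ReflTransGen.cases_tail hx with h' | ⟨b, hxb, hb⟩
    · exact Or.inl h'.symm
    · exact Or.inr ⟨b, h.dashedChild_of_parent_new hv hb, hxb⟩
  · rintro (rfl | ⟨b, hd, hxb⟩)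
    · exact Relation.ReflTransGen.refl
    · exact Relation.ReflTransGen.tail hxb (h.moved v hv b hd)

lemma primary_iff (h : Splitting T S n R) (hA : T.Alternating) {b : ν} :
    R.Primary b ↔ b ∈ T.nodes := by
  constructor
  · rintro ⟨hb, hb'⟩
    rcases (h.mem_nodes b).1 hb with hb | ⟨v, hv, rfl⟩
    · exact hb
    · exfalso
      rcases hb' with hr | hk | ⟨p, hp, hk⟩
      · exact ne_root (h.parent_new v hv) hr
      · rw [h.kind_new v hv] at hk
        cases hk
      · rw [h.parent_new v hv] at hp
        cases hp
        rw [h.kind_eq _ (h.mem_of _ hv), h.kind_of _ hv] at hk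
        cases hk
  · intro hb
    refine ⟨h.mem_old hb, ?_⟩
    by_cases hr : b = T.root
    · exact Or.inl (hr.trans h.root_eq.symm)
    · obtain ⟨p, hp⟩ := exists_parent hb hr
      rcases hA b p hp with hk | hk
      · exact Or.inr (Or.inl ((h.kind_eq b hb).trans hk))
      · refine Or.inr (Or.inr ⟨p, (h.parent_notMem hp fun hpS => ?_).1, ?_⟩)
        · rw [h.kind_of p hpS] at hk
          cases hk
        · rw [h.kind_eq p (mem_parent hp), hk]

lemma secondary_iff (h : Splitting T S n R) (hA : T.Alternating) {b : ν} :
    R.Secondary b ↔ ∃ v ∈ S, b = n v := by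
  rw [Secondary, h.primary_iff hA, h.mem_nodes]
  constructor
  · rintro ⟨hb | hb, hb'⟩
    · exact absurd hb hb'
    · exact hb
  · rintro ⟨v, hv, rfl⟩
    exact ⟨Or.inr ⟨v, hv, rfl⟩, h.fresh v hv⟩

lemma dashedChild_iff (h : Splitting T S n R) {b v : ν} (hv : v ∈ S) :
    R.DashedChild b v ↔ b = n v := by
  constructor
  · rintro ⟨hp, hs⟩
    rcases h.parent_cases hp with ⟨_, hp', hn, hs'⟩ | ⟨w, hw, _, he⟩ | ⟨w, hw, he, rfl⟩
    · exact absurd ⟨hp', fun hc => hs (hs'.2 hc)⟩ (hn v hv)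
    · exact absurd (he ▸ h.mem_of v hv) (h.fresh w hw)
    · exact he
  · rintro rfl
    exact ⟨h.parent_new v hv, h.dashed_new v hv⟩

lemma parent_iff_of_notMem (h : Splitting T S n R) {b v : ν} (hv : v ∈ T.nodes) (hS : v ∉ S) :
    R.parent b = some v ↔ T.parent b = some v := by
  constructor
  · intro hp
    rcases h.parent_cases hp with ⟨_, hp', _⟩ | ⟨w, hw, _, he⟩ | ⟨w, hw, he, rfl⟩
    · exact hp'
    · exact absurd (he ▸ hv) (h.fresh w hw)
    · exact absurd hw hS
  · exact fun hp => (h.parent_notMem hp hS).1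

lemma dashedChild_iff_of_notMem (h : Splitting T S n R) {b v : ν} (hv : v ∈ T.nodes) (hS : v ∉ S) :
    R.DashedChild b v ↔ T.DashedChild b v := by
  unfold DashedChild
  rw [h.parent_iff_of_notMem hv hS]
  exact and_congr_right fun hp => not_congr (h.parent_notMem hp hS).2

lemma solidChild_iff (h : Splitting T S n R) {b v : ν} (hv : v ∈ T.nodes) :
    R.SolidChild b v ↔ T.SolidChild b v := by
  constructor
  · rintro ⟨hp, hs⟩
    rcases h.parent_cases hp with ⟨_, hp', hn, hs'⟩ | ⟨w, hw, _, he⟩ | ⟨w, hw, he, rfl⟩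
    · exact ⟨hp', hs'.1 hs⟩
    · exact absurd (he ▸ hv) (h.fresh w hw)
    · exact absurd (he ▸ hs) (h.dashed_new _ hw)
  · rintro ⟨hp, hs⟩
    exact ⟨(h.parent_solid hs).1.trans hp, (h.parent_solid hs).2⟩

lemma congr_names (h : Splitting T S n R) {m : ν → ν} (hm : ∀ v ∈ S, m v = n v) :
    Splitting T S m R where
  mem_of := h.mem_of
  kind_of := h.kind_of
  inj := h.inj.congr fun v hv => (hm v hv).symm
  fresh v hv := hm v hv ▸ h.fresh v hv
  mem_nodes b := by
    rw [h.mem_nodes]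
    refine or_congr_right (exists_congr fun v => and_congr_right fun hv => ?_)
    rw [hm v hv]
  root_eq := h.root_eq
  kind_eq := h.kind_eq
  skel_eq := h.skel_eq
  kind_new v hv := hm v hv ▸ h.kind_new v hv
  skel_new v hv := hm v hv ▸ h.skel_new v hv
  parent_new v hv := hm v hv ▸ h.parent_new v hv
  dashed_new v hv := hm v hv ▸ h.dashed_new v hv
  moved v hv := hm v hv ▸ h.moved v hv
  kept := h.kept

/-- A splitting of `T` is a splitting of every tree with the same edges and the same status. -/
lemma congr_tree (h : Splitting T S n R) (hs : SameTree T T') (hsol : ∀ a, a ∈ T'.solid ↔ a ∈ T.solid) :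
    Splitting T' S n R := by
  have hd : ∀ b v, T'.DashedChild b v ↔ T.DashedChild b v := fun b v => by
    unfold DashedChild
    rw [hs.parent_eq, hsol]
  exact
  { mem_of := fun v hv => hs.nodes_eq ▸ h.mem_of v hv
    kind_of := fun v hv => (hs.kind_eq v (h.mem_of v hv)).trans (h.kind_of v hv)
    inj := h.inj
    fresh := fun v hv => hs.nodes_eq ▸ h.fresh v hv
    mem_nodes := fun b => by rw [h.mem_nodes, hs.nodes_eq]
    root_eq := h.root_eq.trans hs.root_eq.symm
    kind_eq := fun b hb => by
      rw [hs.nodes_eq] at hb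
      rw [h.kind_eq b hb, hs.kind_eq b hb]
    skel_eq := fun b hb => by
      rw [hs.nodes_eq] at hb
      rw [h.skel_eq b hb, hs.skel_eq b hb]
    kind_new := h.kind_new
    skel_new := fun v hv => (h.skel_new v hv).trans (hs.skel_eq v (h.mem_of v hv)).symm
    parent_new := h.parent_new
    dashed_new := h.dashed_new
    moved := fun v hv b hb => h.moved v hv b ((hd b v).1 hb)
    kept := fun b hb hn => by
      rw [hs.nodes_eq] at hb
      rw [hs.parent_eq, hsol]
      exact h.kept b hb fun v hv hb' => hn v hv ((hd b v).2 hb') }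

end Splitting

/-- The split tree exists for any choice of the nodes to be split, of names for the new nodes, and
of at most one solid child for each of them. -/
lemma exists_splitting (hmem : ∀ v ∈ S, v ∈ T.nodes) (hkind : ∀ v ∈ S, T.kind v = Kind.C)
    (hinj : Set.InjOn n S) (hfresh : ∀ v ∈ S, n v ∉ T.nodes) (H : Set ν)
    (hH : ∀ v ∈ S, ∀ b c, T.DashedChild b v → T.DashedChild c v → b ∈ H → c ∈ H → b = c) :
    ∃ R, Splitting T S n R ∧ ∀ v ∈ S, ∀ b, T.DashedChild b v → (b ∈ R.solid ↔ b ∈ H) := by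
  classical
  have hne : ∀ v ∈ S, ∀ b ∈ T.nodes, b ≠ n v := fun v hv b hb he => hfresh v hv (he ▸ hb)
  let old : ν → ν := fun b => if hb : ∃ v ∈ S, n v = b then hb.choose else b
  have hold : ∀ v ∈ S, old (n v) = v := by
    intro v hv
    have hb : ∃ u ∈ S, n u = n v := ⟨v, hv, rfl⟩
    simp only [old, dif_pos hb]
    exact hinj hb.choose_spec.1 hv hb.choose_spec.2
  let par : ν → Option ν := fun b =>
    if b ∈ T.nodes then (T.parent b).map fun v => if v ∈ S ∧ b ∉ T.solid then n v else v
    else if ∃ v ∈ S, n v = b then some (old b) else none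
  have par_moved : ∀ v ∈ S, ∀ b, T.DashedChild b v → par b = some (n v) := by
    intro v hv b hb
    simp only [par, if_pos (mem_child hb.1), hb.1, Option.map_some, hv, hb.2, not_false_eq_true,
      and_self, if_true]
  have par_kept : ∀ b ∈ T.nodes, (∀ v ∈ S, ¬ T.DashedChild b v) → par b = T.parent b := by
    intro b hb hn
    simp only [par, if_pos hb]
    rcases hp : T.parent b with _ | v
    · rfl
    · have : ¬ (v ∈ S ∧ b ∉ T.solid) := fun h => hn v h.1 ⟨hp, h.2⟩
      simp only [Option.map_some, if_neg this]
  have par_new : ∀ v ∈ S, par (n v) = some v := by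
    intro v hv
    have : ∃ u ∈ S, n u = n v := ⟨v, hv, rfl⟩
    simp only [par, if_neg (hfresh v hv), if_pos this, hold v hv]
  have par_none : ∀ b, b ∉ T.nodes → (¬ ∃ v ∈ S, n v = b) → par b = none := by
    intro b hb hn
    simp only [par, if_neg hb, if_neg hn]
  let N : Finset ν := T.nodes ∪ (T.nodes.filter (· ∈ S)).image n
  have hN : ∀ b, b ∈ N ↔ b ∈ T.nodes ∨ ∃ v ∈ S, b = n v := by
    intro b
    simp only [N, Finset.mem_union, Finset.mem_image, Finset.mem_filter]
    refine or_congr_right ⟨?_, ?_⟩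
    · rintro ⟨v, ⟨_, hv⟩, rfl⟩
      exact ⟨v, hv, rfl⟩
    · rintro ⟨v, hv, rfl⟩
      exact ⟨v, ⟨hmem v hv, hv⟩, rfl⟩
  have par_cases : ∀ b q, par b = some q →
      (b ∈ T.nodes ∧ T.parent b = some q ∧ ∀ v ∈ S, ¬ T.DashedChild b v) ∨
      (∃ v ∈ S, T.DashedChild b v ∧ q = n v) ∨ (∃ v ∈ S, b = n v ∧ q = v) := by
    intro b q hb
    by_cases hbT : b ∈ T.nodes
    · by_cases hm : ∃ v ∈ S, T.DashedChild b v
      · obtain ⟨v, hv, hd⟩ := hm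
        rw [par_moved v hv b hd] at hb
        cases hb
        exact Or.inr (Or.inl ⟨v, hv, hd, rfl⟩)
      · push Not at hm
        exact Or.inl ⟨hbT, par_kept b hbT hm ▸ hb, hm⟩
    · by_cases hm : ∃ v ∈ S, n v = b
      · obtain ⟨v, hv, rfl⟩ := hm
        rw [par_new v hv] at hb
        cases hb
        exact Or.inr (Or.inr ⟨_, hv, rfl, rfl⟩)
      · rw [par_none b hbT hm] at hb
        cases hb
  have reach : ∀ a ∈ T.nodes, Relation.ReflTransGen (fun a b => par a = some b) a T.root := by
    intro a ha
    have := T.reaches_root a ha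
    clear ha
    induction this using Relation.ReflTransGen.head_induction_on with
    | refl => exact Relation.ReflTransGen.refl
    | head hac _ ih =>
      rename_i a c _
      by_cases hm : ∃ v ∈ S, T.DashedChild a v
      · obtain ⟨v, hv, hd⟩ := hm
        have hvc : v = c := Option.some_injective _ (hd.1.symm.trans hac)
        subst hvc
        exact Relation.ReflTransGen.head (par_moved v hv a hd)
          (Relation.ReflTransGen.head (par_new v hv) ih)
      · push Not at hm
        exact Relation.ReflTransGen.head ((par_kept a (mem_child hac) hm).trans hac) ih
  let sol : Set ν := {b | b ∈ T.solid ∨ (b ∈ H ∧ ∃ v ∈ S, T.DashedChild b v)}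
  have sol_kept : ∀ b, b ∈ T.solid → par b = T.parent b := fun b hb =>
    par_kept b (mem_of_solid hb) fun v _ hd => hd.2 hb
  refine ⟨{ nodes := N, root := T.root, parent := par,
            kind := fun b => if b ∈ T.nodes then T.kind b else Kind.C,
            skel := fun b => if b ∈ T.nodes then T.skel b else T.skel (old b),
            solid := sol, root_mem := (hN _).2 (Or.inl T.root_mem),
            parent_root := ?_, mem_of_parent := ?_, reaches_root := ?_, parent_of_solid := ?_,
            solid_unique := ?_ }, ?_, ?_⟩
  · rw [par_kept _ T.root_mem fun v _ hd => ne_root hd.1 rfl, T.parent_root]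
  · intro a b hab
    rcases par_cases a b hab with ⟨ha, hp, _⟩ | ⟨v, hv, hd, rfl⟩ | ⟨v, hv, rfl, rfl⟩
    · exact ⟨(hN a).2 (Or.inl ha), (hN b).2 (Or.inl (mem_parent hp))⟩
    · exact ⟨(hN a).2 (Or.inl (mem_child hd.1)), (hN _).2 (Or.inr ⟨v, hv, rfl⟩)⟩
    · exact ⟨(hN _).2 (Or.inr ⟨_, hv, rfl⟩), (hN _).2 (Or.inl (hmem _ hv))⟩
  · intro a ha
    rcases (hN a).1 ha with ha | ⟨v, hv, rfl⟩
    · exact reach a ha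
    · exact Relation.ReflTransGen.head (par_new v hv) (reach v (hmem v hv))
  · rintro a (ha | ⟨_, v, hv, hd⟩)
    · obtain ⟨b, hb⟩ := T.parent_of_solid a ha
      exact ⟨b, (sol_kept a ha).trans hb⟩
    · exact ⟨n v, par_moved v hv a hd⟩
  · rintro a (ha | ⟨haH, v, hv, hd⟩) b (hb | ⟨hbH, u, hu, hd'⟩) hab
    · rw [sol_kept a ha, sol_kept b hb] at hab
      exact T.solid_unique a ha b hb hab
    · rw [sol_kept a ha, par_moved u hu b hd'] at hab
      exact absurd (mem_parent hab) (hfresh u hu)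
    · rw [sol_kept b hb, par_moved v hv a hd] at hab
      exact absurd (mem_parent hab.symm) (hfresh v hv)
    · rw [par_moved v hv a hd, par_moved u hu b hd'] at hab
      have := hinj hv hu (Option.some_injective _ hab)
      subst this
      exact hH v hv a b hd hd' haH hbH
  · exact
    { mem_of := hmem
      kind_of := hkind
      inj := hinj
      fresh := hfresh
      mem_nodes := hN
      root_eq := rfl
      kind_eq := fun b hb => if_pos hb
      skel_eq := fun b hb => if_pos hb
      kind_new := fun v hv => if_neg (hfresh v hv)
      skel_new := fun v hv => by
        show (if n v ∈ T.nodes then T.skel (n v) else T.skel (old (n v))) = T.skel v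
        rw [if_neg (hfresh v hv), hold v hv]
      parent_new := par_new
      dashed_new := fun v hv => by
        rintro (hs | ⟨_, u, hu, hd⟩)
        · exact hfresh v hv (mem_of_solid hs)
        · exact hfresh v hv (mem_child hd.1)
      moved := par_moved
      kept := fun b hb hn => ⟨par_kept b hb hn,
        ⟨fun hs => hs.resolve_right fun h => by
          obtain ⟨_, v, hv, hd⟩ := h
          exact hn v hv hd, Or.inl⟩⟩ }
  · intro v hv b hd
    exact ⟨fun hs => (hs.resolve_left hd.2).1, fun hb => Or.inr ⟨hb, v, hv, hd⟩⟩

/-! ### Weights -/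

/-- Every vertex is represented by at most one `C` node. -/
def UniqueC (T : PDTree ν α β) : Prop :=
  ∀ a ∈ T.nodes, ∀ b ∈ T.nodes, T.kind a = Kind.C → T.kind b = Kind.C → ∀ x,
    x ∈ V(T.skel a) → x ∈ V(T.skel b) → a = b

lemma IsStrictBC.alternating {G : Graph α β} (h : IsStrictBC G T) : T.Alternating := h.not_both_C

lemma IsStrictBC.uniqueC {G : Graph α β} (h : IsStrictBC G T) : T.UniqueC := by
  intro a ha b hb hka hkb x hxa hxb
  have := h.connected_C x a ha b hb hka hkb hxa hxb
  clear hxb hb hkb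
  suffices b = a ∧ T.kind b = Kind.C from this.1.symm
  induction this with
  | refl => exact ⟨rfl, hka⟩
  | tail _ hcd ih =>
    obtain ⟨rfl, hk⟩ := ih
    obtain ⟨hadj | hadj, hk', -⟩ := hcd
    · rcases h.not_both_C _ _ hadj with hB | hB
      · rw [hk] at hB
        cases hB
      · rw [hk'] at hB
        cases hB
    · rcases h.not_both_C _ _ hadj with hB | hB
      · rw [hk'] at hB
        cases hB
      · rw [hk] at hB
        cases hB

lemma UniqueC.isHome_iff (hU : T.UniqueC) {x : α} {a : ν} :
    T.IsHome x a ↔ a ∈ T.nodes ∧ x ∈ V(T.skel a) ∧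
      (T.kind a = Kind.C ∨ ∀ b ∈ T.nodes, T.kind b = Kind.C → x ∉ V(T.skel b)) := by
  refine and_congr_right fun ha => and_congr_right fun hx => ?_
  constructor
  · rintro (h | h)
    · exact Or.inl h.1
    · exact Or.inr h.2
  · intro h
    rcases hk : T.kind a with _ | _
    · exact Or.inr ⟨rfl, h.resolve_left (by simp [hk])⟩
    · refine Or.inl ⟨rfl, fun b hb hkb hxb => ?_⟩
      rw [hU a ha b hb hk hkb x hx hxb]
      exact Relation.ReflTransGen.refl

lemma SameTree.isHome_iff (h : SameTree T T') {x : α} {a : ν} : T'.IsHome x a ↔ T.IsHome x a := by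
  unfold IsHome
  rw [h.nodes_eq]
  refine and_congr_right fun ha => ?_
  rw [h.skel_eq a ha, h.kind_eq a ha]
  have h1 : ∀ b ∈ T.nodes, (T'.kind b = Kind.C → x ∈ V(T'.skel b) → T'.Below a b) ↔
      (T.kind b = Kind.C → x ∈ V(T.skel b) → T.Below a b) := fun b hb => by
    rw [h.skel_eq b hb, h.kind_eq b hb, h.below_iff]
  have h2 : ∀ b ∈ T.nodes, (T'.kind b = Kind.C → x ∉ V(T'.skel b)) ↔
      (T.kind b = Kind.C → x ∉ V(T.skel b)) := fun b hb => by
    rw [h.skel_eq b hb, h.kind_eq b hb]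
  rw [forall₂_congr h1, forall₂_congr h2]

open Classical in
/-- The weight of the `C` node `v` together with the subtrees rooted in its dashed children. This is
the weight of the subtree of the new node after splitting `v`. -/
noncomputable def branchWeight (T : PDTree ν α β) (v : ν) : ℕ :=
  ∑ u ∈ T.nodes.filter (fun u => u = v ∨ ∃ b, T.DashedChild b v ∧ T.Below u b), T.weight u

/-- In the split tree `R` the edges from the new nodes to their children are solid iff heavy,
expressed in terms of `T`. -/
def InnerHeavy (T : PDTree ν α β) (S : Set ν) (R : PDTree ν α β) : Prop :=
  ∀ v ∈ S, ∀ b, T.DashedChild b v → (b ∈ R.solid ↔ T.branchWeight v < 2 * T.subtreeWeight b)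

lemma subtreeWeight_add_le_branchWeight {v b c : ν} (hb : T.DashedChild b v)
    (hc : T.DashedChild c v) (hne : b ≠ c) :
    T.subtreeWeight b + T.subtreeWeight c ≤ T.branchWeight v := by
  classical
  unfold subtreeWeight branchWeight
  rw [← Finset.sum_union]
  · refine Finset.sum_le_sum_of_subset fun u hu => ?_
    rcases Finset.mem_union.1 hu with hu | hu <;> rw [Finset.mem_filter] at hu ⊢
    · exact ⟨hu.1, Or.inr ⟨b, hb, hu.2⟩⟩
    · exact ⟨hu.1, Or.inr ⟨c, hc, hu.2⟩⟩
  · rw [Finset.disjoint_left]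
    intro u hu hu'
    exact hne (sibling_eq hb.1 hc.1 (Finset.mem_filter.1 hu).2 (Finset.mem_filter.1 hu').2)

lemma branchWeight_add_le_subtreeWeight {v s : ν} (hs : T.SolidChild s v) :
    T.branchWeight v + T.subtreeWeight s ≤ T.subtreeWeight v := by
  classical
  unfold subtreeWeight branchWeight
  rw [← Finset.sum_union]
  · refine Finset.sum_le_sum_of_subset fun u hu => ?_
    rcases Finset.mem_union.1 hu with hu | hu <;> rw [Finset.mem_filter] at hu ⊢
    · rcases hu with ⟨hu', rfl | ⟨b, hb, hub⟩⟩
      · exact ⟨hu', Relation.ReflTransGen.refl⟩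
      · exact ⟨hu', Relation.ReflTransGen.tail hub hb.1⟩
    · exact ⟨hu.1, Relation.ReflTransGen.tail hu.2 hs.1⟩
  · rw [Finset.disjoint_left]
    intro u hu hu'
    have h' := (Finset.mem_filter.1 hu').2
    rcases (Finset.mem_filter.1 hu).2 with rfl | ⟨b, hb, hub⟩
    · exact not_below_of_parent hs.1 h'
    · rw [← sibling_eq hb.1 hs.1 hub h'] at hs
      exact hb.2 hs.2

lemma heavy_iff {a p : ν} (h : T.parent a = some p) :
    T.Heavy a ↔ T.subtreeWeight p < 2 * T.subtreeWeight a := by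
  constructor
  · rintro ⟨q, hq, hw⟩
    rw [h] at hq
    cases hq
    exact hw
  · exact fun hw => ⟨p, h, hw⟩

namespace Splitting

lemma isHome_new (h : Splitting T S n R) (hU : T.UniqueC) {x : α} {v : ν} (hv : v ∈ S) :
    R.IsHome x (n v) ↔ T.IsHome x v := by
  rw [hU.isHome_iff]
  constructor
  · rintro ⟨-, hx, -⟩
    rw [h.skel_new v hv] at hx
    exact ⟨h.mem_of v hv, hx, Or.inl (h.kind_of v hv)⟩
  · rintro ⟨-, hx, -⟩
    refine ⟨h.mem_new hv, by rwa [h.skel_new v hv], Or.inl ⟨h.kind_new v hv, fun b hb hk hxb => ?_⟩⟩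
    rcases (h.mem_nodes b).1 hb with hb | ⟨w, hw, rfl⟩
    · rw [h.kind_eq b hb] at hk
      rw [h.skel_eq b hb] at hxb
      rw [← hU v (h.mem_of v hv) b hb (h.kind_of v hv) hk x hx hxb]
      exact Below.of_parent (h.parent_new v hv)
    · rw [h.skel_new w hw] at hxb
      rw [hU v (h.mem_of v hv) w (h.mem_of w hw) (h.kind_of v hv) (h.kind_of w hw) x hx hxb]
      exact Relation.ReflTransGen.refl

lemma isHome_notMem (h : Splitting T S n R) (hU : T.UniqueC) {x : α} {v : ν} (hv : v ∈ T.nodes)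
    (hS : v ∉ S) : R.IsHome x v ↔ T.IsHome x v := by
  rw [hU.isHome_iff]
  unfold IsHome
  rw [h.kind_eq v hv, h.skel_eq v hv]
  constructor
  · rintro ⟨-, hx, hk | hk⟩
    · exact ⟨hv, hx, Or.inl hk.1⟩
    · refine ⟨hv, hx, Or.inr fun b hb hkb => ?_⟩
      have := hk.2 b (h.mem_old hb) (by rwa [h.kind_eq b hb])
      rwa [h.skel_eq b hb] at this
  · rintro ⟨-, hx, hk⟩
    refine ⟨h.mem_old hv, hx, ?_⟩
    rcases hk' : T.kind v with _ | _
    · refine Or.inr ⟨rfl, fun b hb hkb => ?_⟩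
      have hn := hk.resolve_left (by simp [hk'])
      rcases (h.mem_nodes b).1 hb with hb | ⟨w, hw, rfl⟩
      · rw [h.skel_eq b hb]
        exact hn b hb (by rwa [h.kind_eq b hb] at hkb)
      · rw [h.skel_new w hw]
        exact hn w (h.mem_of w hw) (h.kind_of w hw)
    · refine Or.inl ⟨rfl, fun b hb hkb hxb => ?_⟩
      rcases (h.mem_nodes b).1 hb with hb | ⟨w, hw, rfl⟩
      · rw [h.kind_eq b hb] at hkb
        rw [h.skel_eq b hb] at hxb
        rw [hU v hv b hb hk' hkb x hx hxb]
        exact Relation.ReflTransGen.refl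
      · rw [h.skel_new w hw] at hxb
        have := hU v hv w (h.mem_of w hw) hk' (h.kind_of w hw) x hx hxb
        subst this
        exact absurd hw hS

lemma not_isHome (h : Splitting T S n R) {x : α} {v : ν} (hv : v ∈ S) : ¬ R.IsHome x v := by
  rintro ⟨-, hx, ⟨-, hk⟩ | ⟨hk, -⟩⟩
  · refine not_below_of_parent (h.parent_new v hv) (hk (n v) (h.mem_new hv) (h.kind_new v hv) ?_)
    rwa [h.skel_new v hv, ← h.skel_eq v (h.mem_of v hv)]
  · rw [h.kind_eq v (h.mem_of v hv), h.kind_of v hv] at hk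
    cases hk

open Classical in
/-- The vertices counted at `v` in `T` are counted at the new child of `v` in the split tree if `v`
is split, and at `v` otherwise. -/
lemma sum_weight (h : Splitting T S n R) (hU : T.UniqueC) (Q : ν → Prop) :
    ∑ b ∈ R.nodes.filter Q, R.weight b =
      ∑ u ∈ T.nodes.filter (fun u => Q (if u ∈ S then n u else u)), T.weight u := by
  symm
  apply Finset.sum_of_injOn (fun u => if u ∈ S then n u else u)
  · intro a ha b hb hab
    rw [Finset.mem_coe, Finset.mem_filter] at ha hb
    dsimp only at hab
    split_ifs at hab with h1 h2 h2
    · exact h.inj h1 h2 hab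
    · exact absurd (hab ▸ hb.1) (h.fresh a h1)
    · exact absurd (hab ▸ ha.1) (h.fresh b h2)
    · exact hab
  · intro a ha
    rw [Finset.mem_coe, Finset.mem_filter] at ha ⊢
    refine ⟨?_, ha.2⟩
    dsimp only
    split_ifs with h1
    · exact h.mem_new h1
    · exact h.mem_old ha.1
  · intro b hb hb'
    rw [Finset.mem_filter] at hb
    rcases (h.mem_nodes b).1 hb.1 with hbT | ⟨w, hw, rfl⟩
    · by_cases hS : b ∈ S
      · have : {x | R.IsHome x b} = ∅ := Set.eq_empty_of_forall_notMem fun x => h.not_isHome hS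
        rw [weight, this, Set.ncard_empty]
      · refine absurd ⟨b, ?_, if_neg hS⟩ hb'
        rw [Finset.mem_coe, Finset.mem_filter, if_neg hS]
        exact ⟨hbT, hb.2⟩
    · refine absurd ⟨w, ?_, if_pos hw⟩ hb'
      rw [Finset.mem_coe, Finset.mem_filter, if_pos hw]
      exact ⟨h.mem_of w hw, hb.2⟩
  · intro u hu
    rw [Finset.mem_filter] at hu
    unfold weight
    congr 1
    ext x
    simp only [Set.mem_ofPred_eq]
    split_ifs with h1
    · exact (h.isHome_new hU h1).symm
    · exact (h.isHome_notMem hU hu.1 h1).symm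

lemma subtreeWeight_old (h : Splitting T S n R) (hU : T.UniqueC) {a : ν} (ha : a ∈ T.nodes) :
    R.subtreeWeight a = T.subtreeWeight a := by
  classical
  unfold subtreeWeight
  rw [h.sum_weight hU]
  congr 1
  refine Finset.filter_congr fun u hu => ?_
  split_ifs with h1
  · exact h.new_below_iff h1 ha
  · exact h.below_iff hu ha

lemma subtreeWeight_new (h : Splitting T S n R) (hU : T.UniqueC) {v : ν} (hv : v ∈ S) :
    R.subtreeWeight (n v) = T.branchWeight v := by
  classical
  unfold subtreeWeight branchWeight
  rw [h.sum_weight hU]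
  congr 1
  refine Finset.filter_congr fun u hu => ?_
  rw [h.below_new_iff hv]
  refine or_congr ?_ (exists_congr fun b => and_congr_right fun hb => ?_)
  · split_ifs with h1
    · exact ⟨fun he => h.inj h1 hv he, fun he => he ▸ rfl⟩
    · exact ⟨fun he => absurd (he ▸ hu) (h.fresh v hv), fun he => absurd (he ▸ hv) h1⟩
  · split_ifs with h1
    · exact h.new_below_iff h1 (mem_child hb.1)
    · exact h.below_iff hu (mem_child hb.1)

lemma heavy_old (h : Splitting T S n R) (hU : T.UniqueC) {a p : ν} (hR : R.parent a = some p)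
    (hT : T.parent a = some p) : R.Heavy a ↔ T.Heavy a := by
  rw [PDTree.heavy_iff hR, PDTree.heavy_iff hT, h.subtreeWeight_old hU (mem_parent hT),
    h.subtreeWeight_old hU (mem_child hT)]

lemma heavy_moved (h : Splitting T S n R) (hU : T.UniqueC) {b v : ν} (hv : v ∈ S)
    (hb : T.DashedChild b v) : R.Heavy b ↔ T.branchWeight v < 2 * T.subtreeWeight b := by
  rw [PDTree.heavy_iff (h.moved v hv b hb), h.subtreeWeight_new hU hv,
    h.subtreeWeight_old hU (mem_child hb.1)]

end Splitting

lemma exists_splitting_innerHeavy (hmem : ∀ v ∈ S, v ∈ T.nodes) (hkind : ∀ v ∈ S, T.kind v = Kind.C)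
    (hinj : Set.InjOn n S) (hfresh : ∀ v ∈ S, n v ∉ T.nodes) :
    ∃ R, Splitting T S n R ∧ InnerHeavy T S R := by
  obtain ⟨R, hR, hR'⟩ := exists_splitting hmem hkind hinj hfresh
    {b | ∃ v, T.DashedChild b v ∧ T.branchWeight v < 2 * T.subtreeWeight b} (by
      rintro v - b c hb hc ⟨v₁, hb', hbw⟩ ⟨v₂, hc', hcw⟩
      have h1 : v = v₁ := Option.some_injective _ (hb.1.symm.trans hb'.1)
      have h2 : v = v₂ := Option.some_injective _ (hc.1.symm.trans hc'.1)
      subst h1 h2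
      by_contra hne
      have := subtreeWeight_add_le_branchWeight hb hc hne
      omega)
  refine ⟨R, hR, fun v hv b hb => (hR' v hv b hb).trans ⟨?_, fun hw => ⟨v, hb, hw⟩⟩⟩
  rintro ⟨v₁, hb', hbw⟩
  rwa [Option.some_injective _ (hb.1.symm.trans hb'.1)]

/-! ### Comparing the weights of two trees -/

/-- Two trees that agree on a set `D` of nodes that is closed under passing to children have the
same subtrees below the nodes in `D`. -/
lemma below_congr {D : Set ν} (hc : ∀ w ∈ D, ∀ u, T.parent u = some w ↔ T'.parent u = some w)
    (hD : ∀ w ∈ D, ∀ u, T.parent u = some w → u ∈ D) {a b : ν} (hb : b ∈ D) :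
    T.Below a b ↔ T'.Below a b := by
  constructor
  · intro h
    suffices a ∈ D ∧ T'.Below a b from this.2
    induction h using Relation.ReflTransGen.head_induction_on with
    | refl => exact ⟨hb, Relation.ReflTransGen.refl⟩
    | head h _ ih => exact ⟨hD _ ih.1 _ h, Relation.ReflTransGen.head ((hc _ ih.1 _).1 h) ih.2⟩
  · intro h
    suffices a ∈ D ∧ T.Below a b from this.2
    induction h using Relation.ReflTransGen.head_induction_on with
    | refl => exact ⟨hb, Relation.ReflTransGen.refl⟩
    | head h _ ih =>
      have h' := (hc _ ih.1 _).2 h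
      exact ⟨hD _ ih.1 _ h', Relation.ReflTransGen.head h' ih.2⟩

lemma mem_of_below_mem {D : Set ν} (hD : ∀ w ∈ D, ∀ u, T.parent u = some w → u ∈ D) {a b : ν}
    (hb : b ∈ D) (h : T.Below a b) : a ∈ D := by
  induction h using Relation.ReflTransGen.head_induction_on with
  | refl => exact hb
  | head h _ ih => exact hD _ ih _ h

lemma subtreeWeight_congr {D : Set ν}
    (hc : ∀ w ∈ D, ∀ u, T.parent u = some w ↔ T'.parent u = some w)
    (hD : ∀ w ∈ D, ∀ u, T.parent u = some w → u ∈ D) (hw : ∀ u ∈ D, T.weight u = T'.weight u)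
    {b : ν} (hb : b ∈ D) (hbT : b ∈ T.nodes) (hbT' : b ∈ T'.nodes) :
    T.subtreeWeight b = T'.subtreeWeight b := by
  classical
  unfold subtreeWeight
  refine Finset.sum_congr ?_ fun u hu => hw u
    (mem_of_below_mem hD hb ((below_congr hc hD hb).2 (Finset.mem_filter.1 hu).2))
  ext u
  rw [Finset.mem_filter, Finset.mem_filter, below_congr hc hD hb]
  refine and_congr_left fun hu => ⟨fun _ => hu.mem_left hbT', fun _ => ?_⟩
  exact ((below_congr hc hD hb).2 hu).mem_left hbT

lemma branchWeight_congr {D : Set ν}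
    (hc : ∀ w ∈ D, ∀ u, T.parent u = some w ↔ T'.parent u = some w)
    (hD : ∀ w ∈ D, ∀ u, T.parent u = some w → u ∈ D) (hw : ∀ u ∈ D, T.weight u = T'.weight u)
    {v : ν} (hv : T.weight v = T'.weight v) (hvT : v ∈ T.nodes) (hvT' : v ∈ T'.nodes)
    (hd : ∀ b, T.DashedChild b v ↔ T'.DashedChild b v) (hdD : ∀ b, T.DashedChild b v → b ∈ D) :
    T.branchWeight v = T'.branchWeight v := by
  classical
  unfold branchWeight
  refine Finset.sum_congr ?_ fun u hu => ?_
  · ext u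
    rw [Finset.mem_filter, Finset.mem_filter]
    constructor
    · rintro ⟨-, rfl | ⟨b, hb, hub⟩⟩
      · exact ⟨hvT', Or.inl rfl⟩
      · have hb' := (below_congr hc hD (hdD b hb)).1 hub
        exact ⟨hb'.mem_left (mem_child ((hd b).1 hb).1), Or.inr ⟨b, (hd b).1 hb, hb'⟩⟩
    · rintro ⟨-, rfl | ⟨b, hb, hub⟩⟩
      · exact ⟨hvT, Or.inl rfl⟩
      · have hb' := (below_congr hc hD (hdD b ((hd b).2 hb))).2 hub
        exact ⟨hb'.mem_left (mem_child ((hd b).2 hb).1), Or.inr ⟨b, (hd b).2 hb, hb'⟩⟩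
  · rcases (Finset.mem_filter.1 hu).2 with rfl | ⟨b, hb, hub⟩
    · exact hv
    · have hb' := hdD b ((hd b).2 hb)
      exact hw u (mem_of_below_mem hD hb' ((below_congr hc hD hb').2 hub))

lemma SameTree.weight_eq (h : SameTree T T') (a : ν) : T'.weight a = T.weight a := by
  unfold weight
  simp only [h.isHome_iff]

lemma SameTree.subtreeWeight_eq (h : SameTree T T') (a : ν) :
    T'.subtreeWeight a = T.subtreeWeight a := by
  classical
  unfold subtreeWeight
  rw [h.nodes_eq]
  exact Finset.sum_congr (Finset.filter_congr fun u _ => h.below_iff) fun u _ => h.weight_eq u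

lemma SameTree.branchWeight_eq (h : SameTree T T') {v : ν}
    (hv : ∀ b, T.parent b = some v → (b ∈ T'.solid ↔ b ∈ T.solid)) :
    T'.branchWeight v = T.branchWeight v := by
  classical
  have hd : ∀ b, T'.DashedChild b v ↔ T.DashedChild b v := fun b => by
    unfold DashedChild
    rw [h.parent_eq]
    exact and_congr_right fun hb => not_congr (hv b hb)
  unfold branchWeight
  rw [h.nodes_eq]
  refine Finset.sum_congr (Finset.filter_congr fun u _ => ?_) fun u _ => h.weight_eq u
  simp only [hd, h.below_iff]

/-! ### Pre-split trees are split trees -/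

lemma notMem_edgeSet_of_singleton {H : Graph α β} (hG : G.Loopless) (h : H ≤ G) {x : α}
    (hx : V(H) = {x}) (e : β) : e ∉ E(H) := by
  intro he
  obtain ⟨y, z, hyz⟩ := Graph.exists_isLink_of_mem_edgeSet he
  have hy : y = x := by simpa [hx] using hyz.left_mem
  have hz : z = x := by simpa [hx] using hyz.right_mem
  subst hy hz
  exact hG.not_isLoopAt e _ (h.isLink_mono hyz)

lemma eq_of_singleton {H H' : Graph α β} (hG : G.Loopless) (h : H ≤ G) (h' : H' ≤ G) {x : α}
    (hx : V(H) = {x}) (hx' : V(H') = {x}) : H = H' := by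
  refine Graph.ext (hx.trans hx'.symm) fun e y z => ⟨fun hl => ?_, fun hl => ?_⟩
  · exact absurd hl.edge_mem (notMem_edgeSet_of_singleton hG h hx e)
  · exact absurd hl.edge_mem (notMem_edgeSet_of_singleton hG h' hx' e)

lemma not_B_of_C {a : ν} (h : T.kind a = Kind.C) : T.kind a ≠ Kind.B := by
  rw [h]
  exact Kind.noConfusion

lemma C_of_not_B {a : ν} (h : T.kind a ≠ Kind.B) : T.kind a = Kind.C := by
  rcases hk : T.kind a with _ | _
  · exact absurd hk h
  · rfl

lemma splitNodes_mem_nodes {v : ν} (h : v ∈ T.splitNodes) : v ∈ T.nodes := mem_of_solid h.2.1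

/-- In a tree with a heavy path decomposition, below a dashed edge solid edges are the heavy ones. -/
lemma IsHPD.solid_iff_of_dashed {e : Option ν} (h : R.IsHPD e) {a b c : ν}
    (ha : R.parent a = some b) (hb : R.DashedChild b c) : a ∈ R.solid ↔ R.Heavy a := by
  rcases e with _ | e
  · exact h a b ha
  · have hn : ¬ R.Below e b := fun hn => hb.2 ((h.2 b c hb.1).2 (Or.inl hn))
    rw [h.2 a b ha]
    exact ⟨fun h' => (h'.resolve_left fun hn' => hn (Relation.ReflTransGen.tail hn' ha)).2,
      fun h' => Or.inr ⟨hn, h'⟩⟩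

lemma IsPreSplit.exists_splitting {e : Option ν} (h : IsPreSplit G e T R) :
    ∃ n, Splitting T T.splitNodes n R ∧ InnerHeavy T T.splitNodes R := by
  classical
  have hc := h.corresponds
  have hi := h.invariants
  have secC : ∀ c, R.Secondary c → R.kind c = Kind.C := fun c hs =>
    C_of_not_B fun hk => hs.2 ⟨hs.1, Or.inr (Or.inl hk)⟩
  have secP : ∀ c p, R.Secondary c → R.parent c = some p → R.DashedChild c p ∧ R.Primary p ∧
      R.kind p = Kind.C ∧ (∃ q, R.parent p = some q) ∧ ∃ d, R.SolidChild d p := by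
    intro c p hs hp
    obtain ⟨-, p', hd, hP, hq, hsol⟩ := hi.secondary c hs
    have := hd.1
    rw [hp] at this
    cases this
    exact ⟨hd, hP, C_of_not_B fun hk => hs.2 ⟨hs.1, Or.inr (Or.inr ⟨p, hp, hk⟩)⟩, hq, hsol⟩
  have uniq : ∀ c v b, R.Secondary c → R.parent c = some v → R.DashedChild b v → b = c := by
    intro c v b hs hp hb
    by_contra hne
    obtain ⟨hd, hP, hk, hq, hsol⟩ := secP c v hs hp
    exact hi.not_both v ⟨⟨hP.1, hk, hq, hsol, b, c, hne, hb, hd⟩, c, hp, hs⟩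
  have tpar : ∀ b p, T.parent b = some p → ∃ q, R.parent b = some q ∧
      ((q = p ∧ R.Primary q) ∨ (R.Secondary q ∧ R.parent q = some p)) := by
    intro b p hb
    obtain ⟨-, hpp, q, hq, hqp⟩ := (hc.parent_iff b p).1 hb
    refine ⟨q, hq, ?_⟩
    rcases Relation.ReflTransGen.cases_head hqp with rfl | ⟨d, ⟨hs, hd⟩, hdp⟩
    · exact Or.inl ⟨rfl, hpp⟩
    · rcases Relation.ReflTransGen.cases_head hdp with rfl | ⟨d', ⟨hs', -⟩, -⟩
      · exact Or.inr ⟨hs, hd⟩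
      · exact absurd (secP q d hs hd).2.1 hs'.2
  let n : ν → ν := fun v => if hm : R.Mergeable v then hm.choose else v
  have hn : ∀ v, R.Mergeable v → R.parent (n v) = some v ∧ R.Secondary (n v) := by
    intro v hm
    simp only [n, dif_pos hm]
    exact hm.choose_spec
  have hM : ∀ v, R.Mergeable v → R.Primary v ∧ R.kind v = Kind.C := by
    intro v hm
    obtain ⟨h1, h2⟩ := hn v hm
    have := secP _ _ h2 h1
    exact ⟨this.2.1, this.2.2.1⟩
  have hS : Splitting T {v | R.Mergeable v} n R := by
    refine ⟨fun v hv => (hc.mem_nodes v).2 (hM v hv).1, fun v hv => ?_, fun v hv w hw hvw => ?_,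
      fun v hv hm => (hn v hv).2.2 ((hc.mem_nodes _).1 hm), fun b => ⟨fun hb => ?_, ?_⟩,
      hc.root_eq.symm, fun b hb => (hc.kind_eq b hb).symm, fun b hb => (hc.skel_eq b hb).symm,
      fun v hv => secC _ (hn v hv).2, fun v hv => ?_, fun v hv => (hn v hv).1,
      fun v hv => (secP _ _ (hn v hv).2 (hn v hv).1).1.2, fun v hv b hb => ?_, fun b hb hno => ?_⟩
    · rw [hc.kind_eq v ((hc.mem_nodes v).2 (hM v hv).1)]
      exact (hM v hv).2
    · have := (hn v hv).1
      rw [hvw, (hn w hw).1] at this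
      exact (Option.some_injective _ this).symm
    · by_cases hP : R.Primary b
      · exact Or.inl ((hc.mem_nodes b).2 hP)
      · have hs : R.Secondary b := ⟨hb, hP⟩
        obtain ⟨-, p, hd, -⟩ := hi.secondary b hs
        have hm : R.Mergeable p := ⟨b, hd.1, hs⟩
        exact Or.inr ⟨p, hm, uniq _ p b (hn p hm).2 (hn p hm).1 hd⟩
    · rintro (hb | ⟨v, hv, rfl⟩)
      · exact ((hc.mem_nodes b).1 hb).1
      · exact (hn v hv).2.1
    · have hm := hM v hv
      obtain ⟨x, hx, -⟩ := h.relaxed.skel_C v hm.1.1 hm.2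
      obtain ⟨y, hy, -⟩ := h.relaxed.skel_C (n v) (hn v hv).2.1 (secC _ (hn v hv).2)
      have hxy := h.relaxed.common_vertex _ _ (hn v hv).1
      rw [hx, hy, Set.singleton_inter_nonempty, Set.mem_singleton_iff] at hxy
      rw [hc.skel_eq v ((hc.mem_nodes v).2 hm.1)]
      exact eq_of_singleton h.relaxed.base.loopless (h.relaxed.skel_le _ (hn v hv).2.1)
        (h.relaxed.skel_le v hm.1.1) hy (hxy ▸ hx)
    · obtain ⟨q, hq, ⟨rfl, hP⟩ | ⟨hs, hqv⟩⟩ := tpar b v hb.1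
      · by_cases hbs : b ∈ R.solid
        · exact absurd ((hc.solid_iff b (mem_child hb.1)).2 ⟨hbs, q, hq, hP⟩) hb.2
        · have := uniq _ _ b (hn _ hv).2 (hn _ hv).1 ⟨hq, hbs⟩
          exact absurd ((hc.mem_nodes b).1 (mem_child hb.1)) (this ▸ (hn _ hv).2.2)
      · rw [hq, uniq _ _ q (hn v hv).2 (hn v hv).1 (secP q v hs hqv).1]
    · rcases hp : T.parent b with _ | p
      · have hr : b = T.root := by
          by_contra hr
          obtain ⟨p, hp'⟩ := exists_parent hb hr
          rw [hp] at hp'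
          cases hp'
        have hp' : R.parent b = none := by rw [hr, hc.root_eq, R.parent_root]
        refine ⟨hp', fun hs => ?_, fun hs => ?_⟩
        · obtain ⟨q, hq⟩ := R.parent_of_solid b hs
          rw [hp'] at hq
          cases hq
        · obtain ⟨q, hq⟩ := T.parent_of_solid b hs
          rw [hp] at hq
          cases hq
      · obtain ⟨q, hq, ⟨rfl, hP⟩ | ⟨hs, hqv⟩⟩ := tpar b p hp
        · exact ⟨hq, fun hs => (hc.solid_iff b hb).2 ⟨hs, q, hq, hP⟩,
            fun hs => ((hc.solid_iff b hb).1 hs).1⟩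
        · refine absurd ⟨hp, fun hbs => ?_⟩ (hno p ⟨q, hqv, hs⟩)
          obtain ⟨-, q', hq', hP⟩ := (hc.solid_iff b hb).1 hbs
          rw [hq] at hq'
          cases hq'
          exact hs.2 hP
  have hparent : ∀ v p, T.kind v = Kind.C → T.parent v = some p →
      T.kind p = Kind.B ∧ R.parent v = some p ∧ (v ∈ R.solid ↔ v ∈ T.solid) := by
    intro v p hk hp
    have hB := (h.strict.alternating v p hp).resolve_left (not_B_of_C hk)
    exact ⟨hB, hS.parent_notMem hp fun hm => not_B_of_C (hS.kind_of p hm) hB⟩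
  have hMS : {v | R.Mergeable v} = T.splitNodes := by
    ext v
    constructor
    · intro hv
      have hk := hS.kind_of v hv
      have hvT := hS.mem_of v hv
      obtain ⟨⟨c, d, hcd, hcp, hdp⟩, -⟩ := hi.secondary _ (hn v hv).2
      obtain ⟨-, hP, -, ⟨q, hq⟩, s, hs⟩ := secP _ _ (hn v hv).2 (hn v hv).1
      have hvr : v ≠ T.root := fun hr => ne_root hq (hr.trans hc.root_eq)
      obtain ⟨p, hp⟩ := exists_parent hvT hvr
      obtain ⟨hB, hRp, hsol⟩ := hparent v p hk hp
      refine ⟨hk, ?_, ⟨s, (hS.solidChild_iff hvT).1 hs⟩, c, d, hcd,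
        hS.dashedChild_of_parent_new hv hcp, hS.dashedChild_of_parent_new hv hdp⟩
      by_contra hvs
      refine hi.merge_rule v hP ⟨p, ⟨hRp, fun hc => hvs (hsol.1 hc)⟩, Or.inl ?_⟩ hv
      rw [hS.kind_eq p (mem_parent hp), hB]
    · intro hv
      by_contra hvM
      have hvT := splitNodes_mem_nodes hv
      obtain ⟨hk, hvs, ⟨s, hs⟩, c, d, hcd, hcv, hdv⟩ := hv
      have hsol := (hS.parent_solid hvs).2
      refine hi.split_rule v ((hc.mem_nodes v).1 hvT) (Or.inr (Or.inl hsol))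
        ⟨hS.mem_old hvT, (hS.kind_eq v hvT).trans hk, R.parent_of_solid v hsol,
          ⟨s, (hS.solidChild_iff hvT).2 hs⟩, c, d, hcd, ?_, ?_⟩
      · exact (hS.dashedChild_iff_of_notMem hvT hvM).2 hcv
      · exact (hS.dashedChild_iff_of_notMem hvT hvM).2 hdv
  rw [hMS] at hS
  refine ⟨n, hS, fun v hv b hb => ?_⟩
  rw [h.relaxed_hpd.solid_iff_of_dashed (hS.moved v hv b hb)
    ((hS.dashedChild_iff hv).2 rfl), hS.heavy_moved h.strict.uniqueC hv hb]

/-! ### Split trees are pre-split trees -/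

namespace Splitting

lemma parent_C (h : Splitting T S n R) (hA : T.Alternating) {v p : ν} (hk : T.kind v = Kind.C)
    (hp : T.parent v = some p) :
    T.kind p = Kind.B ∧ R.parent v = some p ∧ (v ∈ R.solid ↔ v ∈ T.solid) := by
  have hB := (hA v p hp).resolve_left (not_B_of_C hk)
  exact ⟨hB, h.parent_notMem hp fun hm => not_B_of_C (h.kind_of p hm) hB⟩

lemma path_lift (h : Splitting T S n R) {x : α} {a b : ν} (ha : a ∈ T.nodes)
    (hx : x ∈ V(T.skel a))
    (hab : Relation.ReflTransGen (fun c d => T.TAdj c d ∧ x ∈ V(T.skel d)) a b) :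
    Relation.ReflTransGen (fun c d => R.TAdj c d ∧ x ∈ V(R.skel d)) a b := by
  suffices b ∈ T.nodes ∧ x ∈ V(T.skel b) ∧
    Relation.ReflTransGen (fun c d => R.TAdj c d ∧ x ∈ V(R.skel d)) a b from this.2.2
  induction hab with
  | refl => exact ⟨ha, hx, Relation.ReflTransGen.refl⟩
  | tail _ hcd ih =>
    rename_i c d _
    obtain ⟨hadj, hxd⟩ := hcd
    obtain ⟨hcT, hxc, hac⟩ := ih
    have hdT : d ∈ T.nodes := by
      rcases hadj with hp | hp
      · exact mem_parent hp
      · exact mem_child hp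
    have hxd' : x ∈ V(R.skel d) := by rwa [h.skel_eq d hdT]
    refine ⟨hdT, hxd, ?_⟩
    rcases hadj with hp | hp
    · by_cases hm : ∃ v ∈ S, T.DashedChild c v
      · obtain ⟨v, hv, hd⟩ := hm
        have hvd : v = d := Option.some_injective _ (hd.1.symm.trans hp)
        subst hvd
        refine Relation.ReflTransGen.tail (Relation.ReflTransGen.tail hac
          ⟨Or.inl (h.moved v hv c hd), ?_⟩) ⟨Or.inl (h.parent_new v hv), hxd'⟩
        rwa [h.skel_new v hv]
      · push Not at hm
        exact Relation.ReflTransGen.tail hac ⟨Or.inl ((h.kept c hcT hm).1.trans hp), hxd'⟩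
    · by_cases hm : ∃ v ∈ S, T.DashedChild d v
      · obtain ⟨v, hv, hd⟩ := hm
        have hvd : v = c := Option.some_injective _ (hd.1.symm.trans hp)
        subst hvd
        refine Relation.ReflTransGen.tail (Relation.ReflTransGen.tail hac
          ⟨Or.inr (h.parent_new v hv), ?_⟩) ⟨Or.inr (h.moved v hv d hd), hxd'⟩
        rwa [h.skel_new v hv]
      · push Not at hm
        exact Relation.ReflTransGen.tail hac ⟨Or.inr ((h.kept d hdT hm).1.trans hp), hxd'⟩

lemma isRelaxedBC (h : Splitting T S n R) (hs : IsStrictBC G T) : IsRelaxedBC G R where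
  base := hs.base
  skel_le a ha := by
    rcases (h.mem_nodes a).1 ha with ha | ⟨v, hv, rfl⟩
    · rw [h.skel_eq a ha]
      exact hs.skel_le a ha
    · rw [h.skel_new v hv]
      exact hs.skel_le v (h.mem_of v hv)
  edge_unique f hf := by
    obtain ⟨a, ⟨ha, hfa⟩, hu⟩ := hs.edge_unique f hf
    refine ⟨a, ⟨h.mem_old ha, by rwa [h.skel_eq a ha]⟩, ?_⟩
    rintro b ⟨hb, hfb⟩
    rcases (h.mem_nodes b).1 hb with hb | ⟨v, hv, rfl⟩
    · exact hu b ⟨hb, by rwa [h.skel_eq b hb] at hfb⟩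
    · rw [h.skel_new v hv] at hfb
      obtain ⟨x, hx, -⟩ := hs.skel_C v (h.mem_of v hv) (h.kind_of v hv)
      exact absurd hfb (notMem_edgeSet_of_singleton hs.base.loopless
        (hs.skel_le v (h.mem_of v hv)) hx f)
  common_vertex a b hab := by
    rcases h.parent_cases hab with ⟨ha, hp, _⟩ | ⟨v, hv, hd, rfl⟩ | ⟨v, hv, rfl, rfl⟩
    · rw [h.skel_eq a ha, h.skel_eq b (mem_parent hp)]
      exact hs.common_vertex a b hp
    · rw [h.skel_eq a (mem_child hd.1), h.skel_new v hv]
      exact hs.common_vertex a v hd.1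
    · rw [h.skel_eq _ (h.mem_of _ hv), h.skel_new _ hv, Set.inter_self]
      obtain ⟨x, hx, -⟩ := hs.skel_C _ (h.mem_of _ hv) (h.kind_of _ hv)
      rw [hx]
      exact Set.singleton_nonempty x
  not_both_B a b hab := by
    rcases h.parent_cases hab with ⟨ha, hp, _⟩ | ⟨v, hv, hd, rfl⟩ | ⟨v, hv, rfl, rfl⟩
    · rw [h.kind_eq a ha, h.kind_eq b (mem_parent hp)]
      exact hs.not_both_B a b hp
    · exact Or.inr (h.kind_new v hv)
    · exact Or.inl (h.kind_new _ hv)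
  skel_B a ha hk := by
    rcases (h.mem_nodes a).1 ha with ha | ⟨v, hv, rfl⟩
    · rw [h.kind_eq a ha] at hk
      rw [h.skel_eq a ha]
      exact hs.skel_B a ha hk
    · rw [h.kind_new v hv] at hk
      cases hk
  skel_C a ha hk := by
    rcases (h.mem_nodes a).1 ha with ha | ⟨v, hv, rfl⟩
    · rw [h.kind_eq a ha] at hk
      rw [h.skel_eq a ha]
      exact hs.skel_C a ha hk
    · rw [h.skel_new v hv]
      exact hs.skel_C v (h.mem_of v hv) (h.kind_of v hv)
  connected x a ha b hb hxa hxb := by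
    have key : ∀ a ∈ R.nodes, x ∈ V(R.skel a) → ∃ a' ∈ T.nodes, x ∈ V(T.skel a') ∧
        Relation.ReflTransGen (fun c d => R.TAdj c d ∧ x ∈ V(R.skel d)) a a' ∧
        Relation.ReflTransGen (fun c d => R.TAdj c d ∧ x ∈ V(R.skel d)) a' a := by
      intro a ha hx
      rcases (h.mem_nodes a).1 ha with ha | ⟨v, hv, rfl⟩
      · exact ⟨a, ha, by rwa [h.skel_eq a ha] at hx, Relation.ReflTransGen.refl,
          Relation.ReflTransGen.refl⟩
      · have hx' := hx
        rw [h.skel_new v hv] at hx'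
        refine ⟨v, h.mem_of v hv, hx', Relation.ReflTransGen.single ⟨Or.inl (h.parent_new v hv), ?_⟩,
          Relation.ReflTransGen.single ⟨Or.inr (h.parent_new v hv), hx⟩⟩
        rwa [h.skel_eq v (h.mem_of v hv)]
    obtain ⟨a', ha', hxa', h1, -⟩ := key a ha hxa
    obtain ⟨b', hb', hxb', -, h2⟩ := key b hb hxb
    exact (h1.trans (h.path_lift ha' hxa' (hs.connected x a' ha' b' hb' hxa' hxb'))).trans h2
  connected_C x a ha b hb hka hkb hxa hxb := by
    have key : ∀ a ∈ R.nodes, R.kind a = Kind.C → x ∈ V(R.skel a) → ∃ a' ∈ T.nodes,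
        x ∈ V(T.skel a') ∧ T.kind a' = Kind.C ∧
        Relation.ReflTransGen (fun c d => R.TAdj c d ∧ R.kind d = Kind.C ∧ x ∈ V(R.skel d)) a a' ∧
        Relation.ReflTransGen
          (fun c d => R.TAdj c d ∧ R.kind d = Kind.C ∧ x ∈ V(R.skel d)) a' a := by
      intro a ha hk hx
      rcases (h.mem_nodes a).1 ha with ha | ⟨v, hv, rfl⟩
      · exact ⟨a, ha, by rwa [h.skel_eq a ha] at hx, by rwa [h.kind_eq a ha] at hk,
          Relation.ReflTransGen.refl, Relation.ReflTransGen.refl⟩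
      · have hx' := hx
        rw [h.skel_new v hv] at hx'
        refine ⟨v, h.mem_of v hv, hx', h.kind_of v hv,
          Relation.ReflTransGen.single ⟨Or.inl (h.parent_new v hv), ?_, ?_⟩,
          Relation.ReflTransGen.single ⟨Or.inr (h.parent_new v hv), hk, hx⟩⟩
        · rw [h.kind_eq v (h.mem_of v hv), h.kind_of v hv]
        · rwa [h.skel_eq v (h.mem_of v hv)]
    obtain ⟨a', ha', hxa', hka', h1, -⟩ := key a ha hka hxa
    obtain ⟨b', hb', hxb', hkb', -, h2⟩ := key b hb hkb hxb
    rw [← hs.uniqueC a' ha' b' hb' hka' hkb' x hxa' hxb'] at h2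
    exact h1.trans h2

lemma corresponds (h : Splitting T S n R) (hA : T.Alternating) : Corresponds T R where
  mem_nodes a := (h.primary_iff hA).symm
  root_eq := h.root_eq.symm
  kind_eq a ha := (h.kind_eq a ha).symm
  skel_eq a ha := (h.skel_eq a ha).symm
  parent_iff a p := by
    rw [h.primary_iff hA, h.primary_iff hA]
    have hterm : ∀ q, q ∈ T.nodes →
        Relation.ReflTransGen (fun c d => R.Secondary c ∧ R.parent c = some d) q p → q = p := by
      intro q hq hqp
      rcases Relation.ReflTransGen.cases_head hqp with rfl | ⟨d, ⟨hs, -⟩, -⟩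
      · rfl
      · exact absurd ((h.primary_iff hA).2 hq) hs.2
    constructor
    · intro hp
      refine ⟨mem_child hp, mem_parent hp, ?_⟩
      by_cases hm : ∃ v ∈ S, T.DashedChild a v
      · obtain ⟨v, hv, hd⟩ := hm
        have hvp : v = p := Option.some_injective _ (hd.1.symm.trans hp)
        subst hvp
        exact ⟨n v, h.moved v hv a hd, Relation.ReflTransGen.single
          ⟨(h.secondary_iff hA).2 ⟨v, hv, rfl⟩, h.parent_new v hv⟩⟩
      · push Not at hm
        exact ⟨p, (h.kept a (mem_child hp) hm).1.trans hp, Relation.ReflTransGen.refl⟩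
    · rintro ⟨ha, hp, q, hq, hqp⟩
      rcases h.parent_cases hq with ⟨_, hp', _⟩ | ⟨v, hv, hd, rfl⟩ | ⟨v, hv, rfl, rfl⟩
      · rw [← hterm q (mem_parent hp') hqp]
        exact hp'
      · rcases Relation.ReflTransGen.cases_head hqp with rfl | ⟨d, ⟨-, hpd⟩, hdp⟩
        · exact absurd hp (h.fresh v hv)
        · rw [h.parent_new v hv] at hpd
          cases hpd
          rw [← hterm v (h.mem_of v hv) hdp]
          exact hd.1
      · exact absurd ha (h.fresh _ hv)
  solid_iff a ha := by
    constructor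
    · intro hs
      obtain ⟨h1, h2⟩ := h.parent_solid hs
      obtain ⟨p, hp⟩ := T.parent_of_solid a hs
      exact ⟨h2, p, h1.trans hp, (h.primary_iff hA).2 (mem_parent hp)⟩
    · rintro ⟨hs, q, hq, hP⟩
      rw [h.primary_iff hA] at hP
      rcases h.parent_cases hq with ⟨_, _, _, hiff⟩ | ⟨v, hv, _, rfl⟩ | ⟨v, hv, rfl, rfl⟩
      · exact hiff.1 hs
      · exact absurd hP (h.fresh v hv)
      · exact absurd ha (h.fresh _ hv)

lemma mergeable_mem (h : Splitting T S n R) (hA : T.Alternating) {a : ν} (ha : R.Mergeable a) :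
    a ∈ S := by
  obtain ⟨c, hc, hs⟩ := ha
  obtain ⟨v, hv, rfl⟩ := (h.secondary_iff hA).1 hs
  rw [h.parent_new v hv] at hc
  cases hc
  exact hv

lemma not_splittable (h : Splitting T S n R) {a : ν} (ha : a ∈ S) : ¬ R.Splittable a := by
  rintro ⟨-, -, -, -, c, d, hcd, hc, hd⟩
  rw [h.dashedChild_iff ha] at hc hd
  exact hcd (hc.trans hd.symm)

lemma preSplitInvariants (h : Splitting T T.splitNodes n R) (hA : T.Alternating) :
    R.PreSplitInvariants where
  not_both a ha := h.not_splittable (h.mergeable_mem hA ha.2) ha.1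
  secondary a ha := by
    obtain ⟨v, hv, rfl⟩ := (h.secondary_iff hA).1 ha
    obtain ⟨hk, hvs, ⟨s, hs⟩, c, d, hcd, hc, hd⟩ := id hv
    have hvT := h.mem_of v hv
    exact ⟨⟨c, d, hcd, h.moved v hv c hc, h.moved v hv d hd⟩, v, (h.dashedChild_iff hv).2 rfl,
      (h.primary_iff hA).2 hvT, R.parent_of_solid v (h.parent_solid hvs).2, s,
      (h.solidChild_iff hvT).2 hs⟩
  split_rule a hP hcase hsp := by
    have haT := (h.primary_iff hA).1 hP
    have haS : a ∉ T.splitNodes := fun haS => h.not_splittable haS hsp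
    obtain ⟨-, hk, ⟨p', hp'⟩, ⟨s, hs⟩, c, d, hcd, hc, hd⟩ := hsp
    rw [h.kind_eq a haT] at hk
    obtain ⟨p, hp⟩ := exists_parent haT fun hr => ne_root hp' (hr.trans h.root_eq.symm)
    obtain ⟨hB, hRp, hiff⟩ := h.parent_C hA hk hp
    rcases hcase with hr | hsol | ⟨⟨q, hq⟩, hun⟩
    · exact ne_root hp' hr
    · exact haS ⟨hk, hiff.1 hsol, ⟨s, (h.solidChild_iff haT).1 hs⟩, c, d, hcd,
        (h.dashedChild_iff_of_notMem haT haS).1 hc, (h.dashedChild_iff_of_notMem haT haS).1 hd⟩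
    · refine hun ⟨p, ⟨hRp, hq.2⟩, Or.inl ?_⟩
      rw [h.kind_eq p (mem_parent hp), hB]
  merge_rule a hP hst hm := by
    obtain ⟨p, hd, -⟩ := hst
    exact hd.2 (h.parent_solid (h.mergeable_mem hA hm).2.1).2

lemma isHPD (h : Splitting T T.splitNodes n R) (hI : InnerHeavy T T.splitNodes R)
    (hU : T.UniqueC) {e : Option ν} (he : T.IsHPD e) : R.IsHPD e := by
  have light : ∀ v ∈ T.splitNodes, ∀ s, T.SolidChild s v → T.Heavy s → ¬ R.Heavy (n v) := by
    intro v hv s hs hsH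
    have h1 := branchWeight_add_le_subtreeWeight hs
    have h2 := (PDTree.heavy_iff hs.1).1 hsH
    rw [PDTree.heavy_iff (h.parent_new v hv), h.subtreeWeight_new hU hv,
      h.subtreeWeight_old hU (h.mem_of v hv)]
    omega
  rcases e with _ | e
  · intro a p hp
    rcases h.parent_cases hp with ⟨ha, hp', _, hiff⟩ | ⟨v, hv, hd, rfl⟩ | ⟨v, hv, rfl, rfl⟩
    · rw [hiff, h.heavy_old hU hp hp']
      exact he a p hp'
    · rw [hI v hv a hd, h.heavy_moved hU hv hd]
    · obtain ⟨-, -, ⟨s, hs⟩, -⟩ := id hv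
      exact iff_of_false (h.dashed_new _ hv) (light _ hv s hs ((he s _ hs.1).1 hs.2))
  · have hdash : ∀ v b, T.DashedChild b v → ¬ T.Below e b := fun v b hb hbe =>
      hb.2 ((he.2 b v hb.1).2 (Or.inl hbe))
    have hnew : ∀ v ∈ T.splitNodes, ¬ R.Below e (n v) := by
      intro v hv hb
      rcases (h.below_new_iff hv).1 hb with rfl | ⟨b, hb, heb⟩
      · exact h.fresh v hv he.1
      · exact hdash v b hb ((h.below_iff he.1 (mem_child hb.1)).1 heb)
    refine ⟨h.mem_old he.1, fun a p hp => ?_⟩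
    rcases h.parent_cases hp with ⟨ha, hp', _, hiff⟩ | ⟨v, hv, hd, rfl⟩ | ⟨v, hv, rfl, rfl⟩
    · rw [hiff, h.heavy_old hU hp hp', h.below_iff he.1 ha, h.below_iff he.1 (mem_parent hp')]
      exact he.2 a p hp'
    · rw [hI v hv a hd, h.heavy_moved hU hv hd]
      have h1 : ¬ R.Below e a := fun hb => hnew v hv (Relation.ReflTransGen.tail hb hp)
      exact ⟨fun hw => Or.inr ⟨hnew v hv, hw⟩, fun hw => (hw.resolve_left h1).2⟩
    · obtain ⟨-, -, ⟨s, hs⟩, -⟩ := id hv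
      refine iff_of_false (h.dashed_new _ hv) ?_
      rintro (hb | ⟨hb, hH⟩)
      · exact hnew _ hv hb
      · rw [h.below_iff he.1 (h.mem_of _ hv)] at hb
        refine light _ hv s hs (((he.2 s _ hs.1).1 hs.2).resolve_left fun hbs => hb ?_).2 hH
        exact Relation.ReflTransGen.tail hbs hs.1

/-- The splitting of a strict tree at its split nodes is a pre-split tree. -/
lemma isPreSplit (h : Splitting T T.splitNodes n R) (hI : InnerHeavy T T.splitNodes R)
    (hs : IsStrictBC G T) {e : Option ν} (he : T.IsHPD e) : IsPreSplit G e T R where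
  strict := hs
  strict_hpd := he
  relaxed := h.isRelaxedBC hs
  relaxed_hpd := h.isHPD hI hs.uniqueC he
  corresponds := h.corresponds hs.alternating
  invariants := h.preSplitInvariants hs.alternating

end Splitting

/-! ### Transforming split trees by merges, flips and splits -/

lemma Steps.trans {Q : PDTree ν α β} {k k' : ℕ} {l l' : List (Sym2 ν)} (h : Steps T R k l)
    (h' : Steps R Q k' l') : Steps T Q (k + k') (l' ++ l) := by
  induction h' with
  | refl => exact h
  | flip _ hf ih => exact ih.flip hf
  | split _ hf ih => exact ih.split hf
  | merge _ hf ih => exact ih.merge hf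

lemma SameTree.alternating (h : SameTree T T') (hA : T.Alternating) : T'.Alternating := by
  intro a b hab
  rw [h.parent_eq] at hab
  rw [h.kind_eq a (mem_child hab), h.kind_eq b (mem_parent hab)]
  exact hA a b hab

lemma SameTree.uniqueC (h : SameTree T T') (hU : T.UniqueC) : T'.UniqueC := by
  intro a ha b hb hka hkb x hxa hxb
  rw [h.nodes_eq] at ha hb
  rw [h.kind_eq a ha] at hka
  rw [h.kind_eq b hb] at hkb
  rw [h.skel_eq a ha] at hxa
  rw [h.skel_eq b hb] at hxb
  exact hU a ha b hb hka hkb x hxa hxb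

lemma parent_eq_none {a : ν} (h : a ∉ T.nodes) : T.parent a = none := by
  rcases hp : T.parent a with _ | p
  · rfl
  · exact absurd (mem_child hp) h

/-- Names for the new children of all nodes of `T`. -/
def FreshNames (T : PDTree ν α β) (n : ν → ν) : Prop :=
  Set.InjOn n T.nodes ∧ ∀ v ∈ T.nodes, n v ∉ T.nodes

namespace Splitting

lemma exists_freshNames [Infinite ν] (h : Splitting T S n R) :
    ∃ m, FreshNames T m ∧ ∀ v ∈ S, m v = n v := by
  classical
  have : Infinite ((R.nodes : Set ν)ᶜ : Set ν) := R.nodes.finite_toSet.infinite_compl.to_subtype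
  let g := Infinite.natEmbedding ((R.nodes : Set ν)ᶜ : Set ν)
  let f := T.nodes.equivFin
  have hg : ∀ i, (g i : ν) ∉ R.nodes := fun i => (g i).2
  let m : ν → ν := fun v =>
    if v ∈ S then n v else if hv : v ∈ T.nodes then (g (f ⟨v, hv⟩) : ν) else v
  have m1 : ∀ v ∈ S, m v = n v := fun v hv => if_pos hv
  have m2 : ∀ v (hv : v ∈ T.nodes), v ∉ S → m v = (g (f ⟨v, hv⟩) : ν) := fun v hv hS => by
    simp only [m, if_neg hS, dif_pos hv]
  refine ⟨m, ⟨fun v hv w hw hvw => ?_, fun v hv => ?_⟩, m1⟩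
  · by_cases h1 : v ∈ S <;> by_cases h2 : w ∈ S
    · rw [m1 v h1, m1 w h2] at hvw
      exact h.inj h1 h2 hvw
    · rw [m1 v h1, m2 w hw h2] at hvw
      exact absurd (hvw ▸ h.mem_new h1) (hg _)
    · rw [m1 w h2, m2 v hv h1] at hvw
      exact absurd (hvw.symm ▸ h.mem_new h2) (hg _)
    · rw [m2 v hv h1, m2 w hw h2] at hvw
      have := f.injective (Fin.ext (g.injective (Subtype.ext hvw)))
      exact congrArg Subtype.val this
  · by_cases h1 : v ∈ S
    · rw [m1 v h1]
      exact h.fresh v h1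
    · rw [m2 v hv h1]
      exact fun hm => hg _ (h.mem_old hm)

lemma exists_isMerge (h : Splitting T S n R) (hI : InnerHeavy T S R) (hA : T.Alternating) {v : ν}
    (hv : v ∈ S) :
    ∃ R', IsMerge R v R' ∧ Splitting T (S \ {v}) n R' ∧ InnerHeavy T (S \ {v}) R' := by
  obtain ⟨R', h', hI'⟩ := exists_splitting_innerHeavy (T := T) (S := S \ {v}) (n := n)
    (fun w hw => h.mem_of w hw.1) (fun w hw => h.kind_of w hw.1) (h.inj.mono Set.sdiff_subset)
    (fun w hw => h.fresh w hw.1)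
  have hvT := h.mem_of v hv
  have hvS : v ∉ S \ {v} := fun hc => hc.2 rfl
  have hmem : ∀ b, b ∈ R'.nodes ↔ b ∈ R.nodes ∧ ¬ (R.parent b = some v ∧ R.Secondary b) := by
    intro b
    rw [h.mem_nodes, h'.mem_nodes, h.secondary_iff hA]
    constructor
    · rintro (hb | ⟨w, hw, rfl⟩)
      · refine ⟨Or.inl hb, ?_⟩
        rintro ⟨-, w, hw, rfl⟩
        exact h.fresh w hw hb
      · refine ⟨Or.inr ⟨w, hw.1, rfl⟩, ?_⟩
        rintro ⟨hp, -⟩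
        rw [h.parent_new w hw.1] at hp
        cases hp
        exact hw.2 rfl
    · rintro ⟨hb | ⟨w, hw, rfl⟩, hn⟩
      · exact Or.inl hb
      · refine Or.inr ⟨w, ⟨hw, ?_⟩, rfl⟩
        rintro rfl
        exact hn ⟨h.parent_new _ hw, _, hw, rfl⟩
  have hsec : ∀ c, R.parent c = some v → R.Secondary c → c = n v := by
    intro c hc hs
    obtain ⟨w, hw, rfl⟩ := (h.secondary_iff hA).1 hs
    rw [h.parent_new w hw] at hc
    cases hc
    rfl
  refine ⟨R', ⟨(h.primary_iff hA).2 hvT, ⟨n v, h.parent_new v hv, (h.secondary_iff hA).2 ⟨v, hv, rfl⟩⟩,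
    hmem, h'.root_eq.trans h.root_eq.symm, fun b hb => ?_, fun b hb => ?_, fun b hb c hc hcv hs => ?_,
    fun b hb hn => ?_⟩, h', hI'⟩
  · rcases (h'.mem_nodes b).1 hb with hb | ⟨w, hw, rfl⟩
    · rw [h.kind_eq b hb, h'.kind_eq b hb]
    · rw [h.kind_new w hw.1, h'.kind_new w hw]
  · rcases (h'.mem_nodes b).1 hb with hb | ⟨w, hw, rfl⟩
    · rw [h.skel_eq b hb, h'.skel_eq b hb]
    · rw [h.skel_new w hw.1, h'.skel_new w hw]
  · rw [hsec c hcv hs] at hc ⊢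
    have hd := h.dashedChild_of_parent_new hv hc
    obtain ⟨h1, h2⟩ := h'.parent_notMem hd.1 hvS
    exact ⟨h1, iff_of_false (fun hs => hd.2 (h2.1 hs)) fun hs => h.dashed_new v hv hs.2⟩
  · rcases (h'.mem_nodes b).1 hb with hb | ⟨w, hw, rfl⟩
    · by_cases hm : ∃ w ∈ S, T.DashedChild b w
      · obtain ⟨w, hw, hd⟩ := hm
        have hwv : w ≠ v := by
          rintro rfl
          exact hn ⟨n w, h.moved w hw b hd, h.parent_new w hw, (h.secondary_iff hA).2 ⟨w, hw, rfl⟩⟩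
        have hw' : w ∈ S \ {v} := ⟨hw, hwv⟩
        exact ⟨(h'.moved w hw' b hd).trans (h.moved w hw b hd).symm,
          (hI' w hw' b hd).trans (hI w hw b hd).symm⟩
      · push Not at hm
        obtain ⟨h1, h2⟩ := h.kept b hb hm
        obtain ⟨h1', h2'⟩ := h'.kept b hb fun w hw => hm w hw.1
        exact ⟨h1'.trans h1.symm, h2'.trans h2.symm⟩
    · exact ⟨(h'.parent_new w hw).trans (h.parent_new w hw.1).symm,
        iff_of_false (h'.dashed_new w hw) (h.dashed_new w hw.1)⟩

lemma exists_isSplit (h : Splitting T S n R) (hI : InnerHeavy T S R) (hA : T.Alternating)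
    (hU : T.UniqueC) (hn : FreshNames T n) {v : ν} (hv : v ∈ T.splitNodes) (hvS : v ∉ S) :
    ∃ R', IsSplit R v R' ∧ Splitting T (insert v S) n R' ∧ InnerHeavy T (insert v S) R' := by
  have hvT := splitNodes_mem_nodes hv
  have hmemT : ∀ w ∈ insert v S, w ∈ T.nodes := by
    rintro w (rfl | hw)
    · exact hvT
    · exact h.mem_of w hw
  obtain ⟨R', h', hI'⟩ := exists_splitting_innerHeavy (T := T) (S := insert v S) (n := n) hmemT
    (by
      rintro w (rfl | hw)
      · exact hv.1
      · exact h.kind_of w hw)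
    (hn.1.mono hmemT) (fun w hw => hn.2 w (hmemT w hw))
  have hvS' : v ∈ insert v S := Set.mem_insert v S
  have hsub : ∀ w ∈ S, w ∈ insert v S := fun w hw => Set.mem_insert_of_mem v hw
  obtain ⟨hk, hvs, ⟨s, hs⟩, c, d, hcd, hc, hd⟩ := hv
  refine ⟨R', ⟨(h.primary_iff hA).2 hvT, ⟨h.mem_old hvT, (h.kind_eq v hvT).trans hk,
    R.parent_of_solid v (h.parent_solid hvs).2, ⟨s, (h.solidChild_iff hvT).2 hs⟩, c, d, hcd,
    (h.dashedChild_iff_of_notMem hvT hvS).2 hc, (h.dashedChild_iff_of_notMem hvT hvS).2 hd⟩,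
    n v, ?_, fun b => ?_, h'.root_eq.trans h.root_eq.symm, fun b hb => ?_, h'.kind_new v hvS', ?_,
    h'.parent_new v hvS', h'.dashed_new v hvS', fun b hb hbd => ?_, fun b hb hbd => ?_⟩, h', hI'⟩
  · rw [h.mem_nodes]
    rintro (hm | ⟨w, hw, he⟩)
    · exact hn.2 v hvT hm
    · have := hn.1 hvT (h.mem_of w hw) he
      subst this
      exact hvS hw
  · rw [h.mem_nodes, h'.mem_nodes]
    constructor
    · rintro (hb | ⟨w, rfl | hw, rfl⟩)
      · exact Or.inr (Or.inl hb)
      · exact Or.inl rfl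
      · exact Or.inr (Or.inr ⟨w, hw, rfl⟩)
    · rintro (rfl | hb | ⟨w, hw, rfl⟩)
      · exact Or.inr ⟨v, hvS', rfl⟩
      · exact Or.inl hb
      · exact Or.inr ⟨w, hsub w hw, rfl⟩
  · rcases (h.mem_nodes b).1 hb with hb | ⟨w, hw, rfl⟩
    · rw [h.kind_eq b hb, h'.kind_eq b hb, h.skel_eq b hb, h'.skel_eq b hb]
      exact ⟨rfl, rfl⟩
    · rw [h.kind_new w hw, h'.kind_new w (hsub w hw), h.skel_new w hw, h'.skel_new w (hsub w hw)]
      exact ⟨rfl, rfl⟩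
  · rw [h'.skel_new v hvS', h.skel_eq v hvT]
  · rw [h.dashedChild_iff_of_notMem hvT hvS] at hbd
    exact ⟨h'.moved v hvS' b hbd, by rw [hI' v hvS' b hbd, h'.heavy_moved hU hvS' hbd]⟩
  · rcases (h.mem_nodes b).1 hb with hb | ⟨w, hw, rfl⟩
    · by_cases hm : ∃ w ∈ S, T.DashedChild b w
      · obtain ⟨w, hw, hd⟩ := hm
        exact ⟨(h'.moved w (hsub w hw) b hd).trans (h.moved w hw b hd).symm,
          (hI' w (hsub w hw) b hd).trans (hI w hw b hd).symm⟩
      · push Not at hm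
        obtain ⟨h1, h2⟩ := h.kept b hb hm
        obtain ⟨h1', h2'⟩ := h'.kept b hb (by
          rintro w (rfl | hw) hd
          · exact hbd ((h.dashedChild_iff_of_notMem hvT hvS).2 hd)
          · exact hm w hw hd)
        exact ⟨h1'.trans h1.symm, h2'.trans h2.symm⟩
    · exact ⟨(h'.parent_new w (hsub w hw)).trans (h.parent_new w hw).symm,
        iff_of_false (h'.dashed_new w (hsub w hw)) (h.dashed_new w hw)⟩

lemma exists_isFlip (h : Splitting T S n R) (hI : InnerHeavy T S R) (hA : T.Alternating)
    (hs : SameTree T T') {c p : ν} (hp : T.parent c = some p) (hpS : p ∉ S)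
    (hc : c ∈ T'.solid ↔ c ∉ T.solid) (hne : ∀ a, a ≠ c → (a ∈ T'.solid ↔ a ∈ T.solid)) :
    ∃ R', IsFlip R c p R' ∧ Splitting T' S n R' ∧ InnerHeavy T' S R' := by
  obtain ⟨R', h', hI'⟩ := exists_splitting_innerHeavy (T := T') (S := S) (n := n)
    (fun w hw => hs.nodes_eq ▸ h.mem_of w hw)
    (fun w hw => (hs.kind_eq w (h.mem_of w hw)).trans (h.kind_of w hw)) h.inj
    (fun w hw => hs.nodes_eq ▸ h.fresh w hw)
  have hch : ∀ w ∈ S, ∀ b, T.parent b = some w → (b ∈ T'.solid ↔ b ∈ T.solid) := by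
    rintro w hw b hb
    refine hne b ?_
    rintro rfl
    rw [hp] at hb
    cases hb
    exact hpS hw
  have hdash : ∀ w ∈ S, ∀ b, T'.DashedChild b w ↔ T.DashedChild b w := by
    intro w hw b
    unfold DashedChild
    rw [hs.parent_eq]
    exact and_congr_right fun hb => not_congr (hch w hw b hb)
  have hnodes : R'.nodes = R.nodes := by
    ext b
    rw [h.mem_nodes, h'.mem_nodes, hs.nodes_eq]
  have key : ∀ b, R'.parent b = R.parent b ∧ (b ≠ c → (b ∈ R'.solid ↔ b ∈ R.solid)) := by
    intro b
    by_cases hb : b ∈ R.nodes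
    · rcases (h.mem_nodes b).1 hb with hb | ⟨w, hw, rfl⟩
      · by_cases hm : ∃ w ∈ S, T.DashedChild b w
        · obtain ⟨w, hw, hd⟩ := hm
          have hd' := (hdash w hw b).2 hd
          refine ⟨(h'.moved w hw b hd').trans (h.moved w hw b hd).symm, fun _ => ?_⟩
          rw [hI' w hw b hd', hI w hw b hd, hs.subtreeWeight_eq, hs.branchWeight_eq (hch w hw)]
        · push Not at hm
          obtain ⟨h1, h2⟩ := h.kept b hb hm
          obtain ⟨h1', h2'⟩ := h'.kept b (hs.nodes_eq ▸ hb) fun w hw hd => hm w hw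
            ((hdash w hw b).1 hd)
          exact ⟨h1'.trans (h1.symm ▸ congrFun hs.parent_eq b), fun hbc =>
            (h2'.trans (hne b hbc)).trans h2.symm⟩
      · exact ⟨(h'.parent_new w hw).trans (h.parent_new w hw).symm, fun _ =>
          iff_of_false (h'.dashed_new w hw) (h.dashed_new w hw)⟩
    · have hb' : b ∉ R'.nodes := hnodes ▸ hb
      exact ⟨(parent_eq_none hb').trans (parent_eq_none hb).symm, fun _ =>
        iff_of_false (fun hs => hb' (mem_of_solid hs)) fun hs => hb (mem_of_solid hs)⟩
  refine ⟨R', ⟨(h.parent_notMem hp hpS).1, (h.primary_iff hA).2 (mem_child hp),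
    (h.primary_iff hA).2 (mem_parent hp), hnodes, (h'.root_eq.trans hs.root_eq).trans h.root_eq.symm,
    funext fun b => (key b).1, fun b hb => ?_, fun b hb => ?_, ?_, fun b => (key b).2⟩, h', hI'⟩
  · rcases (h.mem_nodes b).1 hb with hb | ⟨w, hw, rfl⟩
    · rw [h.kind_eq b hb, h'.kind_eq b (hs.nodes_eq ▸ hb), hs.kind_eq b hb]
    · rw [h.kind_new w hw, h'.kind_new w hw]
  · rcases (h.mem_nodes b).1 hb with hb | ⟨w, hw, rfl⟩
    · rw [h.skel_eq b hb, h'.skel_eq b (hs.nodes_eq ▸ hb), hs.skel_eq b hb]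
    · rw [h.skel_new w hw, h'.skel_new w hw, hs.skel_eq w (h.mem_of w hw)]
  · rw [(h'.parent_notMem ((congrFun hs.parent_eq c).trans hp) hpS).2, hc, (h.parent_notMem hp hpS).2]

lemma exists_steps_merge (h : Splitting T S n R) (hI : InnerHeavy T S R) (hA : T.Alternating)
    (M : Finset ν) (hM : ↑M ⊆ S) :
    ∃ R', Steps R R' M.card [] ∧ Splitting T (S \ M) n R' ∧ InnerHeavy T (S \ M) R' := by
  classical
  induction M using Finset.induction_on with
  | empty =>
    rw [Finset.coe_empty, Set.sdiff_empty]
    exact ⟨R, Steps.refl R, h, hI⟩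
  | insert v M hvM ih =>
    rw [Finset.coe_insert, Set.insert_subset_iff] at hM
    obtain ⟨R₁, hst, h₁, hI₁⟩ := ih hM.2
    obtain ⟨R₂, hm, h₂, hI₂⟩ := h₁.exists_isMerge hI₁ hA ⟨hM.1, hvM⟩
    have he : (S \ ↑M) \ {v} = S \ ↑(insert v M) := by
      rw [Finset.coe_insert, Set.sdiff_sdiff, Set.union_singleton]
    rw [he] at h₂ hI₂
    rw [Finset.card_insert_of_notMem hvM]
    exact ⟨R₂, hst.merge hm, h₂, hI₂⟩

lemma exists_steps_split (h : Splitting T S n R) (hI : InnerHeavy T S R) (hA : T.Alternating)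
    (hU : T.UniqueC) (hn : FreshNames T n) (M : Finset ν) (hM : ↑M ⊆ T.splitNodes)
    (hMS : ∀ v ∈ M, v ∉ S) :
    ∃ R', Steps R R' M.card [] ∧ Splitting T (S ∪ M) n R' ∧ InnerHeavy T (S ∪ M) R' := by
  classical
  induction M using Finset.induction_on with
  | empty =>
    rw [Finset.coe_empty, Set.union_empty]
    exact ⟨R, Steps.refl R, h, hI⟩
  | insert v M hvM ih =>
    rw [Finset.coe_insert, Set.insert_subset_iff] at hM
    obtain ⟨R₁, hst, h₁, hI₁⟩ := ih hM.2 fun v hv => hMS v (Finset.mem_insert_of_mem hv)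
    obtain ⟨R₂, hm, h₂, hI₂⟩ := h₁.exists_isSplit hI₁ hA hU hn hM.1
      (fun hv => hv.elim (hMS v (Finset.mem_insert_self v M)) hvM)
    have he : insert v (S ∪ ↑M) = S ∪ ↑(insert v M) := by
      rw [Finset.coe_insert, Set.union_insert]
    rw [he] at h₂ hI₂
    rw [Finset.card_insert_of_notMem hvM]
    exact ⟨R₂, hst.split hm, h₂, hI₂⟩

end Splitting

/-- Two path decompositions of the same tree that differ can be brought closer to each other by a
change of one edge: solid edges to become dashed are changed first, so that no node ever has two
solid children. -/
lemma SameTree.exists_flip (hs : SameTree T T') (hne : ∃ c, ¬ (c ∈ T.solid ↔ c ∈ T'.solid)) :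
    ∃ T₁ c p, SameTree T T₁ ∧ SameTree T₁ T' ∧ T.parent c = some p ∧
      ¬ (c ∈ T.solid ↔ c ∈ T'.solid) ∧ (c ∈ T₁.solid ↔ c ∉ T.solid) ∧
      ∀ a, a ≠ c → (a ∈ T₁.solid ↔ a ∈ T.solid) := by
  by_cases hex : ∃ c ∈ T.solid, c ∉ T'.solid
  · obtain ⟨c, hc, hc'⟩ := hex
    have hcd : ¬ (c ∈ T.solid ↔ c ∈ T'.solid) := fun hh => hc' (hh.1 hc)
    have e1 : ∀ a ∈ T.solid \ {c}, ∃ b, T.parent a = some b := fun a ha => T.parent_of_solid a ha.1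
    have e2 : ∀ a ∈ T.solid \ {c}, ∀ b ∈ T.solid \ {c}, T.parent a = T.parent b → a = b :=
      fun a ha b hb => T.solid_unique a ha.1 b hb.1
    have e3 : c ∈ T.solid \ {c} ↔ c ∉ T.solid := iff_of_false (fun h => h.2 rfl) (fun h => h hc)
    have e4 : ∀ a, a ≠ c → (a ∈ T.solid \ {c} ↔ a ∈ T.solid) := fun a ha =>
      ⟨fun h => h.1, fun h => ⟨h, ha⟩⟩
    have e5 : SameTree (T.withSolid _ e1 e2) T' := ⟨hs.1, hs.2, hs.3, hs.4, hs.5⟩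
    obtain ⟨p, hp⟩ := T.parent_of_solid c hc
    exact ⟨_, c, p, sameTree_withSolid _ e1 e2, e5, hp, hcd, e3, e4⟩
  · push Not at hex
    obtain ⟨c, hcd⟩ := hne
    have hc : c ∉ T.solid := fun hc => hcd (iff_of_true hc (hex c hc))
    have hc' : c ∈ T'.solid := by
      by_contra hc'
      exact hcd (iff_of_false hc hc')
    have hsub : ∀ a ∈ insert c T.solid, a ∈ T'.solid := by
      rintro a (rfl | ha)
      · exact hc'
      · exact hex a ha
    have e1 : ∀ a ∈ insert c T.solid, ∃ b, T.parent a = some b := fun a ha => by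
      rw [← hs.parent_eq]
      exact T'.parent_of_solid a (hsub a ha)
    have e2 : ∀ a ∈ insert c T.solid, ∀ b ∈ insert c T.solid, T.parent a = T.parent b → a = b :=
      fun a ha b hb hab => T'.solid_unique a (hsub a ha) b (hsub b hb) (by rwa [hs.parent_eq])
    have e3 : c ∈ insert c T.solid ↔ c ∉ T.solid := iff_of_true (Set.mem_insert c _) hc
    have e4 : ∀ a, a ≠ c → (a ∈ insert c T.solid ↔ a ∈ T.solid) := fun a ha =>
      ⟨fun h => h.resolve_left ha, Set.mem_insert_of_mem c⟩
    have e5 : SameTree (T.withSolid _ e1 e2) T' := ⟨hs.1, hs.2, hs.3, hs.4, hs.5⟩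
    obtain ⟨p, hp⟩ := e1 c (Set.mem_insert c _)
    exact ⟨_, c, p, sameTree_withSolid _ e1 e2, e5, hp, hcd, e3, e4⟩

open Classical in
/-- The lower ends of the edges whose status differs in two trees. -/
noncomputable def differing (T T' : PDTree ν α β) : Finset ν :=
  T.nodes.filter fun c => ¬ (c ∈ T.solid ↔ c ∈ T'.solid)

lemma SameTree.mem_differing (hs : SameTree T T') {c : ν} :
    c ∈ differing T T' ↔ ¬ (c ∈ T.solid ↔ c ∈ T'.solid) := by
  classical
  unfold differing
  rw [Finset.mem_filter, and_iff_right_iff_imp]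
  intro h
  by_contra hc
  exact h (iff_of_false (fun h' => hc (mem_of_solid h'))
    (fun h' => hc (hs.nodes_eq ▸ mem_of_solid h')))

lemma SameTree.exists_parent_of_differing (hs : SameTree T T') {c : ν} (hc : c ∈ differing T T') :
    ∃ p, T.parent c = some p := by
  rw [hs.mem_differing] at hc
  by_cases h : c ∈ T.solid
  · exact T.parent_of_solid c h
  · rw [← hs.parent_eq]
    refine T'.parent_of_solid c ?_
    by_contra h'
    exact hc (iff_of_false h h')

/-- All edges with different status can be flipped one by one, provided that their upper ends are
not split. -/
lemma Splitting.exists_steps_flip (h : Splitting T S n R) (hI : InnerHeavy T S R)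
    (hA : T.Alternating) (hs : SameTree T T')
    (hS : ∀ c ∈ differing T T', ∀ p, T.parent c = some p → p ∉ S) :
    ∃ R' l, Steps R R' 0 l ∧ Splitting T' S n R' ∧ InnerHeavy T' S R' ∧ l.Nodup ∧
      ∀ f ∈ l, ∃ c ∈ differing T T', ∃ p, T.parent c = some p ∧ f = s(c, p) := by
  induction hk : (differing T T').card generalizing T R with
  | zero =>
    rw [Finset.card_eq_zero] at hk
    have hsol : ∀ a, a ∈ T'.solid ↔ a ∈ T.solid := fun a => by
      have : a ∉ differing T T' := by simp [hk]
      rw [hs.mem_differing, not_not] at this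
      exact this.symm
    refine ⟨R, [], Steps.refl R, h.congr_tree hs hsol, fun v hv b hb => ?_, List.nodup_nil, by simp⟩
    rw [hs.subtreeWeight_eq, hs.branchWeight_eq fun b _ => hsol b]
    refine hI v hv b ⟨?_, fun hb' => hb.2 ((hsol b).2 hb')⟩
    rw [← hs.parent_eq]
    exact hb.1
  | succ k ih =>
    have hne : ∃ c, ¬ (c ∈ T.solid ↔ c ∈ T'.solid) := by
      obtain ⟨c, hc⟩ := Finset.card_pos.1 (by omega : 0 < (differing T T').card)
      exact ⟨c, hs.mem_differing.1 hc⟩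
    obtain ⟨T₁, c, p, hs₁, hs₂, hp, hc, hcs, hcne⟩ := hs.exists_flip hne
    have hcD := hs.mem_differing.2 hc
    obtain ⟨R₁, hf, h₁, hI₁⟩ := h.exists_isFlip hI hA hs₁ hp (hS c hcD p hp) hcs hcne
    have hD : ∀ a, a ∈ differing T₁ T' ↔ a ∈ differing T T' ∧ a ≠ c := by
      intro a
      rw [hs₂.mem_differing, hs.mem_differing]
      by_cases hac : a = c
      · subst hac
        simp only [ne_eq, not_true_eq_false, and_false, iff_false, not_not]
        tauto
      · rw [hcne a hac]
        simp [hac]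
    have hcard : (differing T₁ T').card = k := by
      classical
      have : differing T₁ T' = (differing T T').erase c := by
        ext a
        rw [hD, Finset.mem_erase, and_comm]
      rw [this, Finset.card_erase_of_mem hcD, hk]
      rfl
    obtain ⟨R', l, hst, h', hI', hl, hlD⟩ := ih h₁ hI₁ (hs₁.alternating hA) hs₂
      (fun a ha q hq => hS a ((hD a).1 ha).1 q (by rwa [hs₁.parent_eq] at hq)) hcard
    have hst' := (Steps.flip (Steps.refl R) hf).trans hst
    refine ⟨R', _, hst', h', hI', ?_, ?_⟩
    · rw [List.nodup_append]
      refine ⟨hl, List.nodup_singleton _, ?_⟩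
      rintro f hfl _ hf' rfl
      rw [List.mem_singleton] at hf'
      obtain ⟨a, ha, q, hq, rfl⟩ := hlD f hfl
      rw [hs₁.parent_eq] at hq
      rcases Sym2.eq_iff.1 hf' with ⟨hac, -⟩ | ⟨rfl, rfl⟩
      · exact ((hD a).1 ha).2 hac
      · exact parent_asymm hp hq
    · intro f hf'
      rcases List.mem_append.1 hf' with hf' | hf'
      · obtain ⟨a, ha, q, hq, rfl⟩ := hlD f hf'
        exact ⟨a, ((hD a).1 ha).1, q, by rwa [hs₁.parent_eq] at hq, rfl⟩
      · rw [List.mem_singleton] at hf'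
        exact ⟨c, hcD, p, hp, hf'⟩

lemma SameTree.mk_mem_changed (hs : SameTree T T') {c p : ν} (hp : T.parent c = some p) :
    s(c, p) ∈ changed T T' ↔ c ∈ differing T T' := by
  have hp' : T'.parent c = some p := by rwa [hs.parent_eq]
  rw [changed, Set.mem_symmDiff, mk_mem_solidEdges hp, mk_mem_solidEdges hp', hs.mem_differing]
  tauto

lemma SameTree.changed_eq_image (hs : SameTree T T') :
    changed T T' = (fun c => s(c, (T.parent c).getD c)) '' (differing T T') := by
  ext f
  constructor
  · intro hf
    have : ∃ c p, T.parent c = some p ∧ f = s(c, p) := by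
      rcases hf with ⟨⟨c, p, h, hf⟩, -⟩ | ⟨⟨c, p, h, hf⟩, -⟩
      · exact ⟨c, p, h.1, hf⟩
      · exact ⟨c, p, by rw [← hs.parent_eq]; exact h.1, hf⟩
    obtain ⟨c, p, hp, rfl⟩ := this
    refine ⟨c, (hs.mk_mem_changed hp).1 hf, ?_⟩
    simp only [hp, Option.getD_some]
  · rintro ⟨c, hc, rfl⟩
    obtain ⟨p, hp⟩ := hs.exists_parent_of_differing hc
    simp only [hp, Option.getD_some]
    exact (hs.mk_mem_changed hp).2 hc

lemma SameTree.ncard_changed (hs : SameTree T T') :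
    (changed T T').ncard = (differing T T').card := by
  rw [hs.changed_eq_image, Set.InjOn.ncard_image, Set.ncard_coe_finset]
  intro a ha b hb hab
  obtain ⟨p, hp⟩ := hs.exists_parent_of_differing ha
  obtain ⟨q, hq⟩ := hs.exists_parent_of_differing hb
  simp only [hp, hq, Option.getD_some] at hab
  rcases Sym2.eq_iff.1 hab with ⟨h, -⟩ | ⟨rfl, rfl⟩
  · exact h
  · exact absurd hq (parent_asymm hp)

lemma SameTree.finite_changed (hs : SameTree T T') : (changed T T').Finite := by
  rw [hs.changed_eq_image]
  exact (Finset.finite_toSet _).image _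

/-- Split nodes of `T` that are not incident to an edge with a different status in `T'` are split
nodes of `T'`. -/
lemma SameTree.mem_splitNodes (hs : SameTree T T') {v : ν} (hv : v ∈ T.splitNodes)
    (hv1 : v ∈ T.solid ↔ v ∈ T'.solid)
    (hv2 : ∀ c, T.parent c = some v → (c ∈ T.solid ↔ c ∈ T'.solid)) : v ∈ T'.splitNodes := by
  have hvT := splitNodes_mem_nodes hv
  obtain ⟨hk, hvs, ⟨s, hs'⟩, c, d, hcd, hc, hd⟩ := hv
  have hp : ∀ a, T.parent a = some v → T'.parent a = some v := fun a ha => by rwa [hs.parent_eq]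
  exact ⟨(hs.kind_eq v hvT).trans hk, hv1.1 hvs, ⟨s, hp s hs'.1, (hv2 s hs'.1).1 hs'.2⟩, c, d, hcd,
    ⟨hp c hc.1, fun h => hc.2 ((hv2 c hc.1).2 h)⟩, hp d hd.1, fun h => hd.2 ((hv2 d hd.1).2 h)⟩

/-- If the path decomposition of a strict tree changes, then the corresponding pre-split tree is
adapted by merging all split nodes incident to a changed edge, flipping the changed edges, and
splitting the nodes incident to a changed edge that are split nodes of the new tree. -/
theorem Splitting.exists_steps [Infinite ν] (h : Splitting T T.splitNodes n R)
    (hI : InnerHeavy T T.splitNodes R) (hA : T.Alternating) (hU : T.UniqueC)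
    (hs : SameTree T T') :
    ∃ R' m k l, Steps R R' k l ∧ Splitting T' T'.splitNodes m R' ∧
      InnerHeavy T' T'.splitNodes R' ∧ l.Nodup ∧ (∀ f ∈ l, f ∈ changed T T') ∧
      k ≤ 4 * (changed T T').ncard := by
  classical
  obtain ⟨m, hm, hmn⟩ := h.exists_freshNames
  replace h := h.congr_names hmn
  let D := differing T T'
  let A : Finset ν := D ∪ D.image fun c => (T.parent c).getD c
  have hA1 : ∀ v, v ∉ A → (v ∈ T.solid ↔ v ∈ T'.solid) := by
    intro v hv
    by_contra hc
    exact hv (Finset.mem_union_left _ (hs.mem_differing.2 hc))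
  have hA2 : ∀ c ∈ D, ∀ p, T.parent c = some p → p ∈ A := by
    intro c hc p hp
    refine Finset.mem_union_right _ (Finset.mem_image.2 ⟨c, hc, ?_⟩)
    rw [hp, Option.getD_some]
  have hA3 : ∀ v, v ∉ A → ∀ c, T.parent c = some v → (c ∈ T.solid ↔ c ∈ T'.solid) := by
    intro v hv c hc
    by_contra hcs
    exact hv (hA2 c (hs.mem_differing.2 hcs) v hc)
  have hAcard : A.card ≤ 2 * D.card := by
    have h1 := Finset.card_union_le D (D.image fun c => (T.parent c).getD c)
    have h2 : (D.image fun c => (T.parent c).getD c).card ≤ D.card := Finset.card_image_le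
    change (D ∪ D.image fun c => (T.parent c).getD c).card ≤ _
    omega
  let M := A.filter (· ∈ T.splitNodes)
  let M' := A.filter (· ∈ T'.splitNodes)
  obtain ⟨R₁, st₁, h₁, hI₁⟩ := h.exists_steps_merge hI hA M
    (fun v hv => (Finset.mem_filter.1 hv).2)
  obtain ⟨R₂, l, st₂, h₂, hI₂, hl, hlD⟩ := h₁.exists_steps_flip hI₁ hA hs
    (fun c hc p hp hpS => hpS.2 (Finset.mem_coe.2 (Finset.mem_filter.2 ⟨hA2 c hc p hp, hpS.1⟩)))
  have hm' : FreshNames T' m := by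
    unfold FreshNames
    rw [hs.nodes_eq]
    exact hm
  obtain ⟨R₃, st₃, h₃, hI₃⟩ := h₂.exists_steps_split hI₂ (hs.alternating hA) (hs.uniqueC hU) hm' M'
    (fun v hv => (Finset.mem_filter.1 hv).2)
    (fun v hv hvS => hvS.2 (Finset.mem_coe.2 (Finset.mem_filter.2 ⟨(Finset.mem_filter.1 hv).1, hvS.1⟩)))
  have hS : T.splitNodes \ ↑M ∪ ↑M' = T'.splitNodes := by
    ext v
    by_cases hvA : v ∈ A
    · simp [M, M', hvA]
    · simp only [M, M', Set.mem_union, Set.mem_sdiff, Finset.mem_coe, Finset.mem_filter, hvA,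
        false_and, not_false_eq_true, and_true, or_false]
      refine ⟨fun hv => hs.mem_splitNodes hv (hA1 v hvA) (hA3 v hvA), fun hv =>
        hs.symm.mem_splitNodes hv (hA1 v hvA).symm fun c hc => (hA3 v hvA c ?_).symm⟩
      rwa [hs.parent_eq] at hc
  rw [hS] at h₃ hI₃
  refine ⟨R₃, m, _, _, (st₁.trans st₂).trans st₃, h₃, hI₃, by simpa using hl, fun f hf => ?_, ?_⟩
  · simp only [List.append_nil, List.nil_append] at hf
    obtain ⟨c, hc, p, hp, rfl⟩ := hlD f hf
    exact (hs.mk_mem_changed hp).2 hc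
  · have h1 : M.card ≤ A.card := Finset.card_filter_le _ _
    have h2 : M'.card ≤ A.card := Finset.card_filter_le _ _
    rw [hs.ncard_changed]
    change _ ≤ 4 * D.card
    omega

/-! ### Exposing, conceiling and reversing -/

lemma mem_of_tAdj {a b : ν} (h : T.TAdj a b) : a ∈ T.nodes ∧ b ∈ T.nodes := by
  rcases h with h | h
  · exact ⟨mem_child h, mem_parent h⟩
  · exact ⟨mem_parent h, mem_child h⟩

/-- Being a strict BC tree does not depend on the root and on the path decomposition. -/
lemma IsStrictBC.congr (h : IsStrictBC G T) (hn : T'.nodes = T.nodes)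
    (hadj : ∀ a b, T'.TAdj a b ↔ T.TAdj a b) (hk : ∀ a ∈ T.nodes, T'.kind a = T.kind a)
    (hs : ∀ a ∈ T.nodes, T'.skel a = T.skel a) : IsStrictBC G T' where
  base := h.base
  skel_le a ha := by
    rw [hn] at ha
    rw [hs a ha]
    exact h.skel_le a ha
  edge_unique f hf := by
    obtain ⟨a, ⟨ha, hfa⟩, hu⟩ := h.edge_unique f hf
    refine ⟨a, ⟨hn ▸ ha, by rwa [hs a ha]⟩, ?_⟩
    rintro b ⟨hb, hfb⟩
    rw [hn] at hb
    exact hu b ⟨hb, by rwa [hs b hb] at hfb⟩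
  common_vertex a b hab := by
    have hadj' := (hadj a b).1 (Or.inl hab)
    obtain ⟨ha, hb⟩ := mem_of_tAdj hadj'
    rw [hs a ha, hs b hb]
    rcases hadj' with h' | h'
    · exact h.common_vertex a b h'
    · rw [Set.inter_comm]
      exact h.common_vertex b a h'
  not_both_B a b hab := by
    have hadj' := (hadj a b).1 (Or.inl hab)
    obtain ⟨ha, hb⟩ := mem_of_tAdj hadj'
    rw [hk a ha, hk b hb]
    rcases hadj' with h' | h'
    · exact h.not_both_B a b h'
    · exact (h.not_both_B b a h').symm
  not_both_C a b hab := by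
    have hadj' := (hadj a b).1 (Or.inl hab)
    obtain ⟨ha, hb⟩ := mem_of_tAdj hadj'
    rw [hk a ha, hk b hb]
    rcases hadj' with h' | h'
    · exact h.not_both_C a b h'
    · exact (h.not_both_C b a h').symm
  skel_B a ha hka := by
    rw [hn] at ha
    rw [hk a ha] at hka
    rw [hs a ha]
    exact h.skel_B a ha hka
  skel_C a ha hka := by
    rw [hn] at ha
    rw [hk a ha] at hka
    rw [hs a ha]
    exact h.skel_C a ha hka
  connected x a ha b hb hxa hxb := by
    rw [hn] at ha hb
    rw [hs a ha] at hxa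
    rw [hs b hb] at hxb
    refine Relation.ReflTransGen.mono ?_ _ _ (h.connected x a ha b hb hxa hxb)
    rintro c d ⟨hcd, hx⟩
    exact ⟨(hadj c d).2 hcd, by rwa [hs d (mem_of_tAdj hcd).2]⟩
  connected_C x a ha b hb hka hkb hxa hxb := by
    rw [hn] at ha hb
    rw [hs a ha] at hxa
    rw [hs b hb] at hxb
    rw [hk a ha] at hka
    rw [hk b hb] at hkb
    refine Relation.ReflTransGen.mono ?_ _ _ (h.connected_C x a ha b hb hka hkb hxa hxb)
    rintro c d ⟨hcd, hkd, hx⟩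
    have hd := (mem_of_tAdj hcd).2
    exact ⟨(hadj c d).2 hcd, by rwa [hk d hd], by rwa [hs d hd]⟩

lemma SameTree.isStrictBC (hs : SameTree T T') (h : IsStrictBC G T) : IsStrictBC G T' :=
  h.congr hs.nodes_eq (fun _ _ => hs.tAdj_iff) hs.kind_eq hs.skel_eq

lemma SameTreeRerooted.isStrictBC {e : ν} (hs : SameTreeRerooted T e T') (h : IsStrictBC G T) :
    IsStrictBC G T' :=
  h.congr hs.nodes_eq hs.adj_iff hs.kind_eq hs.skel_eq

lemma Splitting.exists_isPreSplit [Infinite ν] (h : Splitting T T.splitNodes n R)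
    (hI : InnerHeavy T T.splitNodes R) (hT : IsStrictBC G T) (hs : SameTree T T') {e : Option ν}
    (he : T'.IsHPD e) :
    ∃ R' k l, Steps R R' k l ∧ IsPreSplit G e T' R' ∧ l.Nodup ∧ (∀ f ∈ l, f ∈ changed T T') ∧
      k ≤ 4 * (changed T T').ncard := by
  obtain ⟨R', m, k, l, hst, h', hI', hl, hlc, hk⟩ :=
    h.exists_steps hI hT.alternating hT.uniqueC hs
  exact ⟨R', k, l, hst, h'.isPreSplit hI' (hs.isStrictBC hT) he, hl, hlc, hk⟩

lemma IsPreSplit.exists_sameTree [Infinite ν] {e e' : Option ν} (h : IsPreSplit G e T R)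
    (hs : SameTree T T') (he : T'.IsHPD e') :
    ∃ R' k l, Steps R R' k l ∧ IsPreSplit G e' T' R' ∧ l.Nodup ∧ (∀ f ∈ l, f ∈ changed T T') ∧
      k ≤ 4 * (changed T T').ncard := by
  obtain ⟨n, hS, hI⟩ := h.exists_splitting
  exact hS.exists_isPreSplit hI h.strict hs he

/-- In terms of the unrooted tree, the split nodes are the `C` nodes that are incident to two solid
edges and to two dashed edges. -/
lemma mem_splitNodes_iff {v : ν} : v ∈ T.splitNodes ↔ T.kind v = Kind.C ∧
    (∃ c d, c ≠ d ∧ s(c, v) ∈ T.solidEdges ∧ s(d, v) ∈ T.solidEdges) ∧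
    ∃ c d, c ≠ d ∧ (T.TAdj c v ∧ s(c, v) ∉ T.solidEdges) ∧ T.TAdj d v ∧ s(d, v) ∉ T.solidEdges := by
  have hsol : ∀ c, s(c, v) ∈ T.solidEdges → T.SolidChild c v ∨ T.SolidChild v c := by
    rintro c ⟨a, b, hab, he⟩
    rcases Sym2.eq_iff.1 he with ⟨rfl, rfl⟩ | ⟨rfl, rfl⟩
    · exact Or.inl hab
    · exact Or.inr hab
  constructor
  · rintro ⟨hk, hvs, ⟨s, hs⟩, c, d, hcd, hc, hd⟩
    obtain ⟨p, hp⟩ := T.parent_of_solid v hvs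
    refine ⟨hk, ⟨s, p, ?_, (mk_mem_solidEdges hs.1).2 hs.2, ?_⟩, c, d, hcd,
      ⟨Or.inl hc.1, fun h => hc.2 ((mk_mem_solidEdges hc.1).1 h)⟩, Or.inl hd.1,
      fun h => hd.2 ((mk_mem_solidEdges hd.1).1 h)⟩
    · rintro rfl
      exact parent_asymm hp hs.1
    · rw [Sym2.eq_swap]
      exact (mk_mem_solidEdges hp).2 hvs
  · rintro ⟨hk, ⟨c, d, hcd, hc, hd⟩, c', d', hcd', ⟨hc1, hc2⟩, hd1, hd2⟩
    have key : v ∈ T.solid ∧ ∃ s, T.SolidChild s v := by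
      rcases hsol c hc with hc | hc <;> rcases hsol d hd with hd | hd
      · exact absurd (T.solid_unique c hc.2 d hd.2 (hc.1.trans hd.1.symm)) hcd
      · exact ⟨hd.2, c, hc⟩
      · exact ⟨hc.2, d, hd⟩
      · exact absurd (Option.some_injective _ (hc.1.symm.trans hd.1)) hcd
    have hdash : ∀ c, T.TAdj c v → s(c, v) ∉ T.solidEdges → T.DashedChild c v := by
      rintro c (h | h) hn
      · exact ⟨h, fun hs => hn ((mk_mem_solidEdges h).2 hs)⟩
      · rw [Sym2.eq_swap] at hn
        exact absurd ((mk_mem_solidEdges h).2 key.1) hn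
    exact ⟨hk, key.1, key.2, c', d', hcd', hdash c' hc1 hc2, hdash d' hd1 hd2⟩

lemma dashedChild_iff_of_mem_splitNodes {b v : ν} (hv : v ∈ T.splitNodes) :
    T.DashedChild b v ↔ T.TAdj b v ∧ s(b, v) ∉ T.solidEdges := by
  constructor
  · intro h
    exact ⟨Or.inl h.1, fun hs => h.2 ((mk_mem_solidEdges h.1).1 hs)⟩
  · rintro ⟨h | h, hn⟩
    · exact ⟨h, fun hs => hn ((mk_mem_solidEdges h).2 hs)⟩
    · rw [Sym2.eq_swap] at hn
      exact absurd ((mk_mem_solidEdges h).2 hv.2.1) hn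

lemma UniqueC.weight_eq (hU : T.UniqueC) (hU' : T'.UniqueC) (hn : T'.nodes = T.nodes)
    (hk : ∀ a ∈ T.nodes, T'.kind a = T.kind a) (hs : ∀ a ∈ T.nodes, T'.skel a = T.skel a) (a : ν) :
    T.weight a = T'.weight a := by
  unfold weight
  congr 1
  ext x
  simp only [Set.mem_ofPred_eq]
  rw [hU.isHome_iff, hU'.isHome_iff, hn]
  refine and_congr_right fun ha => ?_
  rw [hk a ha, hs a ha]
  have : (∀ b ∈ T.nodes, T.kind b = Kind.C → x ∉ V(T.skel b)) ↔
      ∀ b ∈ T.nodes, T'.kind b = Kind.C → x ∉ V(T'.skel b) :=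
    forall₂_congr fun b hb => by rw [hk b hb, hs b hb]
  rw [this]

namespace SameTreeRerooted

variable {e : ν}

lemma parent_root (h : SameTreeRerooted T e T') : T'.parent e = none := by
  rw [← h.root_eq, T'.parent_root]

lemma parent_path (h : SameTreeRerooted T e T') {p q : ν} (hp : T.Below e p)
    (hq : T.parent p = some q) : T'.parent q = some p := by
  induction hp generalizing q with
  | refl =>
    rcases (h.adj_iff e q).2 (Or.inl hq) with h' | h'
    · rw [h.parent_root] at h'
      cases h'
    · exact h'
  | tail _ hbp ih =>
    rcases (h.adj_iff _ q).2 (Or.inl hq) with h' | h'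
    · rw [ih hbp] at h'
      cases h'
      exact absurd hq (parent_asymm hbp)
    · exact h'

lemma parent_of_below (h : SameTreeRerooted T e T') {p q : ν} (hp : T.Below e p)
    (hq : T'.parent p = some q) : T.Below e q ∧ T.parent q = some p := by
  rcases Relation.ReflTransGen.cases_tail hp with rfl | ⟨b, hb, hbp⟩
  · rw [h.parent_root] at hq
    cases hq
  · rw [h.parent_path hb hbp] at hq
    cases hq
    exact ⟨hb, hbp⟩

lemma parent_off_path (h : SameTreeRerooted T e T') (he : e ∈ T.nodes) {w z : ν}
    (hw : ¬ T.Below e w) (hz : T.parent w = some z) : T'.parent w = some z := by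
  have hreach := T.reaches_root w (mem_child hz)
  induction hreach using Relation.ReflTransGen.head_induction_on generalizing z with
  | refl => exact absurd (T.reaches_root e he) hw
  | head hac _ ih =>
    rename_i c _
    have hcz : c = z := Option.some_injective _ (hac.symm.trans hz)
    subst hcz
    rcases (h.adj_iff _ _).2 (Or.inl hac) with h' | h'
    · exact h'
    · by_cases hc : T.Below e c
      · exact absurd (h.parent_of_below hc h').1 hw
      · obtain ⟨d, hd⟩ := exists_parent (mem_parent hac) fun hr =>
          hc (hr ▸ T.reaches_root e he)
        rw [ih hc hd] at h'
        cases h'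
        exact absurd hd (parent_asymm hac)

/-- Re-rooting at `e` changes the parents of the nodes on the path from the root to `e` only. -/
lemma parent_iff (h : SameTreeRerooted T e T') (he : e ∈ T.nodes) {w u : ν} (hw : ¬ T.Below e w) :
    T.parent u = some w ↔ T'.parent u = some w := by
  have hup : T.Below e u → T'.parent u ≠ some w := fun hu hp => hw (h.parent_of_below hu hp).1
  constructor
  · intro hp
    exact h.parent_off_path he (fun hu => hw (Relation.ReflTransGen.tail hu hp)) hp
  · intro hp
    have hu : ¬ T.Below e u := fun hu => hup hu hp
    have huT : u ∈ T.nodes := h.nodes_eq ▸ mem_child hp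
    obtain ⟨z, hz⟩ := exists_parent huT fun hr => hu (hr ▸ T.reaches_root e he)
    rw [h.parent_off_path he hu hz] at hp
    rw [hz, hp]

end SameTreeRerooted

/-- Re-rooting `T` at an exposed node, with edges keeping their status, is possible: the only solid
edges at the nodes on the path to the exposed node are those of the path, so that no node gets two
solid children. -/
lemma SameTreeRerooted.exists_withSolid {e : ν} (h : SameTreeRerooted T e T') (he : T.IsExposed e) :
    ∃ T₀, SameTree T₀ T' ∧ T₀.solidEdges = T.solidEdges := by
  let sol : Set ν := {a | ∃ b, T'.parent a = some b ∧ s(a, b) ∈ T.solidEdges}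
  have hsol : ∀ a b, s(a, b) ∈ T.solidEdges → T.SolidChild a b ∨ T.SolidChild b a := by
    rintro a b ⟨c, d, hcd, he⟩
    rcases Sym2.eq_iff.1 he with ⟨rfl, rfl⟩ | ⟨rfl, rfl⟩
    · exact Or.inl hcd
    · exact Or.inr hcd
  have mixed : ∀ a b c, T'.parent a = some c → T'.parent b = some c → T.SolidChild a c →
      ¬ T.SolidChild c b := by
    intro a b c hac hbc ha hc
    have ha' : ¬ T.Below e a := fun hb => parent_asymm hac (h.parent_path hb ha.1)
    have hc' := (((he.2 a c ha.1).1 ha.2).resolve_left ha').1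
    exact parent_asymm hbc (h.parent_off_path he.1 hc' hc.1)
  refine ⟨T'.withSolid sol (fun a ⟨b, hb, _⟩ => ⟨b, hb⟩) ?_, ⟨rfl, rfl, rfl, fun _ _ => rfl,
    fun _ _ => rfl⟩, ?_⟩
  · rintro a ⟨c, hac, ha⟩ b ⟨d, hbd, hb⟩ hab
    have hcd : c = d := Option.some_injective _ (hac.symm.trans (hab.trans hbd))
    subst hcd
    rcases hsol _ _ ha with ha | ha <;> rcases hsol _ _ hb with hb | hb
    · exact T.solid_unique a ha.2 b hb.2 (ha.1.trans hb.1.symm)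
    · exact absurd hb (mixed a b c hac hbd ha)
    · exact absurd ha (mixed b a c hbd hac hb)
    · exact Option.some_injective _ (ha.1.symm.trans hb.1)
  · ext f
    constructor
    · rintro ⟨a, b, ⟨hab, c, hac, hs⟩, rfl⟩
      have hbc : b = c := Option.some_injective _ (hab.symm.trans hac)
      rwa [hbc]
    · rintro ⟨a, b, ⟨hab, hs⟩, rfl⟩
      have hm : s(a, b) ∈ T.solidEdges := (mk_mem_solidEdges hab).2 hs
      rcases (h.adj_iff a b).2 (Or.inl hab) with h' | h'
      · exact ⟨a, b, ⟨h', b, h', hm⟩, rfl⟩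
      · rw [Sym2.eq_swap] at hm ⊢
        exact ⟨b, a, ⟨h', a, h', hm⟩, rfl⟩

/-- Splitting the same nodes in two rooted versions of the same tree yields the same unrooted
tree. -/
lemma Splitting.tAdj_of_parent {T₀ R₀ : PDTree ν α β} (h : Splitting T S n R)
    (h₀ : Splitting T₀ S n R₀) (hadj : ∀ a b, T.TAdj a b → T₀.TAdj a b)
    (hd : ∀ v ∈ S, ∀ b, T.DashedChild b v ↔ T₀.DashedChild b v) {a b : ν}
    (hab : R.parent a = some b) : R₀.TAdj a b := by
  rcases h.parent_cases hab with ⟨ha, hp, hno, _⟩ | ⟨v, hv, hda, rfl⟩ | ⟨v, hv, rfl, rfl⟩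
  · have hadj' := hadj a b (Or.inl hp)
    rcases hadj' with hp' | hp'
    · refine Or.inl (((h₀.kept a (mem_child hp') fun v hv hd' => ?_).1).trans hp')
      exact hno v hv ((hd v hv a).2 hd')
    · refine Or.inr (((h₀.kept b (mem_child hp') fun v hv hd' => ?_).1).trans hp')
      have := hd'.1
      rw [hp'] at this
      cases this
      exact parent_asymm hp ((hd a hv b).2 hd').1
  · exact Or.inl (h₀.moved v hv a ((hd v hv a).1 hda))
  · exact Or.inl (h₀.parent_new _ hv)

lemma Splitting.solidEdges_subset {T₀ R₀ : PDTree ν α β} (h : Splitting T S n R)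
    (h₀ : Splitting T₀ S n R₀) (hsol : T.solidEdges ⊆ T₀.solidEdges)
    (hd : ∀ v ∈ S, ∀ b, T.DashedChild b v → T₀.DashedChild b v)
    (hi : ∀ v ∈ S, ∀ b, T.DashedChild b v → b ∈ R.solid → b ∈ R₀.solid) :
    R.solidEdges ⊆ R₀.solidEdges := by
  rintro f ⟨a, b, ⟨hab, hs⟩, rfl⟩
  rcases h.parent_cases hab with ⟨ha, hp, hno, hiff⟩ | ⟨v, hv, hda, rfl⟩ | ⟨v, hv, rfl, rfl⟩
  · obtain ⟨c, d, hcd, he⟩ := hsol ((mk_mem_solidEdges hp).2 (hiff.1 hs))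
    exact ⟨c, d, (h₀.solidChild_iff (mem_parent hcd.1)).2 hcd, he⟩
  · exact ⟨a, n v, ⟨h₀.moved v hv a (hd v hv a hda), hi v hv a hda hs⟩, rfl⟩
  · exact absurd hs (h.dashed_new _ hv)

lemma IsPreSplit.exists_reverse [Infinite ν] {e : ν} (h : IsPreSplit G (some e) T R)
    (hr : StrictReverse T e T') :
    ∃ R₀ R' k l, SameTreeRerooted R e R₀ ∧ R₀.solidEdges = R.solidEdges ∧ Steps R₀ R' k l ∧
      IsPreSplit G (some T.root) T' R' ∧ l.Nodup ∧ (∀ f ∈ l, f ∈ changed T T') ∧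
      k ≤ 4 * (changed T T').ncard := by
  obtain ⟨n, hS, hI⟩ := h.exists_splitting
  have hex := hr.before
  obtain ⟨T₀, hs₀, hsol⟩ := hr.same.exists_withSolid hex
  have hr₀ : SameTreeRerooted T e T₀ :=
    ⟨hs₀.nodes_eq.symm.trans hr.same.nodes_eq, hs₀.root_eq.symm.trans hr.same.root_eq,
      fun a b => hs₀.tAdj_iff.symm.trans (hr.same.adj_iff a b),
      fun a ha => (hs₀.symm.kind_eq a (hr.same.nodes_eq ▸ ha)).trans (hr.same.kind_eq a ha),
      fun a ha => (hs₀.symm.skel_eq a (hr.same.nodes_eq ▸ ha)).trans (hr.same.skel_eq a ha)⟩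
  have hT₀ := hr₀.isStrictBC h.strict
  have hsp : T₀.splitNodes = T.splitNodes := by
    ext v
    by_cases hv : v ∈ T.nodes
    · rw [mem_splitNodes_iff, mem_splitNodes_iff, hsol, hr₀.kind_eq v hv]
      simp only [hr₀.adj_iff]
    · exact iff_of_false (fun h' => hv (hr₀.nodes_eq ▸ splitNodes_mem_nodes h'))
        fun h' => hv (splitNodes_mem_nodes h')
  have hd : ∀ v ∈ T.splitNodes, ∀ b, T.DashedChild b v ↔ T₀.DashedChild b v := by
    intro v hv b
    rw [dashedChild_iff_of_mem_splitNodes hv, dashedChild_iff_of_mem_splitNodes (hsp ▸ hv), hsol,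
      hr₀.adj_iff]
  obtain ⟨R₀, hS₀, hI₀⟩ := exists_splitting_innerHeavy (T := T₀) (S := T₀.splitNodes) (n := n)
    (fun v hv => splitNodes_mem_nodes hv) (fun v hv => hv.1) (hsp ▸ hS.inj)
    (fun v hv => hr₀.nodes_eq ▸ hS.fresh v (hsp ▸ hv))
  have hoff : ∀ v b, T.DashedChild b v → ¬ T.Below e b := fun v b hb hbe =>
    hb.2 ((hex.2 b v hb.1).2 (Or.inl hbe))
  have hc : ∀ w ∈ {w | ¬ T.Below e w}, ∀ u, T.parent u = some w ↔ T₀.parent u = some w :=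
    fun w hw u => hr₀.parent_iff hex.1 hw
  have hD : ∀ w ∈ {w | ¬ T.Below e w}, ∀ u, T.parent u = some w → u ∈ {w | ¬ T.Below e w} :=
    fun w hw u hu hbu => hw (Relation.ReflTransGen.tail hbu hu)
  have hw := h.strict.uniqueC.weight_eq hT₀.uniqueC hr₀.nodes_eq hr₀.kind_eq hr₀.skel_eq
  have hi : ∀ v ∈ T.splitNodes, ∀ b, T.DashedChild b v → (b ∈ R.solid ↔ b ∈ R₀.solid) := by
    intro v hv b hb
    have hvT := splitNodes_mem_nodes hv
    have hbT := mem_child hb.1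
    rw [hI v hv b hb, hI₀ v (hsp ▸ hv) b ((hd v hv b).1 hb),
      subtreeWeight_congr hc hD (fun u _ => hw u) (hoff v b hb) hbT (hr₀.nodes_eq ▸ hbT),
      branchWeight_congr hc hD (fun u _ => hw u) (hw v) hvT (hr₀.nodes_eq ▸ hvT) (hd v hv)
        (hoff v)]
  obtain ⟨R', k, l, hst, hpre, hl, hlc, hk⟩ :=
    hS₀.exists_isPreSplit hI₀ hT₀ hs₀ (e := some T.root) hr.after
  have hch : changed T₀ T' = changed T T' := by
    unfold changed
    rw [hsol]
  rw [hch] at hlc hk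
  rw [hsp] at hS₀
  refine ⟨R₀, R', k, l, ⟨?_, hS₀.root_eq.trans hr₀.root_eq, fun a b => ⟨?_, ?_⟩, fun a ha => ?_,
    fun a ha => ?_⟩, ?_, hst, hpre, hl, hlc, hk⟩
  · ext b
    rw [hS₀.mem_nodes, hS.mem_nodes, hr₀.nodes_eq]
  · have hd' : ∀ v ∈ T.splitNodes, ∀ b, T₀.DashedChild b v ↔ T.DashedChild b v :=
      fun v hv b => (hd v hv b).symm
    have hadj : ∀ a b, T₀.TAdj a b → T.TAdj a b := fun a b => (hr₀.adj_iff a b).1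
    rintro (hab | hab)
    · exact hS₀.tAdj_of_parent hS hadj hd' hab
    · exact (hS₀.tAdj_of_parent hS hadj hd' hab).symm
  · have hadj : ∀ a b, T.TAdj a b → T₀.TAdj a b := fun a b => (hr₀.adj_iff a b).2
    rintro (hab | hab)
    · exact hS.tAdj_of_parent hS₀ hadj hd hab
    · exact (hS.tAdj_of_parent hS₀ hadj hd hab).symm
  · rcases (hS.mem_nodes a).1 ha with ha | ⟨v, hv, rfl⟩
    · rw [hS.kind_eq a ha, hS₀.kind_eq a (hr₀.nodes_eq ▸ ha), hr₀.kind_eq a ha]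
    · rw [hS.kind_new v hv, hS₀.kind_new v hv]
  · rcases (hS.mem_nodes a).1 ha with ha | ⟨v, hv, rfl⟩
    · rw [hS.skel_eq a ha, hS₀.skel_eq a (hr₀.nodes_eq ▸ ha), hr₀.skel_eq a ha]
    · rw [hS.skel_new v hv, hS₀.skel_new v hv, hr₀.skel_eq v (hS.mem_of v hv)]
  · refine Set.Subset.antisymm ?_ ?_
    · exact hS₀.solidEdges_subset hS hsol.subset (fun v hv b hb => (hd v hv b).2 hb)
        fun v hv b hb => (hi v hv b ((hd v hv b).2 hb)).2
    · exact hS.solidEdges_subset hS₀ hsol.symm.subset (fun v hv b hb => (hd v hv b).1 hb)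
        fun v hv b hb => (hi v hv b hb).1

/-! ### Parts of trees -/

/-- If two different nodes share a vertex, then some `C` node represents this vertex. -/
lemma IsRelaxedBC.exists_C (h : IsRelaxedBC G T) {a b : ν} (ha : a ∈ T.nodes) (hb : b ∈ T.nodes)
    (hab : a ≠ b) {x : α} (hxa : x ∈ V(T.skel a)) (hxb : x ∈ V(T.skel b)) :
    ∃ d ∈ T.nodes, T.kind d = Kind.C ∧ x ∈ V(T.skel d) := by
  rcases Relation.ReflTransGen.cases_head (h.connected x a ha b hb hxa hxb) with
    h' | ⟨c, ⟨hac, hxc⟩, -⟩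
  · exact absurd h' hab
  · have hc := (mem_of_tAdj hac).2
    have hk : T.kind a = Kind.C ∨ T.kind c = Kind.C := by
      rcases hac with h' | h'
      · exact h.not_both_B a c h'
      · exact (h.not_both_B c a h').symm
    rcases hk with hk | hk
    · exact ⟨a, ha, hk, hxa⟩
    · exact ⟨c, hc, hk, hxc⟩

/-- A node `c` of a part `T'` of a tree `T` has the same weight in both trees, if `T'` is attached to
the rest of `T` at another node `p`: all vertices of `c` that are represented by `C` nodes outside
`T'` are contained in `p`, and hence are represented by `C` nodes in `T'`. -/
lemma weight_eq_of_part (hT : T.UniqueC) (hT' : IsStrictBC G T') {c p : ν} (hc : c ∈ T'.nodes)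
    (hcT : c ∈ T.nodes) (hk : T.kind c = T'.kind c) (hs : T.skel c = T'.skel c)
    (hp : p ∈ T'.nodes) (hpc : c ≠ p)
    (hcover : ∀ d ∈ T.nodes, T.kind d = Kind.C → ∀ y ∈ V(T.skel d), y ∈ V(T'.skel c) →
      (∃ d' ∈ T'.nodes, T'.kind d' = Kind.C ∧ y ∈ V(T'.skel d')) ∨ y ∈ V(T'.skel p))
    (hback : ∀ d ∈ T'.nodes, T'.kind d = Kind.C → ∀ y ∈ V(T'.skel d),
      ∃ d' ∈ T.nodes, T.kind d' = Kind.C ∧ y ∈ V(T.skel d')) :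
    T.weight c = T'.weight c := by
  unfold weight
  congr 1
  ext y
  simp only [Set.mem_ofPred_eq]
  rw [hT.isHome_iff, hT'.uniqueC.isHome_iff, hk, hs]
  simp only [hc, hcT, true_and]
  refine and_congr_right fun hy => or_congr_right ⟨fun h d hd hkd hyd => ?_, fun h d hd hkd hyd => ?_⟩
  · obtain ⟨d', hd', hkd', hyd'⟩ := hback d hd hkd y hyd
    exact h d' hd' hkd' hyd'
  · rcases hcover d hd hkd y hyd hy with ⟨d', hd', hkd', hyd'⟩ | hyp
    · exact h d' hd' hkd' hyd'
    · obtain ⟨d', hd', hkd', hyd'⟩ := hT'.toIsRelaxedBC.exists_C hc hp hpc hy hyp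
      exact h d' hd' hkd' hyd'

lemma mem_splitNodes_congr {v : ν} (hk : T.kind v = Kind.C → T'.kind v = Kind.C)
    (hv : v ∈ T.solid → v ∈ T'.solid) (hs : ∀ b, T.SolidChild b v → T'.SolidChild b v)
    (hd : ∀ b, T.DashedChild b v → T'.DashedChild b v) (h : v ∈ T.splitNodes) :
    v ∈ T'.splitNodes := by
  obtain ⟨h1, h2, ⟨s, h3⟩, c, d, hcd, h4, h5⟩ := h
  exact ⟨hk h1, hv h2, ⟨s, hs s h3⟩, c, d, hcd, hd c h4, hd d h5⟩

/-- Where two trees and the sets of their split nodes agree, so do the split trees. -/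
lemma Splitting.agree {S' : Set ν} (h : Splitting T S n R) (h' : Splitting T' S' n R') {b : ν}
    (hb : b ∈ T.nodes) (hb' : b ∈ T'.nodes) (hp : T'.parent b = T.parent b)
    (hs : b ∈ T'.solid ↔ b ∈ T.solid) (hS : ∀ v, T.parent b = some v → (v ∈ S' ↔ v ∈ S))
    (hi : ∀ v ∈ S, T.DashedChild b v → (b ∈ R'.solid ↔ b ∈ R.solid)) :
    R'.parent b = R.parent b ∧ (b ∈ R'.solid ↔ b ∈ R.solid) := by
  by_cases hm : ∃ v ∈ S, T.DashedChild b v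
  · obtain ⟨v, hv, hd⟩ := hm
    have hv' := (hS v hd.1).2 hv
    exact ⟨(h'.moved v hv' b ⟨hp.trans hd.1, fun hs' => hd.2 (hs.1 hs')⟩).trans
      (h.moved v hv b hd).symm, hi v hv hd⟩
  · push Not at hm
    obtain ⟨h1, h2⟩ := h.kept b hb hm
    obtain ⟨h1', h2'⟩ := h'.kept b hb' fun v hv hd => by
      have hd1 := hp.symm.trans hd.1
      exact hm v ((hS v hd1).1 hv) ⟨hd1, fun hs' => hd.2 (hs.2 hs')⟩
    exact ⟨(h1'.trans hp).trans h1.symm, (h2'.trans hs).trans h2.symm⟩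

lemma mem_of_mem_solidEdges {f : Sym2 ν} (hf : f ∈ T.solidEdges) {v : ν} (hv : v ∈ f) :
    v ∈ T.nodes := by
  obtain ⟨a, b, hab, rfl⟩ := hf
  rcases Sym2.mem_iff.1 hv with rfl | rfl
  · exact mem_child hab.1
  · exact mem_parent hab.1

lemma finite_solidEdges : T.solidEdges.Finite := by
  refine (T.nodes.finite_toSet.image fun c => s(c, (T.parent c).getD c)).subset ?_
  rintro f ⟨a, b, hab, rfl⟩
  refine ⟨a, mem_child hab.1, ?_⟩
  simp only [hab.1, Option.getD_some]

lemma IsExposed.not_solidChild {e s : ν} (h : T.IsExposed e) : ¬ T.SolidChild s e := by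
  intro hs
  rcases (h.2 s e hs.1).1 hs.2 with h' | h'
  · exact not_below_of_parent hs.1 h'
  · exact h'.1 Relation.ReflTransGen.refl

/-! ### Cutting -/

namespace IsCut

variable {L₁ L₂ : PDTree ν α β} {a e : ν}

lemma parent_left_iff (h : IsCut T a e L₁ L₂) {u w : ν} (hw : w ∈ L₁.nodes) :
    T.parent u = some w ↔ L₁.parent u = some w := by
  constructor
  · intro hp
    have hu : u ∈ L₁.nodes := (h.mem_left u).2 (Relation.ReflTransGen.head hp ((h.mem_left w).1 hw))
    rw [h.parent_left u hu, hp]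
    rintro rfl
    rw [h.parent_a] at hp
    cases hp
    exact not_below_of_parent h.parent_a ((h.mem_left e).1 hw)
  · intro hp
    rw [← h.parent_left u (mem_child hp) fun hr => ne_root hp (hr.trans h.root_left.symm)]
    exact hp

lemma solid_left_iff (h : IsCut T a e L₁ L₂) {u w : ν} (hp : L₁.parent u = some w) :
    u ∈ L₁.solid ↔ u ∈ T.solid :=
  h.solid_left u (mem_child hp) fun hr => ne_root hp (hr.trans h.root_left.symm)

lemma parent_right_iff (h : IsCut T a e L₁ L₂) {u w : ν} (hw : w ∈ L₂.nodes) :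
    L₂.parent u = some w ↔ T.parent u = some w ∧ u ≠ a := by
  constructor
  · intro hp
    have hu := mem_child hp
    refine ⟨by rwa [← h.parent_right u hu], ?_⟩
    rintro rfl
    exact ((h.mem_right _).1 hu).2 Relation.ReflTransGen.refl
  · rintro ⟨hp, hne⟩
    rw [h.parent_right u ((h.mem_right u).2 ⟨mem_child hp, fun hua => ?_⟩), hp]
    exact ((h.mem_right w).1 hw).2 (hua.parent_of_ne hne hp)

/-- A vertex occurring on both sides of the edge `(a, e)` is contained in both ends of the edge. -/
lemma mem_skel_of_path (h : IsRelaxedBC G T) (hae : T.parent a = some e) {x : α} {c d : ν}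
    (hc : c ∈ T.nodes) (hd : d ∈ T.nodes) (hca : T.Below c a) (hda : ¬ T.Below d a)
    (hxc : x ∈ V(T.skel c)) (hxd : x ∈ V(T.skel d)) : x ∈ V(T.skel a) ∧ x ∈ V(T.skel e) := by
  suffices x ∈ V(T.skel d) ∧ (T.Below d a ∨ (x ∈ V(T.skel a) ∧ x ∈ V(T.skel e))) from
    this.2.resolve_left hda
  have hpath := h.connected x c hc d hd hxc hxd
  clear hd hda hxd
  induction hpath with
  | refl => exact ⟨hxc, Or.inl hca⟩
  | tail _ hst ih =>
    rename_i u w _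
    obtain ⟨hxu, hua | hx⟩ := ih
    · refine ⟨hst.2, ?_⟩
      rcases hst.1 with hp | hp
      · by_cases hne : u = a
        · subst hne
          rw [hae] at hp
          cases hp
          exact Or.inr ⟨hxu, hst.2⟩
        · exact Or.inl (hua.parent_of_ne hne hp)
      · exact Or.inl (Relation.ReflTransGen.head hp hua)
    · exact ⟨hst.2, Or.inr hx⟩

end IsCut

lemma symmDiff_union_union {X : Type*} {A A' B B' : Set X} (h : Disjoint (A ∪ A') (B ∪ B')) :
    symmDiff (A ∪ B) (A' ∪ B') = symmDiff A A' ∪ symmDiff B B' := by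
  ext x
  have hx : ¬ ((x ∈ A ∨ x ∈ A') ∧ (x ∈ B ∨ x ∈ B')) := fun hx =>
    Set.disjoint_left.1 h hx.1 hx.2
  simp only [Set.mem_symmDiff, Set.mem_union]
  tauto

lemma IsPreSplit.exists_cut [Infinite ν] {G₁ G₂ : Graph α β} {a e : ν} {T₁ T₂ : PDTree ν α β}
    (h : IsPreSplit G (some e) T R) (hc : StrictCut T a e T₁ T₂) (h₁ : IsStrictBC G₁ T₁)
    (h₂ : IsStrictBC G₂ T₂) :
    ∃ Q₁ Q₂ R₁ R₂ k₁ k₂ l₁ l₂, IsCut R a e Q₁ Q₂ ∧ Steps Q₁ R₁ k₁ l₁ ∧ Steps Q₂ R₂ k₂ l₂ ∧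
      IsPreSplit G₁ none T₁ R₁ ∧ IsPreSplit G₂ (some e) T₂ R₂ ∧ (l₁ ++ l₂).Nodup ∧
      (∀ f ∈ l₁ ++ l₂, f ∈ changedCut T T₁ T₂) ∧ k₁ + k₂ ≤ 4 * (changedCut T T₁ T₂).ncard := by
  obtain ⟨n, hS, hI⟩ := h.exists_splitting
  obtain ⟨L₁, L₂, hcut, hs₁, hs₂⟩ := hc.cut
  have hex := hc.before
  have hae := hcut.parent_a
  have hL₁ := hs₁.symm.isStrictBC h₁
  have hL₂ := hs₂.symm.isStrictBC h₂
  have heS : e ∉ T.splitNodes := fun he => by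
    obtain ⟨-, -, ⟨s, hs⟩, -⟩ := he
    exact hex.not_solidChild hs
  have has : a ∉ T.solid := fun hs => hex.not_solidChild ⟨hae, hs⟩
  have haS : a ∉ T.splitNodes := fun ha => has ha.2.1
  have hea : ¬ T.Below e a := not_below_of_parent hae
  have haL₁ : a ∈ L₁.nodes := hcut.root_left ▸ L₁.root_mem
  have heL₂ : e ∈ L₂.nodes := (hcut.mem_right e).2 ⟨mem_parent hae, hea⟩
  have haL₁s : a ∉ L₁.solid := fun hs => by
    obtain ⟨p, hp⟩ := L₁.parent_of_solid a hs
    exact ne_root hp hcut.root_left.symm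
  have hsub₁ : ∀ b ∈ L₁.nodes, b ∈ T.nodes := fun b hb =>
    ((hcut.mem_left b).1 hb).mem_left (mem_child hae)
  have hsub₂ : ∀ b ∈ L₂.nodes, b ∈ T.nodes := fun b hb => ((hcut.mem_right b).1 hb).1
  have hdisj : ∀ b ∈ L₁.nodes, b ∉ L₂.nodes := fun b hb hb' =>
    ((hcut.mem_right b).1 hb').2 ((hcut.mem_left b).1 hb)
  -- the children of the nodes in the two parts
  have hd₁ : ∀ v ∈ L₁.nodes, ∀ b, T.DashedChild b v ↔ L₁.DashedChild b v := fun v hv b => by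
    unfold DashedChild
    rw [hcut.parent_left_iff hv]
    exact and_congr_right fun hp => not_congr (hcut.solid_left_iff hp).symm
  have hsc₁ : ∀ v ∈ L₁.nodes, ∀ b, T.SolidChild b v ↔ L₁.SolidChild b v := fun v hv b => by
    unfold SolidChild
    rw [hcut.parent_left_iff hv]
    exact and_congr_right fun hp => (hcut.solid_left_iff hp).symm
  have hpar₂ : ∀ v ∈ L₂.nodes, v ≠ e → ∀ b, T.parent b = some v ↔ L₂.parent b = some v := by
    intro v hv hve b
    rw [hcut.parent_right_iff hv, iff_self_and]
    rintro hp rfl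
    rw [hae] at hp
    cases hp
    exact hve rfl
  have hd₂ : ∀ v ∈ L₂.nodes, v ≠ e → ∀ b, T.DashedChild b v ↔ L₂.DashedChild b v := by
    intro v hv hve b
    unfold DashedChild
    rw [hpar₂ v hv hve]
    exact and_congr_right fun hp => not_congr (hcut.solid_right b (mem_child hp)).symm
  have hsc₂ : ∀ v ∈ L₂.nodes, ∀ b, T.SolidChild b v ↔ L₂.SolidChild b v := fun v hv b => by
    unfold SolidChild
    rw [hcut.parent_right_iff hv]
    constructor
    · rintro ⟨hp, hs⟩
      have hba : b ≠ a := by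
        rintro rfl
        exact has hs
      exact ⟨⟨hp, hba⟩, (hcut.solid_right b
        (mem_child ((hcut.parent_right_iff hv).2 ⟨hp, hba⟩))).2 hs⟩
    · rintro ⟨hp, hs⟩
      exact ⟨hp.1, (hcut.solid_right b (mem_of_solid hs)).1 hs⟩
  -- the split nodes of the two parts
  have hsp₁ : ∀ v ∈ L₁.nodes, (v ∈ L₁.splitNodes ↔ v ∈ T.splitNodes) := by
    intro v hv
    by_cases hva : v = a
    · subst hva
      exact iff_of_false (fun h => haL₁s h.2.1) haS
    · have hk := hcut.kind_left v hv
      have hvs := hcut.solid_left v hv hva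
      exact ⟨mem_splitNodes_congr (fun h => hk.symm.trans h) hvs.1 (fun b => (hsc₁ v hv b).2)
        (fun b => (hd₁ v hv b).2), mem_splitNodes_congr (fun h => hk.trans h) hvs.2
        (fun b => (hsc₁ v hv b).1) (fun b => (hd₁ v hv b).1)⟩
  have hsp₂ : ∀ v ∈ L₂.nodes, (v ∈ L₂.splitNodes ↔ v ∈ T.splitNodes) := by
    intro v hv
    by_cases hve : v = e
    · subst hve
      refine iff_of_false (fun h => ?_) heS
      obtain ⟨-, -, ⟨s, hs⟩, -⟩ := h
      exact hex.not_solidChild ((hsc₂ _ hv s).2 hs)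
    · have hk := hcut.kind_right v hv
      have hvs := hcut.solid_right v hv
      exact ⟨mem_splitNodes_congr (fun h => hk.symm.trans h) hvs.1 (fun b => (hsc₂ v hv b).2)
        (fun b => (hd₂ v hv hve b).2), mem_splitNodes_congr (fun h => hk.trans h) hvs.2
        (fun b => (hsc₂ v hv b).1) (fun b => (hd₂ v hv hve b).1)⟩
  have hS₁ : ∀ v ∈ L₁.splitNodes, v ∈ T.splitNodes := fun v hv =>
    (hsp₁ v (splitNodes_mem_nodes hv)).1 hv
  have hS₂ : ∀ v ∈ L₂.splitNodes, v ∈ T.splitNodes := fun v hv =>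
    (hsp₂ v (splitNodes_mem_nodes hv)).1 hv
  obtain ⟨Q₁, hQ₁, hJ₁⟩ := exists_splitting_innerHeavy (T := L₁) (S := L₁.splitNodes) (n := n)
    (fun v hv => splitNodes_mem_nodes hv) (fun v hv => hv.1) (hS.inj.mono hS₁)
    (fun v hv hm => hS.fresh v (hS₁ v hv) (hsub₁ _ hm))
  obtain ⟨Q₂, hQ₂, hJ₂⟩ := exists_splitting_innerHeavy (T := L₂) (S := L₂.splitNodes) (n := n)
    (fun v hv => splitNodes_mem_nodes hv) (fun v hv => hv.1) (hS.inj.mono hS₂)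
    (fun v hv hm => hS.fresh v (hS₂ v hv) (hsub₂ _ hm))
  -- the weights in the two parts
  have hw₁ : ∀ c ∈ {w | T.Below w a ∧ w ≠ a}, T.weight c = L₁.weight c := by
    rintro c ⟨hca, hne⟩
    have hcL := (hcut.mem_left c).2 hca
    refine weight_eq_of_part h.strict.uniqueC hL₁ hcL (hsub₁ c hcL)
      (hcut.kind_left c hcL).symm (by rw [hcut.skel_left c hcL]) haL₁ hne (fun d hd hkd y hyd hyc => ?_)
      (fun d hd hkd y hyd => ⟨d, hsub₁ d hd, by rwa [← hcut.kind_left d hd],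
        by rwa [← hcut.skel_left d hd]⟩)
    by_cases hda : T.Below d a
    · have hdL := (hcut.mem_left d).2 hda
      exact Or.inl ⟨d, hdL, by rwa [hcut.kind_left d hdL], by rwa [hcut.skel_left d hdL]⟩
    · rw [hcut.skel_left c hcL] at hyc
      rw [hcut.skel_left a haL₁]
      exact Or.inr (IsCut.mem_skel_of_path h.strict.toIsRelaxedBC hae (hsub₁ c hcL) hd hca hda
        hyc hyd).1
  have hw₂ : ∀ c ∈ L₂.nodes, c ≠ e → T.weight c = L₂.weight c := by
    intro c hcL hne
    have hca := ((hcut.mem_right c).1 hcL).2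
    refine weight_eq_of_part h.strict.uniqueC hL₂ hcL (hsub₂ c hcL)
      (hcut.kind_right c hcL).symm (by rw [hcut.skel_right c hcL]) heL₂ hne
      (fun d hd hkd y hyd hyc => ?_)
      (fun d hd hkd y hyd => ⟨d, hsub₂ d hd, by rwa [← hcut.kind_right d hd],
        by rwa [← hcut.skel_right d hd]⟩)
    by_cases hda : T.Below d a
    · rw [hcut.skel_right c hcL] at hyc
      rw [hcut.skel_right e heL₂]
      exact Or.inr (IsCut.mem_skel_of_path h.strict.toIsRelaxedBC hae hd (hsub₂ c hcL) hda hca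
        hyd hyc).2
    · have hdL := (hcut.mem_right d).2 ⟨hd, hda⟩
      exact Or.inl ⟨d, hdL, by rwa [hcut.kind_right d hdL], by rwa [hcut.skel_right d hdL]⟩
  have hi₁ : ∀ v ∈ L₁.splitNodes, ∀ b, T.DashedChild b v → (b ∈ Q₁.solid ↔ b ∈ R.solid) := by
    intro v hv b hb
    have hvL := splitNodes_mem_nodes hv
    have hva := (hcut.mem_left v).1 hvL
    have hb' := (hd₁ v hvL b).1 hb
    have hD : ∀ w ∈ {w | T.Below w a ∧ w ≠ a}, ∀ u, T.parent u = some w →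
        u ∈ {w | T.Below w a ∧ w ≠ a} := by
      rintro w ⟨hwa, -⟩ u hu
      refine ⟨Relation.ReflTransGen.head hu hwa, ?_⟩
      rintro rfl
      exact not_below_of_parent hu hwa
    have hch : ∀ w ∈ {w | T.Below w a ∧ w ≠ a}, ∀ u,
        T.parent u = some w ↔ L₁.parent u = some w := fun w hw u =>
      hcut.parent_left_iff ((hcut.mem_left w).2 hw.1)
    have hdD : ∀ b, T.DashedChild b v → b ∈ {w | T.Below w a ∧ w ≠ a} := by
      rintro b hb
      refine ⟨Relation.ReflTransGen.head hb.1 hva, ?_⟩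
      rintro rfl
      exact not_below_of_parent hb.1 hva
    have hvne : v ≠ a := by
      rintro rfl
      exact haL₁s hv.2.1
    rw [hJ₁ v hv b hb', hI v (hS₁ v hv) b hb,
      subtreeWeight_congr hch hD hw₁ (hdD b hb) (mem_child hb.1) (mem_child hb'.1),
      branchWeight_congr hch hD hw₁ (hw₁ v ⟨hva, hvne⟩) (hsub₁ v hvL) hvL (hd₁ v hvL) hdD]
  have hi₂ : ∀ v ∈ L₂.splitNodes, ∀ b, T.DashedChild b v → (b ∈ Q₂.solid ↔ b ∈ R.solid) := by
    intro v hv b hb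
    have hvL := splitNodes_mem_nodes hv
    have hve : v ≠ e := by
      rintro rfl
      exact heS (hS₂ _ hv)
    have hb' := (hd₂ v hvL hve b).1 hb
    have hne : ∀ w, ¬ T.Below e w → w ≠ e := by
      rintro w hw rfl
      exact hw Relation.ReflTransGen.refl
    have hD : ∀ w ∈ {w | w ∈ L₂.nodes ∧ ¬ T.Below e w}, ∀ u, T.parent u = some w →
        u ∈ {w | w ∈ L₂.nodes ∧ ¬ T.Below e w} := by
      rintro w ⟨hw, hew⟩ u hu
      exact ⟨mem_child ((hpar₂ w hw (hne w hew) u).1 hu), fun heu =>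
        hew (Relation.ReflTransGen.tail heu hu)⟩
    have hch : ∀ w ∈ {w | w ∈ L₂.nodes ∧ ¬ T.Below e w}, ∀ u,
        T.parent u = some w ↔ L₂.parent u = some w := fun w hw u => hpar₂ w hw.1 (hne w hw.2) u
    have hw : ∀ w ∈ {w | w ∈ L₂.nodes ∧ ¬ T.Below e w}, T.weight w = L₂.weight w := fun w hw =>
      hw₂ w hw.1 (hne w hw.2)
    have hdD : ∀ b, T.DashedChild b v → b ∈ {w | w ∈ L₂.nodes ∧ ¬ T.Below e w} := fun b hb =>
      ⟨mem_child ((hd₂ v hvL hve b).1 hb).1, fun heb => hb.2 ((hex.2 b v hb.1).2 (Or.inl heb))⟩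
    rw [hJ₂ v hv b hb', hI v (hS₂ v hv) b hb,
      subtreeWeight_congr hch hD hw (hdD b hb) (mem_child hb.1) (mem_child hb'.1),
      branchWeight_congr hch hD hw (hw₂ v hvL hve) (hsub₂ v hvL) hvL (hd₂ v hvL hve) hdD]
  have key₁ : ∀ b ∈ Q₁.nodes, b ≠ a →
      Q₁.parent b = R.parent b ∧ (b ∈ Q₁.solid ↔ b ∈ R.solid) := by
    intro b hb hba
    rcases (hQ₁.mem_nodes b).1 hb with hb | ⟨v, hv, rfl⟩
    · have hpL : ∀ v, T.parent b = some v → v ∈ L₁.nodes := fun v hp =>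
        (hcut.mem_left v).2 (((hcut.mem_left b).1 hb).parent_of_ne hba hp)
      exact hS.agree hQ₁ (hsub₁ b hb) hb (hcut.parent_left b hb hba) (hcut.solid_left b hb hba)
        (fun v hp => hsp₁ v (hpL v hp)) fun v hv hd => hi₁ v ((hsp₁ v (hpL v hd.1)).2 hv) b hd
    · exact ⟨(hQ₁.parent_new v hv).trans (hS.parent_new v (hS₁ v hv)).symm,
        iff_of_false (hQ₁.dashed_new v hv) (hS.dashed_new v (hS₁ v hv))⟩
  have key₂ : ∀ b ∈ Q₂.nodes, Q₂.parent b = R.parent b ∧ (b ∈ Q₂.solid ↔ b ∈ R.solid) := by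
    intro b hb
    rcases (hQ₂.mem_nodes b).1 hb with hb | ⟨v, hv, rfl⟩
    · have hpL : ∀ v, T.parent b = some v → v ∈ L₂.nodes := fun v hp =>
        (hcut.mem_right v).2 ⟨mem_parent hp, fun hva =>
          ((hcut.mem_right b).1 hb).2 (Relation.ReflTransGen.head hp hva)⟩
      exact hS.agree hQ₂ (hsub₂ b hb) hb (hcut.parent_right b hb) (hcut.solid_right b hb)
        (fun v hp => hsp₂ v (hpL v hp)) fun v hv hd => hi₂ v ((hsp₂ v (hpL v hd.1)).2 hv) b hd
    · exact ⟨(hQ₂.parent_new v hv).trans (hS.parent_new v (hS₂ v hv)).symm,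
        iff_of_false (hQ₂.dashed_new v hv) (hS.dashed_new v (hS₂ v hv))⟩
  have hcutR : IsCut R a e Q₁ Q₂ := by
    have haT := mem_child hae
    refine ⟨(hS.parent_notMem hae heS).1, fun b => ?_, fun b => ?_,
      hQ₁.root_eq.trans hcut.root_left, (hQ₂.root_eq.trans hcut.root_right).trans hS.root_eq.symm,
      fun b hb hba => (key₁ b hb hba).1, fun b hb => (key₂ b hb).1, fun b hb => ?_, fun b hb => ?_,
      fun b hb => ?_, fun b hb => ?_, fun b hb hba => (key₁ b hb hba).2,
      fun b hb => (key₂ b hb).2⟩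
    · rw [hQ₁.mem_nodes]
      constructor
      · rintro (hb | ⟨v, hv, rfl⟩)
        · exact hS.below_of_below ((hcut.mem_left b).1 hb)
        · exact (hS.new_below_iff (hS₁ v hv) haT).2
            ((hcut.mem_left v).1 (splitNodes_mem_nodes hv))
      · intro hb
        rcases (hS.mem_nodes b).1 (hb.mem_left (hS.mem_old haT)) with hbT | ⟨v, hv, rfl⟩
        · exact Or.inl ((hcut.mem_left b).2 ((hS.below_iff hbT haT).1 hb))
        · have hvL := (hcut.mem_left v).2 ((hS.new_below_iff hv haT).1 hb)
          exact Or.inr ⟨v, (hsp₁ v hvL).2 hv, rfl⟩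
    · rw [hQ₂.mem_nodes]
      constructor
      · rintro (hb | ⟨v, hv, rfl⟩)
        · have hb' := (hcut.mem_right b).1 hb
          exact ⟨hS.mem_old hb'.1, fun hba => hb'.2 ((hS.below_iff hb'.1 haT).1 hba)⟩
        · exact ⟨hS.mem_new (hS₂ v hv), fun hba =>
            ((hcut.mem_right v).1 (splitNodes_mem_nodes hv)).2
              ((hS.new_below_iff (hS₂ v hv) haT).1 hba)⟩
      · rintro ⟨hb, hba⟩
        rcases (hS.mem_nodes b).1 hb with hbT | ⟨v, hv, rfl⟩
        · exact Or.inl ((hcut.mem_right b).2 ⟨hbT, fun hb' => hba (hS.below_of_below hb')⟩)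
        · have hvL := (hcut.mem_right v).2 ⟨hS.mem_of v hv, fun hva =>
            hba ((hS.new_below_iff hv haT).2 hva)⟩
          exact Or.inr ⟨v, (hsp₂ v hvL).2 hv, rfl⟩
    · rcases (hQ₁.mem_nodes b).1 hb with hb | ⟨v, hv, rfl⟩
      · rw [hQ₁.kind_eq b hb, hS.kind_eq b (hsub₁ b hb), hcut.kind_left b hb]
      · rw [hQ₁.kind_new v hv, hS.kind_new v (hS₁ v hv)]
    · rcases (hQ₂.mem_nodes b).1 hb with hb | ⟨v, hv, rfl⟩
      · rw [hQ₂.kind_eq b hb, hS.kind_eq b (hsub₂ b hb), hcut.kind_right b hb]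
      · rw [hQ₂.kind_new v hv, hS.kind_new v (hS₂ v hv)]
    · rcases (hQ₁.mem_nodes b).1 hb with hb | ⟨v, hv, rfl⟩
      · rw [hQ₁.skel_eq b hb, hS.skel_eq b (hsub₁ b hb), hcut.skel_left b hb]
      · rw [hQ₁.skel_new v hv, hS.skel_new v (hS₁ v hv), hcut.skel_left v (splitNodes_mem_nodes hv)]
    · rcases (hQ₂.mem_nodes b).1 hb with hb | ⟨v, hv, rfl⟩
      · rw [hQ₂.skel_eq b hb, hS.skel_eq b (hsub₂ b hb), hcut.skel_right b hb]
      · rw [hQ₂.skel_new v hv, hS.skel_new v (hS₂ v hv), hcut.skel_right v (splitNodes_mem_nodes hv)]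
  obtain ⟨R₁, k₁, l₁, hst₁, hpre₁, hl₁, hlc₁, hk₁⟩ :=
    hQ₁.exists_isPreSplit hJ₁ hL₁ hs₁ (e := none) hc.after_left
  obtain ⟨R₂, k₂, l₂, hst₂, hpre₂, hl₂, hlc₂, hk₂⟩ :=
    hQ₂.exists_isPreSplit hJ₂ hL₂ hs₂ (e := some e) hc.after_right
  -- the edges of the two parts
  have hTsol : T.solidEdges = L₁.solidEdges ∪ L₂.solidEdges := by
    ext f
    constructor
    · rintro ⟨c, p, hcp, rfl⟩
      by_cases hca : T.Below p a
      · exact Or.inl ⟨c, p, (hsc₁ p ((hcut.mem_left p).2 hca) c).1 hcp, rfl⟩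
      · exact Or.inr ⟨c, p, (hsc₂ p ((hcut.mem_right p).2 ⟨mem_parent hcp.1, hca⟩) c).1 hcp, rfl⟩
    · rintro (⟨c, p, hcp, rfl⟩ | ⟨c, p, hcp, rfl⟩)
      · exact ⟨c, p, (hsc₁ p (mem_parent hcp.1) c).2 hcp, rfl⟩
      · exact ⟨c, p, (hsc₂ p (mem_parent hcp.1) c).2 hcp, rfl⟩
  have hdis : Disjoint (L₁.solidEdges ∪ T₁.solidEdges) (L₂.solidEdges ∪ T₂.solidEdges) := by
    rw [Set.disjoint_left]
    intro f hf hf'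
    induction f using Sym2.ind with
    | _ x y =>
      have hx : x ∈ s(x, y) := Sym2.mem_mk_left x y
      refine hdisj x ?_ ?_
      · exact hf.elim (fun h => mem_of_mem_solidEdges h hx)
          fun h => hs₁.nodes_eq ▸ mem_of_mem_solidEdges h hx
      · exact hf'.elim (fun h => mem_of_mem_solidEdges h hx)
          fun h => hs₂.nodes_eq ▸ mem_of_mem_solidEdges h hx
  have hchg : changedCut T T₁ T₂ = changed L₁ T₁ ∪ changed L₂ T₂ := by
    unfold changedCut changed
    rw [hTsol, symmDiff_union_union hdis]
  have hdis' : Disjoint (changed L₁ T₁) (changed L₂ T₂) :=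
    hdis.mono symmDiff_le_sup symmDiff_le_sup
  refine ⟨Q₁, Q₂, R₁, R₂, k₁, k₂, l₁, l₂, hcutR, hst₁, hst₂, hpre₁, hpre₂, ?_, fun f hf => ?_, ?_⟩
  · rw [List.nodup_append]
    refine ⟨hl₁, hl₂, ?_⟩
    rintro f hf _ hf' rfl
    exact Set.disjoint_left.1 hdis' (hlc₁ f hf) (hlc₂ f hf')
  · rw [hchg]
    exact (List.mem_append.1 hf).imp (hlc₁ f) (hlc₂ f)
  · rw [hchg, Set.ncard_union_eq hdis' hs₁.finite_changed hs₂.finite_changed]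
    omega

/-! ### Linking -/

/-- `T` consists of the trees `T₁` (with root `a`) and `T₂` (exposed at `e`), where `a` has become a
dashed child of `e` or, if both are `C` nodes, may have been contracted into `e`, making its child
edges dashed. -/
structure Joined (T₁ T₂ : PDTree ν α β) (a e : ν) (T : PDTree ν α β) : Prop where
  disjoint : ∀ b ∈ T₁.nodes, b ∉ T₂.nodes
  root_left : T₁.root = a
  mem_e : e ∈ T₂.nodes
  mem_cases : ∀ b ∈ T.nodes, b ∈ T₁.nodes ∨ b ∈ T₂.nodes
  mem_left : ∀ b ∈ T₁.nodes, b ≠ a → b ∈ T.nodes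
  mem_right : ∀ b ∈ T₂.nodes, b ∈ T.nodes
  mem_a : a ∈ T.nodes ∨ (T₁.kind a = Kind.C ∧ T₂.kind e = Kind.C)
  kind_left : ∀ b ∈ T₁.nodes, b ∈ T.nodes → T.kind b = T₁.kind b
  kind_right : ∀ b ∈ T₂.nodes, T.kind b = T₂.kind b
  skel_left : ∀ b ∈ T₁.nodes, b ∈ T.nodes → T.skel b = T₁.skel b
  skel_right : ∀ b ∈ T₂.nodes, T.skel b = T₂.skel b
  parent_left : ∀ w ∈ T₁.nodes, w ≠ a → ∀ u, T₁.parent u = some w ↔ T.parent u = some w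
  parent_right : ∀ w ∈ T₂.nodes, w ≠ e → ∀ u, T₂.parent u = some w ↔ T.parent u = some w
  solid_left : ∀ w ∈ T₁.nodes, w ≠ a → ∀ u, T₁.parent u = some w → (u ∈ T.solid ↔ u ∈ T₁.solid)
  own_left : ∀ v ∈ T₁.nodes, v ≠ a → T₁.kind v = Kind.C → (v ∈ T.solid ↔ v ∈ T₁.solid)
  solid_right : ∀ v ∈ T₂.nodes, (v ∈ T.solid ↔ v ∈ T₂.solid)
  not_solid_a : a ∉ T.solid
  not_solidChild : ∀ s, ¬ T.SolidChild s e

namespace Joined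

variable {T₁ T₂ : PDTree ν α β} {a e : ν} {G₁ G₂ : Graph α β} {x : α} {R₁ R₂ : PDTree ν α β}

lemma a_mem (h : Joined T₁ T₂ a e T) : a ∈ T₁.nodes := h.root_left ▸ T₁.root_mem

lemma not_solid_root (h : Joined T₁ T₂ a e T) : a ∉ T₁.solid := fun hs => by
  obtain ⟨p, hp⟩ := T₁.parent_of_solid a hs
  exact ne_root hp h.root_left.symm

lemma solidChild_left (h : Joined T₁ T₂ a e T) {v : ν} (hv : v ∈ T₁.nodes) (hva : v ≠ a) (b : ν) :
    T₁.SolidChild b v ↔ T.SolidChild b v := by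
  unfold SolidChild
  rw [← h.parent_left v hv hva]
  exact and_congr_right fun hp => (h.solid_left v hv hva b hp).symm

lemma dashedChild_left (h : Joined T₁ T₂ a e T) {v : ν} (hv : v ∈ T₁.nodes) (hva : v ≠ a) (b : ν) :
    T₁.DashedChild b v ↔ T.DashedChild b v := by
  unfold DashedChild
  rw [← h.parent_left v hv hva]
  exact and_congr_right fun hp => not_congr (h.solid_left v hv hva b hp).symm

lemma solidChild_right (h : Joined T₁ T₂ a e T) {v : ν} (hv : v ∈ T₂.nodes) (hve : v ≠ e) (b : ν) :
    T₂.SolidChild b v ↔ T.SolidChild b v := by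
  unfold SolidChild
  rw [← h.parent_right v hv hve]
  exact and_congr_right fun hp => (h.solid_right b (mem_child hp)).symm

lemma dashedChild_right (h : Joined T₁ T₂ a e T) {v : ν} (hv : v ∈ T₂.nodes) (hve : v ≠ e) (b : ν) :
    T₂.DashedChild b v ↔ T.DashedChild b v := by
  unfold DashedChild
  rw [← h.parent_right v hv hve]
  exact and_congr_right fun hp => not_congr (h.solid_right b (mem_child hp)).symm

lemma splitNodes_ne_right (hex : T₂.IsExposed e) {v : ν} (hv : v ∈ T₂.splitNodes) : v ≠ e := by
  rintro rfl
  obtain ⟨-, -, ⟨s, hs⟩, -⟩ := hv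
  exact hex.not_solidChild hs

lemma splitNodes_ne_left (h : Joined T₁ T₂ a e T) {v : ν} (hv : v ∈ T₁.splitNodes) : v ≠ a := by
  rintro rfl
  exact h.not_solid_root hv.2.1

lemma splitNodes_eq (h : Joined T₁ T₂ a e T) (hex : T₂.IsExposed e) :
    T.splitNodes = T₁.splitNodes ∪ T₂.splitNodes := by
  ext v
  constructor
  · intro hv
    have hvT := splitNodes_mem_nodes hv
    rcases h.mem_cases v hvT with hv₁ | hv₂
    · have hva : v ≠ a := by
        rintro rfl
        exact h.not_solid_a hv.2.1
      have hk := (h.kind_left v hv₁ hvT).symm.trans hv.1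
      exact Or.inl (mem_splitNodes_congr (fun _ => hk) (h.own_left v hv₁ hva hk).1
        (fun b => (h.solidChild_left hv₁ hva b).2) (fun b => (h.dashedChild_left hv₁ hva b).2) hv)
    · have hve : v ≠ e := by
        rintro rfl
        obtain ⟨-, -, ⟨s, hs⟩, -⟩ := hv
        exact h.not_solidChild s hs
      exact Or.inr (mem_splitNodes_congr (fun hk => (h.kind_right v hv₂).symm.trans hk)
        (h.solid_right v hv₂).1 (fun b => (h.solidChild_right hv₂ hve b).2)
        (fun b => (h.dashedChild_right hv₂ hve b).2) hv)
  · rintro (hv | hv)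
    · have hv₁ := splitNodes_mem_nodes hv
      have hva := h.splitNodes_ne_left hv
      exact mem_splitNodes_congr (fun hk => (h.kind_left v hv₁ (h.mem_left v hv₁ hva)).trans hk)
        (h.own_left v hv₁ hva hv.1).2 (fun b => (h.solidChild_left hv₁ hva b).1)
        (fun b => (h.dashedChild_left hv₁ hva b).1) hv
    · have hv₂ := splitNodes_mem_nodes hv
      have hve := splitNodes_ne_right hex hv
      exact mem_splitNodes_congr (fun hk => (h.kind_right v hv₂).trans hk)
        (h.solid_right v hv₂).2 (fun b => (h.solidChild_right hv₂ hve b).1)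
        (fun b => (h.dashedChild_right hv₂ hve b).1) hv

lemma vertex_eq (hG : IsUnionAt G G₁ G₂ x) (h₁ : IsStrictBC G₁ T₁) (h₂ : IsStrictBC G₂ T₂)
    {c d : ν} (hc : c ∈ T₁.nodes) (hd : d ∈ T₂.nodes) {y : α} (hyc : y ∈ V(T₁.skel c))
    (hyd : y ∈ V(T₂.skel d)) : y = x := by
  have hy : y ∈ V(G₁) ∩ V(G₂) :=
    ⟨(h₁.skel_le c hc).vertexSet_mono hyc, (h₂.skel_le d hd).vertexSet_mono hyd⟩
  rw [hG.inter_vertices] at hy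
  exact hy

lemma weight_left (h : Joined T₁ T₂ a e T) (hU : T.UniqueC) (hG : IsUnionAt G G₁ G₂ x)
    (h₁ : IsStrictBC G₁ T₁) (h₂ : IsStrictBC G₂ T₂) (hxa : x ∈ V(T₁.skel a))
    (hxe : x ∈ V(T₂.skel e)) {c : ν} (hc : c ∈ T₁.nodes) (hca : c ≠ a) :
    T.weight c = T₁.weight c := by
  have hcT := h.mem_left c hc hca
  refine weight_eq_of_part hU h₁ hc hcT (h.kind_left c hc hcT) (h.skel_left c hc hcT) h.a_mem hca
    (fun d hd hkd y hyd hyc => ?_) (fun d hd hkd y hyd => ?_)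
  · rcases h.mem_cases d hd with hd₁ | hd₂
    · exact Or.inl ⟨d, hd₁, by rwa [← h.kind_left d hd₁ hd], by rwa [← h.skel_left d hd₁ hd]⟩
    · rw [h.skel_right d hd₂] at hyd
      rw [vertex_eq hG h₁ h₂ hc hd₂ hyc hyd]
      exact Or.inr hxa
  · by_cases hdT : d ∈ T.nodes
    · exact ⟨d, hdT, (h.kind_left d hd hdT).trans hkd, by rwa [h.skel_left d hd hdT]⟩
    · have hda : d = a := by
        by_contra hne
        exact hdT (h.mem_left d hd hne)
      subst hda
      obtain ⟨hk, hke⟩ := h.mem_a.resolve_left hdT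
      obtain ⟨z, hz, -⟩ := h₁.skel_C d hd hk
      rw [hz, Set.mem_singleton_iff] at hxa hyd
      refine ⟨e, h.mem_right e h.mem_e, (h.kind_right e h.mem_e).trans hke, ?_⟩
      rw [h.skel_right e h.mem_e, hyd, ← hxa]
      exact hxe

lemma weight_right (h : Joined T₁ T₂ a e T) (hU : T.UniqueC) (hG : IsUnionAt G G₁ G₂ x)
    (h₁ : IsStrictBC G₁ T₁) (h₂ : IsStrictBC G₂ T₂)
    (hxe : x ∈ V(T₂.skel e)) {c : ν} (hc : c ∈ T₂.nodes) (hce : c ≠ e) :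
    T.weight c = T₂.weight c := by
  refine weight_eq_of_part hU h₂ hc (h.mem_right c hc) (h.kind_right c hc) (h.skel_right c hc)
    h.mem_e hce (fun d hd hkd y hyd hyc => ?_) (fun d hd hkd y hyd => ⟨d, h.mem_right d hd,
      (h.kind_right d hd).trans hkd, by rwa [h.skel_right d hd]⟩)
  rcases h.mem_cases d hd with hd₁ | hd₂
  · rw [h.skel_left d hd₁ hd] at hyd
    rw [vertex_eq hG h₁ h₂ hd₁ hc hyd hyc]
    exact Or.inr hxe
  · exact Or.inl ⟨d, hd₂, by rwa [← h.kind_right d hd₂], by rwa [← h.skel_right d hd₂]⟩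

/-- The inner edges of the split tree of the joined tree keep the status they have in the split
trees of the two parts. -/
lemma innerHeavy (h : Joined T₁ T₂ a e T) (hU : T.UniqueC) (hG : IsUnionAt G G₁ G₂ x)
    (h₁ : IsStrictBC G₁ T₁) (h₂ : IsStrictBC G₂ T₂) (hxa : x ∈ V(T₁.skel a))
    (hxe : x ∈ V(T₂.skel e)) (hex : T₂.IsExposed e) (hI₁ : InnerHeavy T₁ T₁.splitNodes R₁)
    (hI₂ : InnerHeavy T₂ T₂.splitNodes R₂)
    (hR₁ : ∀ v ∈ T₁.splitNodes, ∀ b, T₁.DashedChild b v → (b ∈ R.solid ↔ b ∈ R₁.solid))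
    (hR₂ : ∀ v ∈ T₂.splitNodes, ∀ b, T₂.DashedChild b v → (b ∈ R.solid ↔ b ∈ R₂.solid)) :
    InnerHeavy T T.splitNodes R := by
  rw [h.splitNodes_eq hex]
  rintro v (hv | hv) b hb
  · have hv₁ := splitNodes_mem_nodes hv
    have hva := h.splitNodes_ne_left hv
    have hb₁ := (h.dashedChild_left hv₁ hva b).2 hb
    have hD : ∀ w ∈ {w | w ∈ T₁.nodes ∧ w ≠ a}, ∀ u, T₁.parent u = some w →
        u ∈ {w | w ∈ T₁.nodes ∧ w ≠ a} := fun w _ u hu =>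
      ⟨mem_child hu, fun hua => ne_root hu (hua.trans h.root_left.symm)⟩
    have hch : ∀ w ∈ {w | w ∈ T₁.nodes ∧ w ≠ a}, ∀ u,
        T₁.parent u = some w ↔ T.parent u = some w := fun w hw => h.parent_left w hw.1 hw.2
    have hw : ∀ w ∈ {w | w ∈ T₁.nodes ∧ w ≠ a}, T₁.weight w = T.weight w := fun w hw =>
      (h.weight_left hU hG h₁ h₂ hxa hxe hw.1 hw.2).symm
    have hdD : ∀ b, T₁.DashedChild b v → b ∈ {w | w ∈ T₁.nodes ∧ w ≠ a} := fun b hb =>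
      hD v ⟨hv₁, hva⟩ b hb.1
    rw [hR₁ v hv b hb₁, hI₁ v hv b hb₁,
      subtreeWeight_congr hch hD hw (hdD b hb₁) (mem_child hb₁.1) (mem_child hb.1),
      branchWeight_congr hch hD hw (hw v ⟨hv₁, hva⟩) hv₁ (h.mem_left v hv₁ hva)
        (h.dashedChild_left hv₁ hva) hdD]
  · have hv₂ := splitNodes_mem_nodes hv
    have hve := splitNodes_ne_right hex hv
    have hb₂ := (h.dashedChild_right hv₂ hve b).2 hb
    have hne : ∀ w, ¬ T₂.Below e w → w ≠ e := by
      rintro w hw rfl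
      exact hw Relation.ReflTransGen.refl
    have hD : ∀ w ∈ {w | w ∈ T₂.nodes ∧ ¬ T₂.Below e w}, ∀ u, T₂.parent u = some w →
        u ∈ {w | w ∈ T₂.nodes ∧ ¬ T₂.Below e w} := fun w hw u hu =>
      ⟨mem_child hu, fun heu => hw.2 (Relation.ReflTransGen.tail heu hu)⟩
    have hch : ∀ w ∈ {w | w ∈ T₂.nodes ∧ ¬ T₂.Below e w}, ∀ u,
        T₂.parent u = some w ↔ T.parent u = some w := fun w hw =>
      h.parent_right w hw.1 (hne w hw.2)
    have hw' : ∀ w ∈ T₂.nodes, w ≠ e → T₂.weight w = T.weight w := fun w hw hwe =>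
      (h.weight_right hU hG h₁ h₂ hxe hw hwe).symm
    have hw : ∀ w ∈ {w | w ∈ T₂.nodes ∧ ¬ T₂.Below e w}, T₂.weight w = T.weight w := fun w hw =>
      hw' w hw.1 (hne w hw.2)
    have hdD : ∀ b, T₂.DashedChild b v → b ∈ {w | w ∈ T₂.nodes ∧ ¬ T₂.Below e w} := fun b hb =>
      ⟨mem_child hb.1, fun heb => hb.2 ((hex.2 b v hb.1).2 (Or.inl heb))⟩
    rw [hR₂ v hv b hb₂, hI₂ v hv b hb₂,
      subtreeWeight_congr hch hD hw (hdD b hb₂) (mem_child hb₂.1) (mem_child hb.1),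
      branchWeight_congr hch hD hw (hw' v hv₂ hve) hv₂ (h.mem_right v hv₂)
        (h.dashedChild_right hv₂ hve) hdD]

end Joined

namespace IsLinked

variable {T₁ T₂ L : PDTree ν α β} {a e : ν}

lemma notMem_right (h : IsLinked T₁ T₂ a e L) {b : ν} (hb : b ∈ T₁.nodes) : b ∉ T₂.nodes :=
  Finset.disjoint_left.1 h.disjoint hb

lemma a_mem (h : IsLinked T₁ T₂ a e L) : a ∈ T₁.nodes := h.root_left ▸ T₁.root_mem

lemma parent_left_iff (h : IsLinked T₁ T₂ a e L) {u w : ν} (hw : w ∈ T₁.nodes) :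
    T₁.parent u = some w ↔ L.parent u = some w := by
  constructor
  · intro hp
    rw [h.parent_left u (mem_child hp) fun hua => ne_root hp (hua.trans h.root_left.symm), hp]
  · intro hp
    rcases (h.mem_nodes u).1 (mem_child hp) with hu | hu
    · rw [← h.parent_left u hu, hp]
      rintro rfl
      rw [h.parent_a] at hp
      cases hp
      exact h.notMem_right hw h.mem_right
    · rw [h.parent_right u hu] at hp
      exact absurd (mem_parent hp) (h.notMem_right hw)

lemma parent_right_iff (h : IsLinked T₁ T₂ a e L) {u w : ν} (hw : w ∈ T₂.nodes) :
    L.parent u = some w ↔ T₂.parent u = some w ∨ (u = a ∧ w = e) := by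
  constructor
  · intro hp
    rcases (h.mem_nodes u).1 (mem_child hp) with hu | hu
    · by_cases hua : u = a
      · subst hua
        rw [h.parent_a] at hp
        cases hp
        exact Or.inr ⟨rfl, rfl⟩
      · rw [h.parent_left u hu hua] at hp
        exact absurd hw (h.notMem_right (mem_parent hp))
    · rw [h.parent_right u hu] at hp
      exact Or.inl hp
  · rintro (hp | ⟨rfl, rfl⟩)
    · rw [h.parent_right u (mem_child hp), hp]
    · exact h.parent_a

lemma solid_left_iff (h : IsLinked T₁ T₂ a e L) {b : ν} (hb : b ∈ T₁.nodes) :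
    b ∈ L.solid ↔ b ∈ T₁.solid := by
  rw [h.solid_eq]
  exact ⟨fun hs => hs.resolve_right fun hs => h.notMem_right hb (mem_of_solid hs), Or.inl⟩

lemma solid_right_iff (h : IsLinked T₁ T₂ a e L) {b : ν} (hb : b ∈ T₂.nodes) :
    b ∈ L.solid ↔ b ∈ T₂.solid := by
  rw [h.solid_eq]
  exact ⟨fun hs => hs.resolve_left fun hs => h.notMem_right (mem_of_solid hs) hb, Or.inr⟩

lemma not_solid_a (h : IsLinked T₁ T₂ a e L) : a ∉ L.solid := by
  rw [h.solid_left_iff h.a_mem]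
  intro hs
  obtain ⟨p, hp⟩ := T₁.parent_of_solid a hs
  exact ne_root hp h.root_left.symm

lemma primary (h : IsLinked T₁ T₂ a e L) (hA₁ : T₁.Alternating) (hA₂ : T₂.Alternating) {b : ν}
    (hb : b ∈ L.nodes) (hba : b ≠ a) : L.Primary b := by
  refine ⟨hb, ?_⟩
  rcases (h.mem_nodes b).1 hb with hb | hb
  · obtain ⟨p, hp⟩ := exists_parent hb fun hr => hba (hr.trans h.root_left)
    refine Or.inr ((hA₁ b p hp).imp (fun hk => (h.kind_left b hb).trans hk) fun hk => ⟨p, ?_, ?_⟩)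
    · exact (h.parent_left_iff (mem_parent hp)).1 hp
    · exact (h.kind_left p (mem_parent hp)).trans hk
  · by_cases hr : b = T₂.root
    · exact Or.inl (hr.trans h.root_eq.symm)
    · obtain ⟨p, hp⟩ := exists_parent hb hr
      refine Or.inr ((hA₂ b p hp).imp (fun hk => (h.kind_right b hb).trans hk) fun hk =>
        ⟨p, ?_, ?_⟩)
      · exact (h.parent_right_iff (mem_parent hp)).2 (Or.inl hp)
      · exact (h.kind_right p (mem_parent hp)).trans hk

lemma primary_a_iff (h : IsLinked T₁ T₂ a e L) :
    L.Primary a ↔ ¬ (L.kind a = Kind.C ∧ L.kind e = Kind.C) := by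
  constructor
  · rintro ⟨-, hr | hk | ⟨p, hp, hk⟩⟩ ⟨hka, hke⟩
    · exact ne_root h.parent_a hr
    · exact not_B_of_C hka hk
    · rw [h.parent_a] at hp
      cases hp
      exact not_B_of_C hke hk
  · intro hn
    refine ⟨mem_child h.parent_a, Or.inr ?_⟩
    by_cases hk : L.kind a = Kind.B
    · exact Or.inl hk
    · refine Or.inr ⟨e, h.parent_a, ?_⟩
      by_contra hke
      exact hn ⟨C_of_not_B hk, C_of_not_B hke⟩

end IsLinked

/-- The contraction of a linked tree: either nothing is contracted, or `a` and `e` are both `C` nodes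
and the children of `a` have become children of `e`. -/
lemma IsContraction.parent_cases {T₁ T₂ L : PDTree ν α β} {a e : ν} (hc : IsContraction T L)
    (h : IsLinked T₁ T₂ a e L) (hA₁ : T₁.Alternating) (hA₂ : T₂.Alternating) :
    (a ∈ T.nodes ∧ ∀ u, T.parent u = L.parent u) ∨
      ((a ∉ T.nodes ∧ L.kind a = Kind.C ∧ L.kind e = Kind.C) ∧
        ∀ u, (T.parent u = L.parent u ∧ L.parent u ≠ some a ∧ u ≠ a) ∨
          (u = a ∧ T.parent u = none) ∨ (L.parent u = some a ∧ T.parent u = some e)) := by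
  have hprim : ∀ b ∈ L.nodes, b ≠ a → L.Primary b := fun b hb => h.primary hA₁ hA₂ hb
  have hea : e ≠ a := (parent_ne h.parent_a).symm
  by_cases ha : L.Primary a
  · have hall : ∀ b ∈ L.nodes, L.Primary b := fun b hb => by
      by_cases hba : b = a
      · exact hba ▸ ha
      · exact hprim b hb hba
    refine Or.inl ⟨(hc.mem_nodes a).2 ha, fun u => Option.ext fun p => ?_⟩
    rw [hc.parent_iff]
    constructor
    · rintro ⟨-, -, q, hq, hqp⟩
      rcases Relation.ReflTransGen.cases_head hqp with rfl | ⟨d, ⟨hs, -⟩, -⟩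
      · exact hq
      · exact absurd (hall q hs.1) hs.2
    · intro hp
      exact ⟨hall u (mem_child hp), hall p (mem_parent hp), p, hp, Relation.ReflTransGen.refl⟩
  · have haT : a ∉ T.nodes := fun h' => ha ((hc.mem_nodes a).1 h')
    refine Or.inr ⟨⟨haT, not_not.1 fun hn => ha (h.primary_a_iff.2 hn)⟩, fun u => ?_⟩
    by_cases hua : u = a
    · subst hua
      exact Or.inr (Or.inl ⟨rfl, parent_eq_none haT⟩)
    by_cases hpa : L.parent u = some a
    · refine Or.inr (Or.inr ⟨hpa, (hc.parent_iff u e).2 ⟨hprim u (mem_child hpa) hua,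
        hprim e (mem_parent h.parent_a) hea, a, hpa, Relation.ReflTransGen.single
          ⟨⟨mem_parent hpa, ha⟩, h.parent_a⟩⟩⟩)
    · refine Or.inl ⟨Option.ext fun p => ?_, hpa, hua⟩
      rw [hc.parent_iff]
      constructor
      · rintro ⟨-, -, q, hq, hqp⟩
        rcases Relation.ReflTransGen.cases_head hqp with rfl | ⟨d, ⟨hs, -⟩, -⟩
        · exact hq
        · have hqa : q ≠ a := by
            rintro rfl
            exact hpa hq
          exact absurd (hprim q hs.1 hqa) hs.2
      · intro hp
        have hpne : p ≠ a := by
          rintro rfl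
          exact hpa hp
        exact ⟨hprim u (mem_child hp) hua, hprim p (mem_parent hp) hpne, p, hp,
          Relation.ReflTransGen.refl⟩

/-- The tree resulting from a link with the solid edges inherited from the two linked trees. -/
lemma IsContraction.exists_joined {T₁ T₂ L : PDTree ν α β} {a e : ν} (hc : IsContraction T L)
    (h : IsLinked T₁ T₂ a e L) (hA₁ : T₁.Alternating) (hA₂ : T₂.Alternating)
    (hex : T₂.IsExposed e) :
    ∃ T₀, SameTree T₀ T ∧ Joined T₁ T₂ a e T₀ ∧
      ∀ b, b ∈ T₀.solid ↔ b ∈ L.solid ∧ T.parent b = L.parent b := by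
  have hcases := hc.parent_cases h hA₁ hA₂
  have hea : e ≠ a := (parent_ne h.parent_a).symm
  have hcase : ∀ u, T.parent u = L.parent u ∨ (u = a ∧ T.parent u = none) ∨
      ((L.kind a = Kind.C) ∧ L.parent u = some a ∧ T.parent u = some e) := by
    intro u
    rcases hcases with ⟨-, hu⟩ | ⟨⟨-, hk, -⟩, hu⟩
    · exact Or.inl (hu u)
    · exact (hu u).imp And.left (Or.imp_right fun h => ⟨hk, h⟩)
  let T₀ : PDTree ν α β := T.withSolid {b | b ∈ L.solid ∧ T.parent b = L.parent b}
    (fun b hb => by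
      obtain ⟨p, hp⟩ := L.parent_of_solid b hb.1
      exact ⟨p, hb.2.trans hp⟩)
    (fun b hb c hc hbc => L.solid_unique b hb.1 c hc.1 (hb.2.symm.trans (hbc.trans hc.2)))
  have hT₀ : SameTree T₀ T := ⟨rfl, rfl, rfl, fun _ _ => rfl, fun _ _ => rfl⟩
  have hTL : ∀ b ∈ T.nodes, b ∈ L.nodes := fun b hb => ((hc.mem_nodes b).1 hb).1
  have hmem : ∀ b ∈ L.nodes, b ≠ a → b ∈ T.nodes := fun b hb hba =>
    (hc.mem_nodes b).2 (h.primary hA₁ hA₂ hb hba)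
  have hL₁ : ∀ b ∈ T₁.nodes, b ∈ L.nodes := fun b hb => (h.mem_nodes b).2 (Or.inl hb)
  have hL₂ : ∀ b ∈ T₂.nodes, b ∈ L.nodes := fun b hb => (h.mem_nodes b).2 (Or.inr hb)
  have hne₂ : ∀ b ∈ T₂.nodes, b ≠ a := by
    rintro b hb rfl
    exact h.notMem_right h.a_mem hb
  have hne₁ : ∀ b ∈ T₁.nodes, b ≠ e := by
    rintro b hb rfl
    exact h.notMem_right hb h.mem_right
  have hright : ∀ v ∈ T₂.nodes, T.parent v = L.parent v := by
    intro v hv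
    rcases hcase v with h' | ⟨hva, -⟩ | ⟨-, hp, -⟩
    · exact h'
    · exact absurd hva (hne₂ v hv)
    · rw [h.parent_right v hv] at hp
      exact absurd rfl (hne₂ a (mem_parent hp))
  have hleft : ∀ w ∈ T₁.nodes, w ≠ a → ∀ u, T₁.parent u = some w ↔ T.parent u = some w := by
    intro w hw hwa u
    rw [h.parent_left_iff hw]
    rcases hcase u with h' | ⟨rfl, h'⟩ | ⟨-, hp, h'⟩
    · rw [h']
    · rw [h', h.parent_a]
      exact iff_of_false (fun he => hne₁ w hw (Option.some_injective _ he).symm) (by simp)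
    · rw [h', hp]
      exact iff_of_false (fun he => hwa (Option.some_injective _ he).symm)
        fun he => hne₁ w hw (Option.some_injective _ he).symm
  refine ⟨T₀, hT₀, ⟨fun b hb => h.notMem_right hb, h.root_left, h.mem_right,
    fun b hb => (h.mem_nodes b).1 (hTL b hb), fun b hb => hmem b (hL₁ b hb),
    fun b hb => hmem b (hL₂ b hb) (hne₂ b hb), ?_,
    fun b hb hbT => (hc.kind_eq b hbT).trans (h.kind_left b hb), fun b hb => ?_,
    fun b hb hbT => (hc.skel_eq b hbT).trans (h.skel_left b hb), fun b hb => ?_, hleft,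
    fun w hw hwe u => ?_, fun w hw hwa u hu => ?_, fun v hv hva hk => ?_, fun v hv => ?_,
    fun hs => h.not_solid_a hs.1, ?_⟩, fun b => Iff.rfl⟩
  · rcases hcases with ⟨ha, -⟩ | ⟨⟨-, hka, hke⟩, -⟩
    · exact Or.inl ha
    · exact Or.inr ⟨(h.kind_left a h.a_mem).symm.trans hka,
        (h.kind_right e h.mem_right).symm.trans hke⟩
  · exact (hc.kind_eq b (hmem b (hL₂ b hb) (hne₂ b hb))).trans (h.kind_right b hb)
  · exact (hc.skel_eq b (hmem b (hL₂ b hb) (hne₂ b hb))).trans (h.skel_right b hb)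
  · have h1 : L.parent u = some w ↔ T₂.parent u = some w := by
      rw [h.parent_right_iff hw, or_iff_left]
      exact fun h' => hwe h'.2
    rw [← h1]
    change L.parent u = some w ↔ T.parent u = some w
    rcases hcase u with h' | ⟨rfl, h'⟩ | ⟨-, hp, h'⟩
    · rw [h']
    · rw [h', h.parent_a]
      exact iff_of_false (fun he => hwe (Option.some_injective _ he).symm) (by simp)
    · rw [h', hp]
      exact iff_of_false (fun he => hne₂ w hw (Option.some_injective _ he).symm)
        fun he => hwe (Option.some_injective _ he).symm
  · rw [← h.solid_left_iff (mem_child hu)]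
    exact and_iff_left (((hleft w hw hwa u).1 hu).trans ((h.parent_left_iff hw).1 hu).symm)
  · rw [← h.solid_left_iff hv]
    refine and_iff_left ?_
    rcases hcase v with h' | ⟨h', -⟩ | ⟨hka, hp, -⟩
    · exact h'
    · exact absurd h' hva
    · rw [← h.parent_left_iff h.a_mem] at hp
      rw [h.kind_left a h.a_mem] at hka
      rcases hA₁ v a hp with hB | hB
      · exact absurd hB (not_B_of_C hk)
      · exact absurd hB (not_B_of_C hka)
  · rw [← h.solid_right_iff hv]
    exact and_iff_left (hright v hv)
  · rintro s ⟨hp, hs⟩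
    change T.parent s = some e at hp
    rw [hs.2, h.parent_right_iff h.mem_right] at hp
    rcases hp with hp | ⟨rfl, -⟩
    · exact hex.not_solidChild ⟨hp, (h.solid_right_iff (mem_child hp)).1 hs.1⟩
    · exact h.not_solid_a hs.1

/-- The edges of the joined tree that change are counted as changed in the link. The child edges of
a contracted node that become dashed in the joined tree remain dashed, since they are incident
to the exposed node. -/
lemma Joined.changed_subset {T₀ T₁ T₂ L : PDTree ν α β} {a e : ν} (hj : Joined T₁ T₂ a e T₀)
    (hs : SameTree T₀ T) (h : IsLinked T₁ T₂ a e L)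
    (hsol : ∀ b, b ∈ T₀.solid ↔ b ∈ L.solid ∧ T.parent b = L.parent b) (hex : T.IsExposed e)
    (hcase : a ∈ T.nodes ∧ (∀ u, T.parent u = L.parent u) ∨
      a ∉ T.nodes ∧ ∀ u, L.parent u = some a → T.parent u = some e) :
    changed T₀ T ⊆ changedLink T₁ T₂ e T := by
  classical
  have hf : ∀ b ∈ T.nodes, (if b ∈ T.nodes then b else e) = b := fun b hb => if_pos hb
  have sub₁ : T₀.solidEdges ⊆
      Sym2.map (fun b => if b ∈ T.nodes then b else e) '' T₁.solidEdges ∪ T₂.solidEdges := by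
    rintro f ⟨c, p, ⟨hcp, hcs⟩, rfl⟩
    obtain ⟨hcL, hpar⟩ := (hsol c).1 hcs
    have hcp' : T.parent c = some p := by rwa [hs.parent_eq]
    have hcL' : L.parent c = some p := hpar.symm.trans hcp'
    rw [h.solid_eq] at hcL
    rcases hcL with hc₁ | hc₂
    · refine Or.inl ⟨s(c, p), ⟨c, p, ⟨?_, hc₁⟩, rfl⟩, ?_⟩
      · obtain ⟨q, hq⟩ := T₁.parent_of_solid c hc₁
        have := (h.parent_left_iff (mem_parent hq)).1 hq
        rw [hcL'] at this
        rw [hq, this]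
      · rw [Sym2.map_mk]
        simp only [if_pos (mem_child hcp'), if_pos (mem_parent hcp')]
    · refine Or.inr ⟨c, p, ⟨?_, hc₂⟩, rfl⟩
      rw [← h.parent_right c (mem_of_solid hc₂), hcL']
  have sub₂ : ∀ f ∈ Sym2.map (fun b => if b ∈ T.nodes then b else e) '' T₁.solidEdges ∪
      T₂.solidEdges, f ∈ T.solidEdges → f ∈ T₀.solidEdges := by
    rintro f (⟨-, ⟨c, p, ⟨hcp, hcs⟩, rfl⟩, rfl⟩ | ⟨c, p, ⟨hcp, hcs⟩, rfl⟩) hfT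
    · have hc₁ := mem_child hcp
      have hp₁ := mem_parent hcp
      have hca : c ≠ a := fun hca => ne_root hcp (hca.trans h.root_left.symm)
      have hcL := (h.parent_left_iff hp₁).1 hcp
      have hcT : c ∈ T.nodes := hs.nodes_eq ▸ hj.mem_left c hc₁ hca
      rw [Sym2.map_mk] at hfT ⊢
      have hkeep : p ∈ T.nodes → T.parent c = some p → s(c, p) ∈ T₀.solidEdges := by
        intro _ hp
        refine ⟨c, p, ⟨by rwa [← hs.parent_eq], (hsol c).2 ⟨?_, hp.trans hcL.symm⟩⟩, rfl⟩
        exact (h.solid_left_iff hc₁).2 hcs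
      by_cases hpT : p ∈ T.nodes
      · simp only [if_pos hcT, if_pos hpT]
        refine hkeep hpT ?_
        by_cases hpa : p = a
        · rcases hcase with ⟨-, hu⟩ | ⟨ha, -⟩
          · exact (hu c).trans hcL
          · exact absurd (hpa ▸ hpT) ha
        · rw [hs.parent_eq]
          exact (hj.parent_left p hp₁ hpa c).1 hcp
      · have hpa : p = a := by
          by_contra hpa
          exact hpT (hs.nodes_eq ▸ hj.mem_left p hp₁ hpa)
        subst hpa
        have hce := (hcase.resolve_left fun h' => hpT h'.1).2 c hcL
        simp only [if_pos hcT, if_neg hpT] at hfT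
        exact absurd ⟨hce, (mk_mem_solidEdges hce).1 hfT⟩ hex.not_solidChild
    · have hc₂ := mem_child hcp
      have hsolc := (hj.solid_right c hc₂).2 hcs
      have hpar := ((hsol c).1 hsolc).2
      refine ⟨c, p, ⟨?_, hsolc⟩, rfl⟩
      rw [← hs.parent_eq, hpar, h.parent_right c hc₂, hcp]
  rintro f (⟨h1, h2⟩ | ⟨h1, h2⟩)
  · exact Or.inl ⟨sub₁ h1, h2⟩
  · exact Or.inr ⟨h1, fun h' => h2 (sub₂ f h' h1)⟩

lemma finite_changedLink {T₁ T₂ : PDTree ν α β} {e : ν} : (changedLink T₁ T₂ e T).Finite := by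
  unfold changedLink
  exact Set.Finite.symmDiff (Set.Finite.union (Set.Finite.image _ finite_solidEdges)
    finite_solidEdges) finite_solidEdges

/-- The split trees of two trees can be linked like the trees themselves. -/
lemma IsLinked.exists_splitting {T₁ T₂ R₁ R₂ L : PDTree ν α β} {a e : ν} {S₁ S₂ : Set ν}
    (h : IsLinked T₁ T₂ a e L) (h₁ : Splitting T₁ S₁ n R₁) (h₂ : Splitting T₂ S₂ n R₂)
    (hdis : Disjoint R₁.nodes R₂.nodes) (ha : a ∉ S₁) (he : e ∉ S₂) :
    ∃ R, IsLinked R₁ R₂ a e R ∧ Splitting L (S₁ ∪ S₂) n R ∧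
      (∀ v ∈ S₁, ∀ b, T₁.DashedChild b v → (b ∈ R.solid ↔ b ∈ R₁.solid)) ∧
      ∀ v ∈ S₂, ∀ b, T₂.DashedChild b v → (b ∈ R.solid ↔ b ∈ R₂.solid) := by
  rw [Finset.disjoint_left] at hdis
  have hn₁ : ∀ v ∈ S₁, v ∉ S₂ := fun v hv hv' => h.notMem_right (h₁.mem_of v hv) (h₂.mem_of v hv')
  have hd₁ : ∀ v ∈ S₁, ∀ b, L.DashedChild b v ↔ T₁.DashedChild b v := fun v hv b => by
    unfold DashedChild
    rw [← h.parent_left_iff (h₁.mem_of v hv)]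
    exact and_congr_right fun hp => not_congr (h.solid_left_iff (mem_child hp))
  have hd₂ : ∀ v ∈ S₂, ∀ b, L.DashedChild b v ↔ T₂.DashedChild b v := fun v hv b => by
    have hve : v ≠ e := by
      rintro rfl
      exact he hv
    unfold DashedChild
    rw [h.parent_right_iff (h₂.mem_of v hv), or_iff_left fun h' => hve h'.2]
    exact and_congr_right fun hp => not_congr (h.solid_right_iff (mem_child hp))
  have hH₁ : ∀ b ∈ T₁.nodes, (b ∈ R₁.solid ∪ R₂.solid ↔ b ∈ R₁.solid) := fun b hb =>
    ⟨fun hs => hs.resolve_right fun hs => hdis (h₁.mem_old hb) (mem_of_solid hs), Or.inl⟩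
  have hH₂ : ∀ b ∈ T₂.nodes, (b ∈ R₁.solid ∪ R₂.solid ↔ b ∈ R₂.solid) := fun b hb =>
    ⟨fun hs => hs.resolve_left fun hs => hdis (mem_of_solid hs) (h₂.mem_old hb), Or.inr⟩
  obtain ⟨R, hR, hRs⟩ := PDTree.exists_splitting (T := L) (S := S₁ ∪ S₂) (n := n)
    (by
      rintro v (hv | hv)
      · exact (h.mem_nodes v).2 (Or.inl (h₁.mem_of v hv))
      · exact (h.mem_nodes v).2 (Or.inr (h₂.mem_of v hv)))
    (by
      rintro v (hv | hv)
      · exact (h.kind_left v (h₁.mem_of v hv)).trans (h₁.kind_of v hv)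
      · exact (h.kind_right v (h₂.mem_of v hv)).trans (h₂.kind_of v hv))
    (by
      rintro v (hv | hv) w (hw | hw) hvw
      · exact h₁.inj hv hw hvw
      · exact absurd (h₂.mem_new hw) (hvw ▸ hdis (h₁.mem_new hv))
      · exact absurd (h₂.mem_new hv) (hvw ▸ hdis (h₁.mem_new hw))
      · exact h₂.inj hv hw hvw)
    (by
      rintro v (hv | hv) hm <;> rcases (h.mem_nodes _).1 hm with hm | hm
      · exact h₁.fresh v hv hm
      · exact hdis (h₁.mem_new hv) (h₂.mem_old hm)
      · exact hdis (h₁.mem_old hm) (h₂.mem_new hv)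
      · exact h₂.fresh v hv hm)
    (R₁.solid ∪ R₂.solid)
    (by
      rintro v (hv | hv) b c hb hc hbH hcH
      · rw [hd₁ v hv] at hb hc
        refine R₁.solid_unique b ((hH₁ b (mem_child hb.1)).1 hbH) c
          ((hH₁ c (mem_child hc.1)).1 hcH) ?_
        rw [h₁.moved v hv b hb, h₁.moved v hv c hc]
      · rw [hd₂ v hv] at hb hc
        refine R₂.solid_unique b ((hH₂ b (mem_child hb.1)).1 hbH) c
          ((hH₂ c (mem_child hc.1)).1 hcH) ?_
        rw [h₂.moved v hv b hb, h₂.moved v hv c hc])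
  have hi₁ : ∀ v ∈ S₁, ∀ b, T₁.DashedChild b v → (b ∈ R.solid ↔ b ∈ R₁.solid) := fun v hv b hb =>
    (hRs v (Or.inl hv) b ((hd₁ v hv b).2 hb)).trans (hH₁ b (mem_child hb.1))
  have hi₂ : ∀ v ∈ S₂, ∀ b, T₂.DashedChild b v → (b ∈ R.solid ↔ b ∈ R₂.solid) := fun v hv b hb =>
    (hRs v (Or.inr hv) b ((hd₂ v hv b).2 hb)).trans (hH₂ b (mem_child hb.1))
  have heS : e ∉ S₁ ∪ S₂ := by
    rintro (h' | h')
    · exact h.notMem_right (h₁.mem_of e h') h.mem_right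
    · exact he h'
  have hpa := hR.parent_notMem h.parent_a heS
  have haR : a ∉ R.solid := fun hs => h.not_solid_a (hpa.2.1 hs)
  have haR₁ : R₁.root = a := h₁.root_eq.trans h.root_left
  have haR₁s : a ∉ R₁.solid := fun hs => by
    obtain ⟨p, hp⟩ := R₁.parent_of_solid a hs
    exact ne_root hp haR₁.symm
  have key₁ : ∀ b ∈ R₁.nodes, b ≠ a → R.parent b = R₁.parent b ∧ (b ∈ R.solid ↔ b ∈ R₁.solid) := by
    intro b hb hba
    rcases (h₁.mem_nodes b).1 hb with hb | ⟨v, hv, rfl⟩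
    · exact h₁.agree hR hb ((h.mem_nodes b).2 (Or.inl hb)) (h.parent_left b hb hba)
        (h.solid_left_iff hb) (fun v hp => ⟨fun hv => hv.resolve_right fun hv =>
          h.notMem_right (mem_parent hp) (h₂.mem_of v hv), Or.inl⟩) fun v hv hd => hi₁ v hv b hd
    · exact ⟨(hR.parent_new v (Or.inl hv)).trans (h₁.parent_new v hv).symm,
        iff_of_false (hR.dashed_new v (Or.inl hv)) (h₁.dashed_new v hv)⟩
  have key₂ : ∀ b ∈ R₂.nodes, R.parent b = R₂.parent b ∧ (b ∈ R.solid ↔ b ∈ R₂.solid) := by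
    intro b hb
    rcases (h₂.mem_nodes b).1 hb with hb | ⟨v, hv, rfl⟩
    · exact h₂.agree hR hb ((h.mem_nodes b).2 (Or.inr hb)) (h.parent_right b hb)
        (h.solid_right_iff hb) (fun v hp => ⟨fun hv => hv.resolve_left fun hv =>
          h.notMem_right (h₁.mem_of v hv) (mem_parent hp), Or.inr⟩) fun v hv hd => hi₂ v hv b hd
    · exact ⟨(hR.parent_new v (Or.inr hv)).trans (h₂.parent_new v hv).symm,
        iff_of_false (hR.dashed_new v (Or.inr hv)) (h₂.dashed_new v hv)⟩
  have hmem : ∀ b, b ∈ R.nodes ↔ b ∈ R₁.nodes ∨ b ∈ R₂.nodes := by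
    intro b
    rw [hR.mem_nodes, h₁.mem_nodes, h₂.mem_nodes, h.mem_nodes]
    constructor
    · rintro ((hb | hb) | ⟨v, hv | hv, rfl⟩)
      · exact Or.inl (Or.inl hb)
      · exact Or.inr (Or.inl hb)
      · exact Or.inl (Or.inr ⟨v, hv, rfl⟩)
      · exact Or.inr (Or.inr ⟨v, hv, rfl⟩)
    · rintro ((hb | ⟨v, hv, rfl⟩) | (hb | ⟨v, hv, rfl⟩))
      · exact Or.inl (Or.inl hb)
      · exact Or.inr ⟨v, Or.inl hv, rfl⟩
      · exact Or.inl (Or.inr hb)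
      · exact Or.inr ⟨v, Or.inr hv, rfl⟩
  refine ⟨R, ⟨Finset.disjoint_left.2 hdis, haR₁, h₂.mem_old h.mem_right, hmem,
    (hR.root_eq.trans h.root_eq).trans h₂.root_eq.symm, hpa.1, fun b hb hba => (key₁ b hb hba).1,
    fun b hb => (key₂ b hb).1, fun b hb => ?_, fun b hb => ?_, fun b hb => ?_, fun b hb => ?_, ?_⟩,
    hR, hi₁, hi₂⟩
  · rcases (h₁.mem_nodes b).1 hb with hb | ⟨v, hv, rfl⟩
    · rw [hR.kind_eq b ((h.mem_nodes b).2 (Or.inl hb)), h₁.kind_eq b hb, h.kind_left b hb]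
    · rw [hR.kind_new v (Or.inl hv), h₁.kind_new v hv]
  · rcases (h₂.mem_nodes b).1 hb with hb | ⟨v, hv, rfl⟩
    · rw [hR.kind_eq b ((h.mem_nodes b).2 (Or.inr hb)), h₂.kind_eq b hb, h.kind_right b hb]
    · rw [hR.kind_new v (Or.inr hv), h₂.kind_new v hv]
  · rcases (h₁.mem_nodes b).1 hb with hb | ⟨v, hv, rfl⟩
    · rw [hR.skel_eq b ((h.mem_nodes b).2 (Or.inl hb)), h₁.skel_eq b hb, h.skel_left b hb]
    · rw [hR.skel_new v (Or.inl hv), h₁.skel_new v hv, h.skel_left v (h₁.mem_of v hv)]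
  · rcases (h₂.mem_nodes b).1 hb with hb | ⟨v, hv, rfl⟩
    · rw [hR.skel_eq b ((h.mem_nodes b).2 (Or.inr hb)), h₂.skel_eq b hb, h.skel_right b hb]
    · rw [hR.skel_new v (Or.inr hv), h₂.skel_new v hv, h.skel_right v (h₂.mem_of v hv)]
  · ext b
    constructor
    · intro hs
      rcases (hmem b).1 (mem_of_solid hs) with hb | hb
      · refine Or.inl ((key₁ b hb ?_).2.1 hs)
        rintro rfl
        exact haR hs
      · exact Or.inr ((key₂ b hb).2.1 hs)
    · rintro (hs | hs)
      · refine (key₁ b (mem_of_solid hs) ?_).2.2 hs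
        rintro rfl
        exact haR₁s hs
      · exact (key₂ b (mem_of_solid hs)).2.2 hs

/-- If `a` and `e` are both `C` nodes, then `a` is a secondary child of `e` in the linked split tree,
and a merge contracts it. -/
lemma IsLinked.exists_isMerge {T₀ T₁ T₂ R₁ R₂ L : PDTree ν α β} {a e : ν} {S₁ S₂ : Set ν}
    (h : IsLinked T₁ T₂ a e L) (hA₂ : T₂.Alternating) (hR : Splitting L (S₁ ∪ S₂) n R)
    (hRl : IsLinked R₁ R₂ a e R) (ha : a ∉ S₁ ∪ S₂) (he : e ∉ S₁ ∪ S₂) (hc : IsContraction T L)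
    (hs : SameTree T₀ T)
    (hsol : ∀ b, b ∈ T₀.solid ↔ b ∈ L.solid ∧ T.parent b = L.parent b)
    (hmem : ∀ b, b ∈ T.nodes ↔ b ∈ L.nodes ∧ b ≠ a)
    (hka : L.kind a = Kind.C) (hke : L.kind e = Kind.C)
    (hpar : ∀ u, (T.parent u = L.parent u ∧ L.parent u ≠ some a ∧ u ≠ a) ∨
      (u = a ∧ T.parent u = none) ∨ (L.parent u = some a ∧ T.parent u = some e))
    (hSa : ∀ v ∈ S₁ ∪ S₂, ∀ b, L.DashedChild b v ↔ T₀.DashedChild b v) :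
    ∃ R', IsMerge R e R' ∧ Splitting T₀ (S₁ ∪ S₂) n R' ∧
      ∀ v ∈ S₁ ∪ S₂, ∀ b, L.DashedChild b v → (b ∈ R'.solid ↔ b ∈ R.solid) := by
  have hmem₀ : ∀ b, b ∈ T₀.nodes ↔ b ∈ L.nodes ∧ b ≠ a := fun b => by rw [← hs.nodes_eq, hmem]
  have hkind₀ : ∀ b ∈ T₀.nodes, T₀.kind b = L.kind b := fun b hb => by
    rw [← hs.kind_eq b hb, hc.kind_eq b (hs.nodes_eq ▸ hb)]
  have hskel₀ : ∀ b ∈ T₀.nodes, T₀.skel b = L.skel b := fun b hb => by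
    rw [← hs.skel_eq b hb, hc.skel_eq b (hs.nodes_eq ▸ hb)]
  have hS₀ : ∀ v ∈ S₁ ∪ S₂, v ∈ T₀.nodes := fun v hv =>
    (hmem₀ v).2 ⟨hR.mem_of v hv, fun hva => ha (hva ▸ hv)⟩
  obtain ⟨R', hR', hRs'⟩ := PDTree.exists_splitting (T := T₀) (S := S₁ ∪ S₂) (n := n) hS₀
    (fun v hv => (hkind₀ v (hS₀ v hv)).trans (hR.kind_of v hv)) hR.inj
    (fun v hv hm => hR.fresh v hv ((hmem₀ _).1 hm).1) R.solid
    (by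
      intro v hv b c hb hc hbs hcs
      rw [← hSa v hv] at hb hc
      refine R.solid_unique b hbs c hcs ?_
      rw [hR.moved v hv b hb, hR.moved v hv c hc])
  have hi : ∀ v ∈ S₁ ∪ S₂, ∀ b, L.DashedChild b v → (b ∈ R'.solid ↔ b ∈ R.solid) :=
    fun v hv b hb => hRs' v hv b ((hSa v hv b).1 hb)
  have heL : e ∈ L.nodes := mem_parent h.parent_a
  have haL : a ∈ L.nodes := mem_child h.parent_a
  have hea : e ≠ a := (parent_ne h.parent_a).symm
  have hRe : R.Primary e := by
    refine ⟨hR.mem_old heL, ?_⟩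
    by_cases hr : e = L.root
    · exact Or.inl (hr.trans hR.root_eq.symm)
    · obtain ⟨p, hp⟩ := exists_parent heL hr
      have hp₂ : T₂.parent e = some p := (h.parent_right e h.mem_right).symm.trans hp
      have hpB := (hA₂ e p hp₂).resolve_left fun hB =>
        not_B_of_C hke ((h.kind_right e h.mem_right).trans hB)
      have hpL : L.kind p = Kind.B := (h.kind_right p (mem_parent hp₂)).trans hpB
      refine Or.inr (Or.inr ⟨p, (hR.parent_notMem hp fun hpS => ?_).1, ?_⟩)
      · exact not_B_of_C (hR.kind_of p hpS) hpL
      · rw [hR.kind_eq p (mem_parent hp), hpL]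
  have hRa : R.Secondary a := by
    refine ⟨hR.mem_old haL, ?_⟩
    rintro ⟨-, hr | hk | ⟨p, hp, hk⟩⟩
    · exact ne_root hRl.parent_a hr
    · rw [hR.kind_eq a haL] at hk
      exact not_B_of_C hka hk
    · rw [hRl.parent_a] at hp
      cases hp
      rw [hR.kind_eq e heL] at hk
      exact not_B_of_C hke hk
  have hsec : ∀ b, R.parent b = some e → R.Secondary b → b = a := by
    intro b hb hbs
    rw [hR.parent_iff_of_notMem heL he, h.parent_right_iff h.mem_right] at hb
    rcases hb with hb | ⟨hba, -⟩
    · exfalso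
      have hbB := (hA₂ b e hb).resolve_right fun hB =>
        not_B_of_C hke ((h.kind_right e h.mem_right).trans hB)
      refine hbs.2 ⟨hbs.1, Or.inr (Or.inl ?_)⟩
      rw [hR.kind_eq b ((h.mem_nodes b).2 (Or.inr (mem_child hb))), h.kind_right b (mem_child hb),
        hbB]
    · exact hba
  have hpe := hRl.parent_a
  have haR : a ∉ R.solid := fun hs' =>
    h.not_solid_a ((hR.parent_notMem h.parent_a he).2.1 hs')
  have hmemR : ∀ b, b ∈ R'.nodes ↔ b ∈ R.nodes ∧ b ≠ a := by
    intro b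
    rw [hR.mem_nodes, hR'.mem_nodes, hmem₀]
    constructor
    · rintro (hb | ⟨v, hv, rfl⟩)
      · exact ⟨Or.inl hb.1, hb.2⟩
      · refine ⟨Or.inr ⟨v, hv, rfl⟩, fun hva => hR.fresh v hv (hva ▸ haL)⟩
    · rintro ⟨hb | hb, hba⟩
      · exact Or.inl ⟨hb, hba⟩
      · exact Or.inr hb
  refine ⟨R', ⟨hRe, ⟨a, hpe, hRa⟩, fun b => ?_, ?_, fun b hb => ?_, fun b hb => ?_,
    fun b hb c hbc hce hcs => ?_, fun b hb hno => ?_⟩, hR', hi⟩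
  · rw [hmemR]
    refine and_congr_right fun _ => not_congr ⟨?_, fun h' => hsec b h'.1 h'.2⟩
    rintro rfl
    exact ⟨hpe, hRa⟩
  · rw [hR'.root_eq, ← hs.root_eq, hc.root_eq, hR.root_eq]
  · rcases (hR'.mem_nodes b).1 hb with hb | ⟨v, hv, rfl⟩
    · rw [hR'.kind_eq b hb, hkind₀ b hb, hR.kind_eq b ((hmem₀ b).1 hb).1]
    · rw [hR'.kind_new v hv, hR.kind_new v hv]
  · rcases (hR'.mem_nodes b).1 hb with hb | ⟨v, hv, rfl⟩
    · rw [hR'.skel_eq b hb, hskel₀ b hb, hR.skel_eq b ((hmem₀ b).1 hb).1]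
    · rw [hR'.skel_new v hv, hR.skel_new v hv, hskel₀ v (hS₀ v hv)]
  · have hca := hsec c hce hcs
    subst hca
    have hbL := (hR.parent_iff_of_notMem haL ha).1 hbc
    have hbT : T.parent b = some e := by
      rcases hpar b with ⟨-, hne, -⟩ | ⟨rfl, -⟩ | ⟨-, hp⟩
      · exact absurd hbL hne
      · exact absurd rfl (parent_ne hbL)
      · exact hp
    have hbT₀ : T₀.parent b = some e := by rwa [← hs.parent_eq]
    obtain ⟨h1, h2⟩ := hR'.parent_notMem hbT₀ he
    refine ⟨h1, iff_of_false (fun hbs => ?_) fun hbs => haR hbs.2⟩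
    have := ((hsol b).1 (h2.1 hbs)).2
    rw [hbT, hbL] at this
    exact hea (Option.some_injective _ this)
  · rcases (hR'.mem_nodes b).1 hb with hb | ⟨v, hv, rfl⟩
    · have hbL := (hmem₀ b).1 hb
      have hbp : T.parent b = L.parent b := by
        rcases hpar b with ⟨h', -⟩ | ⟨hba, -⟩ | ⟨hp, -⟩
        · exact h'
        · exact absurd hba hbL.2
        · exact absurd ⟨a, (hR.parent_iff_of_notMem haL ha).2 hp, hpe, hRa⟩ hno
      refine hR.agree hR' hbL.1 hb ?_ ?_ (fun _ _ => Iff.rfl) fun v hv hd => hi v hv b hd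
      · rw [← hs.parent_eq]
        exact hbp
      · rw [hsol]
        exact and_iff_left hbp
    · exact ⟨(hR'.parent_new v hv).trans (hR.parent_new v hv).symm,
        iff_of_false (hR'.dashed_new v hv) (hR.dashed_new v hv)⟩

lemma IsPreSplit.exists_link [Infinite ν] {G₁ G₂ : Graph α β} {x : α} {a e : ν}
    {T₁ T₂ R₁ R₂ : PDTree ν α β} (h₁ : IsPreSplit G₁ none T₁ R₁) (h₂ : IsPreSplit G₂ (some e) T₂ R₂)
    (hdis : Disjoint R₁.nodes R₂.nodes) (hG : IsUnionAt G G₁ G₂ x) (hxa : x ∈ V(T₁.skel a))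
    (hxe : x ∈ V(T₂.skel e)) (hl : StrictLink T₁ T₂ a e T) (hT : IsStrictBC G T) :
    ∃ R₀ R' k l, IsLinked R₁ R₂ a e R₀ ∧ Steps R₀ R' k l ∧ IsPreSplit G (some e) T R' ∧ l.Nodup ∧
      (∀ f ∈ l, f ∈ changedLink T₁ T₂ e T) ∧ k ≤ 4 * ((changedLink T₁ T₂ e T).ncard + 1) := by
  classical
  obtain ⟨n₁, hS₁, hI₁⟩ := h₁.exists_splitting
  obtain ⟨n₂, hS₂, hI₂⟩ := h₂.exists_splitting
  obtain ⟨L, hL, hc⟩ := hl.linked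
  have hA₁ := h₁.strict.alternating
  have hA₂ := h₂.strict.alternating
  have hex := hl.before_right
  replace hS₁ := hS₁.congr_names (m := fun v => if v ∈ T₁.nodes then n₁ v else n₂ v)
    fun v hv => if_pos (splitNodes_mem_nodes hv)
  replace hS₂ := hS₂.congr_names (m := fun v => if v ∈ T₁.nodes then n₁ v else n₂ v)
    fun v hv => if_neg fun hv' => hL.notMem_right hv' (splitNodes_mem_nodes hv)
  obtain ⟨T₀, hs, hj, hsol⟩ := hc.exists_joined hL hA₁ hA₂ hex
  have hT₀ := hs.symm.isStrictBC hT
  have ha : a ∉ T₁.splitNodes := fun h' => hj.splitNodes_ne_left h' rfl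
  have he : e ∉ T₂.splitNodes := fun h' => Joined.splitNodes_ne_right hex h' rfl
  obtain ⟨R₀, hRl, hR₀, hr₁, hr₂⟩ := hL.exists_splitting hS₁ hS₂ hdis ha he
  have hsp := hj.splitNodes_eq hex
  have hea : e ≠ a := (parent_ne hL.parent_a).symm
  -- the linked tree, after contracting `a` into `e` if necessary, is a split tree of `T₀`
  have hstep : ∃ R k, Steps R₀ R k [] ∧ k ≤ 1 ∧
      Splitting T₀ T₀.splitNodes (fun v => if v ∈ T₁.nodes then n₁ v else n₂ v) R ∧
      InnerHeavy T₀ T₀.splitNodes R := by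
    rcases hc.parent_cases hL hA₁ hA₂ with ⟨haT, hpar⟩ | ⟨⟨haT, hka, hke⟩, hpar⟩
    · have hLT : SameTree L T₀ := by
        have hnodes : T.nodes = L.nodes := by
          ext b
          rw [hc.mem_nodes]
          refine ⟨fun hb => hb.1, fun hb => ?_⟩
          by_cases hba : b = a
          · exact hba ▸ (hc.mem_nodes a).1 haT
          · exact hL.primary hA₁ hA₂ hb hba
        refine ⟨hs.nodes_eq.symm.trans hnodes, hs.root_eq.symm.trans hc.root_eq,
          hs.parent_eq.symm.trans (funext hpar), fun b hb => ?_, fun b hb => ?_⟩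
        · rw [← hnodes] at hb
          rw [← hs.kind_eq b (hs.nodes_eq ▸ hb), hc.kind_eq b hb]
        · rw [← hnodes] at hb
          rw [← hs.skel_eq b (hs.nodes_eq ▸ hb), hc.skel_eq b hb]
      refine ⟨R₀, 0, Steps.refl R₀, Nat.zero_le 1, ?_, hj.innerHeavy hT₀.uniqueC hG h₁.strict
        h₂.strict hxa hxe hex hI₁ hI₂ hr₁ hr₂⟩
      rw [hsp]
      exact hR₀.congr_tree hLT fun b => (hsol b).trans (and_iff_left (hpar b))
    · have haS : a ∉ T₁.splitNodes ∪ T₂.splitNodes := by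
        rintro (h' | h')
        · exact ha h'
        · exact hL.notMem_right hL.a_mem (splitNodes_mem_nodes h')
      have heS : e ∉ T₁.splitNodes ∪ T₂.splitNodes := by
        rintro (h' | h')
        · exact hL.notMem_right (splitNodes_mem_nodes h') hL.mem_right
        · exact he h'
      have hd₁ : ∀ v ∈ T₁.splitNodes, ∀ b, L.DashedChild b v ↔ T₁.DashedChild b v :=
        fun v hv b => by
          unfold DashedChild
          rw [← hL.parent_left_iff (splitNodes_mem_nodes hv)]
          exact and_congr_right fun hp => not_congr (hL.solid_left_iff (mem_child hp))
      have hd₂ : ∀ v ∈ T₂.splitNodes, ∀ b, L.DashedChild b v ↔ T₂.DashedChild b v :=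
        fun v hv b => by
          unfold DashedChild
          rw [hL.parent_right_iff (splitNodes_mem_nodes hv),
            or_iff_left fun h' => Joined.splitNodes_ne_right hex hv h'.2]
          exact and_congr_right fun hp => not_congr (hL.solid_right_iff (mem_child hp))
      have hSa : ∀ v ∈ T₁.splitNodes ∪ T₂.splitNodes, ∀ b,
          L.DashedChild b v ↔ T₀.DashedChild b v := by
        rintro v (hv | hv) b
        · rw [hd₁ v hv b, hj.dashedChild_left (splitNodes_mem_nodes hv) (hj.splitNodes_ne_left hv)]
        · rw [hd₂ v hv b, hj.dashedChild_right (splitNodes_mem_nodes hv)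
            (Joined.splitNodes_ne_right hex hv)]
      have hmem : ∀ b, b ∈ T.nodes ↔ b ∈ L.nodes ∧ b ≠ a := fun b =>
        ⟨fun hb => ⟨((hc.mem_nodes b).1 hb).1, fun hba => haT (hba ▸ hb)⟩, fun hb =>
          (hc.mem_nodes b).2 (hL.primary hA₁ hA₂ hb.1 hb.2)⟩
      obtain ⟨R, hm, hR, hi⟩ := hL.exists_isMerge hA₂ hR₀ hRl haS heS hc hs hsol hmem hka hke hpar hSa
      refine ⟨R, 1, (Steps.refl R₀).merge hm, le_rfl, hsp ▸ hR, hj.innerHeavy hT₀.uniqueC hG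
        h₁.strict h₂.strict hxa hxe hex hI₁ hI₂ (fun v hv b hb => ?_) fun v hv b hb => ?_⟩
      · rw [hi v (Or.inl hv) b ((hd₁ v hv b).2 hb), hr₁ v hv b hb]
      · rw [hi v (Or.inr hv) b ((hd₂ v hv b).2 hb), hr₂ v hv b hb]
  obtain ⟨R, k₀, hst₀, hk₀, hR, hI⟩ := hstep
  obtain ⟨R', k, l, hst, hpre, hln, hlc, hk⟩ :=
    hR.exists_isPreSplit hI hT₀ hs (e := some e) hl.after
  have hsub : changed T₀ T ⊆ changedLink T₁ T₂ e T := by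
    refine hj.changed_subset hs hL hsol hl.after ?_
    rcases hc.parent_cases hL hA₁ hA₂ with ⟨haT, hpar⟩ | ⟨⟨haT, -, -⟩, hpar⟩
    · exact Or.inl ⟨haT, hpar⟩
    · refine Or.inr ⟨haT, fun u hu => ?_⟩
      rcases hpar u with ⟨-, hne, -⟩ | ⟨rfl, -⟩ | ⟨-, hp⟩
      · exact absurd hu hne
      · exact absurd rfl (parent_ne hu)
      · exact hp
  have hcard := Set.ncard_le_ncard hsub finite_changedLink
  refine ⟨R₀, R', _, _, hRl, hst₀.trans hst, hpre, by simpa using hln, fun f hf => ?_, ?_⟩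
  · rw [List.append_nil] at hf
    exact hsub (hlc f hf)
  · omega

end PDTree
end BCT

theorem mainTheorem10 :
    ∃ K : ℕ, ∀ (ν : Type*) (α : Type*) (β : Type*) [Infinite ν],
      -- expose
      (∀ (G : Graph α β) (e : ν) (T T' R : BCT.PDTree ν α β),
        BCT.PDTree.IsPreSplit G none T R → BCT.PDTree.StrictExpose T e T' →
        ∃ (R' : BCT.PDTree ν α β) (k : ℕ) (l : List (Sym2 ν)),
          BCT.PDTree.Steps R R' k l ∧
          BCT.PDTree.IsPreSplit G (some e) T' R' ∧
          l.Nodup ∧ (∀ f ∈ l, f ∈ BCT.PDTree.changed T T') ∧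
          k ≤ K * (BCT.PDTree.changed T T').ncard) ∧
      -- conceil
      (∀ (G : Graph α β) (e : ν) (T T' R : BCT.PDTree ν α β),
        BCT.PDTree.IsPreSplit G (some e) T R → BCT.PDTree.StrictConceil T e T' →
        ∃ (R' : BCT.PDTree ν α β) (k : ℕ) (l : List (Sym2 ν)),
          BCT.PDTree.Steps R R' k l ∧
          BCT.PDTree.IsPreSplit G none T' R' ∧
          l.Nodup ∧ (∀ f ∈ l, f ∈ BCT.PDTree.changed T T') ∧
          k ≤ K * (BCT.PDTree.changed T T').ncard) ∧
      -- reverse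
      (∀ (G : Graph α β) (e : ν) (T T' R : BCT.PDTree ν α β),
        BCT.PDTree.IsPreSplit G (some e) T R → BCT.PDTree.StrictReverse T e T' →
        ∃ (R₀ R' : BCT.PDTree ν α β) (k : ℕ) (l : List (Sym2 ν)),
          BCT.PDTree.SameTreeRerooted R e R₀ ∧ R₀.solidEdges = R.solidEdges ∧
          BCT.PDTree.Steps R₀ R' k l ∧
          BCT.PDTree.IsPreSplit G (some T.root) T' R' ∧
          l.Nodup ∧ (∀ f ∈ l, f ∈ BCT.PDTree.changed T T') ∧
          k ≤ K * (BCT.PDTree.changed T T').ncard) ∧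
      -- link-exposed
      (∀ (G G₁ G₂ : Graph α β) (x : α) (a e : ν) (T₁ T₂ T' R₁ R₂ : BCT.PDTree ν α β),
        BCT.PDTree.IsPreSplit G₁ none T₁ R₁ → BCT.PDTree.IsPreSplit G₂ (some e) T₂ R₂ →
        Disjoint R₁.nodes R₂.nodes → BCT.IsUnionAt G G₁ G₂ x →
        x ∈ V(T₁.skel a) → x ∈ V(T₂.skel e) →
        BCT.PDTree.StrictLink T₁ T₂ a e T' → BCT.PDTree.IsStrictBC G T' →
        ∃ (R₀ R' : BCT.PDTree ν α β) (k : ℕ) (l : List (Sym2 ν)),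
          BCT.PDTree.IsLinked R₁ R₂ a e R₀ ∧
          BCT.PDTree.Steps R₀ R' k l ∧
          BCT.PDTree.IsPreSplit G (some e) T' R' ∧
          l.Nodup ∧ (∀ f ∈ l, f ∈ BCT.PDTree.changedLink T₁ T₂ e T') ∧
          k ≤ K * ((BCT.PDTree.changedLink T₁ T₂ e T').ncard + 1)) ∧
      -- cut-exposed
      (∀ (G G₁ G₂ : Graph α β) (a e : ν) (T T₁ T₂ R : BCT.PDTree ν α β),
        BCT.PDTree.IsPreSplit G (some e) T R →
        BCT.PDTree.StrictCut T a e T₁ T₂ →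
        BCT.PDTree.IsStrictBC G₁ T₁ → BCT.PDTree.IsStrictBC G₂ T₂ →
        ∃ (Q₁ Q₂ R₁ R₂ : BCT.PDTree ν α β) (k₁ k₂ : ℕ) (l₁ l₂ : List (Sym2 ν)),
          BCT.PDTree.IsCut R a e Q₁ Q₂ ∧
          BCT.PDTree.Steps Q₁ R₁ k₁ l₁ ∧ BCT.PDTree.Steps Q₂ R₂ k₂ l₂ ∧
          BCT.PDTree.IsPreSplit G₁ none T₁ R₁ ∧
          BCT.PDTree.IsPreSplit G₂ (some e) T₂ R₂ ∧
          (l₁ ++ l₂).Nodup ∧ (∀ f ∈ l₁ ++ l₂, f ∈ BCT.PDTree.changedCut T T₁ T₂) ∧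
          k₁ + k₂ ≤ K * (BCT.PDTree.changedCut T T₁ T₂).ncard) := by
  refine ⟨4, fun ν α β _ => ⟨?_, ?_, ?_, ?_, ?_⟩⟩
  · intro G e T T' R h hop
    exact h.exists_sameTree (e' := some e) hop.same hop.after
  · intro G e T T' R h hop
    exact h.exists_sameTree (e' := none) hop.same hop.after
  · intro G e T T' R h hop
    exact h.exists_reverse hop
  · intro G G₁ G₂ x a e T₁ T₂ T' R₁ R₂ h₁ h₂ hdis hG hxa hxe hop hT'
    exact h₁.exists_link h₂ hdis hG hxa hxe hop hT'
  · intro G G₁ G₂ a e T T₁ T₂ R h hop h₁ h₂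
    exact h.exists_cut hop h₁ h₂
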